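/- Throughout, $\log$ is the logarithm to base $2$ and $\ln$ the natural logarithm. Let $n,d,U\ge 1$ be integers, let $H\in\{\pm1\}^{d\times d}$ be a Hadamard matrix ($HH^{\top}=dI$; for example the Sylvester matrix when $d$ is a power of $2$), and let $\varepsilon>0$, $\delta,\beta\in(0,1)$. User $i\in[n]$ holds $x_i\in\mathbb Z^d$ with $\|x_i\|_2\le U$; put $D=(x_1,\dots,x_n)$, $\mathrm{Sum}(D)=\sum_i x_i$, $\mathrm{Max}_{\ell_2}(D)=\max_i\|x_i\|_2$. A one-round shuffle protocol consists of a local randomizer, which sends a random multiset of messages, and an analyzer, which sees only the multiset union of the messages of all users (and the public randomness). An algorithm $\mathcal M$ is $(\varepsilon,\delta)$-DP if $\Pr[\mathcal M(D)\in Y]\le e^{\varepsilon}\Pr[\mathcal M(D')\in Y]+\delta$ for all sets $Y$ of outputs and all $D,D'$ of the same size that differ in the element of one user. **BaseSumDP** with parameters $(\varepsilon,\delta,n,V)$, $V$ a power of $2$, for inputs in $\{0,\dots,V\}$. Let $\lambda=0.1$, $\zeta=\min(0.1,0.1/\varepsilon)$; let $V'=V$ if $V\le\sqrt{n/\zeta}$,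 and otherwise let $V'$ be $\sqrt{n/\zeta}$ rounded down to a power of $2$; let $B=V/V'$. A user with input $x$ rounds $x/B$ at random, without bias, to one of the two neighbouring integers, sends the result if it is non-zero, and adds noise messages in $\{-V',\dots,V'\}\setminus\{0\}$: with $\mathrm{NB}(r,p)$ the negative binomial distribution (mass $\frac{r(r+1)\cdots(r+k-1)}{k!}(1-p)^rp^k$ at $k\ge 0$), the user sends, all independently, $\mathrm{NB}(1/n,e^{-(1-\lambda)\varepsilon/V'})$ copies of each of the messages $1$ and $-1$; and, for each of the zero-sum multisets $\{1,-1\}$ ($v=1$) and $\pm\{v,-\lfloor v/2\rfloor,-\lceil v/2\rceil\}$ ($2\le v\le V'$), $\mathrm{NB}(r/n,e^{-0.1\,\varepsilon_0 v/V'})$ copies of it, where $r=3(1+\ln(\Gamma/\delta))$, $\varepsilon_0=\min(1,\lambda\varepsilon/\Gamma)$, $\Gamma=4\log V'+1$. The analyzer returns $B$ times the sum of all messages. **SumDP** with parameters $(\varepsilon,\delta,\beta,n,2^J)$, for inputs in $\{0,\dots,2^J\}$. For each level $j=0,\dots,J$ run BaseSumDP with parameters $(\varepsilon,\delta,n,2^j)$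 on the inputs that lie in $[2^{j-1}+1,2^j]$ (with $2^{-1}:=0$), all other inputs being replaced by $0$; messages carry the label $j$. If $j^*$ is the last level whose estimate exceeds $1.3\cdot 2^j\ln(2(J+1)/\beta)/\varepsilon$, return the sum of the estimates of the levels $0,\dots,j^*$; if there is none, return $0$. **HighDimSumDP.** Let $P$ be a diagonal matrix with independent uniform $\pm1$ diagonal entries (public randomness), $W=HP$, $\varepsilon'=\varepsilon/(4\sqrt{d\log(2/\delta)})$, $\delta'=\delta/(4d)$, $\bar U=U\sqrt{2\log(8nd/\beta)}$, and let $2^J$ be $\bar U$ rounded up to a power of $2$. For each coordinate $k\in[d]$ run SumDP with parameters $(\varepsilon',\delta',\beta/(2d),n,2^J)$ twice: on the positive parts and on the negative parts of $(Wx_i)^k$, both clipped at $\lfloor\bar U\rfloor$; messages carry the labels $k$ and $\pm$. The analyzer subtracts the negative from the positive estimate in each coordinate and applies $W^{-1}$. **Theorem.** For all $\varepsilon_0>0$ and $\delta_0,\beta_0<1$ there is a constant $C>0$ (depending on nothing else) such that for all parameters as above with $\varepsilon\le\varepsilon_0$, $\delta\le\delta_0$, $\beta\le\beta_0$: 1.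 (Privacy) If $\varepsilon\le 3\log(2/\delta)$, then for every value of the public signs the messages received by the analyzer are $(\varepsilon,\delta)$-DP. 2. (Utility) If $U\ge2$, then for every $D$ with $\mathrm{Max}_{\ell_2}(D)\le U$, with probability at least $1-\beta$ the $\ell_2$ distance of the output to $\mathrm{Sum}(D)$ is at most $$C\cdot\mathrm{Max}_{\ell_2}(D)\cdot\sqrt{d\,\log(nd/\beta)\,\log(1/\delta)}\cdot\log(d\log(U)/\beta)/\varepsilon .$$ 3. (Communication) If $U\ge2$, $n\ge2$ and $\delta\le 1/n$, then for every value of the public signs each user sends in expectation at most $$d+C\cdot d^{1.5}\cdot\log\bigl(U\log(nd/\beta)\bigr)\cdot\log^{1.5}(d/\delta)\cdot\log^2 n/(\varepsilon\sqrt n)$$ messages. 4. (Message size) If $U\ge2$ and $n\ge2$, then every message, including its labels, can be encoded by $$C\Bigl(\log d+\log\log\bigl(U\log(nd/\beta)\bigr)+\min\bigl(\log n,\log(U\log(nd/\beta))\bigr)\Bigr)$$ bits; if moreover $\log(nd/\beta)\le U$ and $\log U\le nd$, then $C(\log d+\min(\log n,\log U))$ bits suffice. -/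

import Mathlib

open scoped ENNReal

noncomputable section

namespace ShuffleSum

/-! ### Discrete distributions -/

/-- Weight of `k` under the negative binomial law: `(r)(r+1)⋯(r+k-1)/k! · (1-p)^r p^k`. -/
def negBinWeight (r p : ℝ) (k : ℕ) : ℝ :=
  Ring.multichoose r k * (1 - p) ^ r * p ^ k

theorem multichoose_nonneg {r : ℝ} (hr : 0 < r) (k : ℕ) : 0 ≤ Ring.multichoose r k := by
  have h := Ring.factorial_nsmul_multichoose_eq_ascPochhammer r k
  have h2 : 0 ≤ (ascPochhammer ℕ k).smeval r := by
    rw [Polynomial.ascPochhammer_smeval_eq_eval]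
    exact (ascPochhammer_pos k r hr).le
  rw [← h, nsmul_eq_mul] at h2
  exact nonneg_of_mul_nonneg_right h2 (by exact_mod_cast k.factorial_pos)

theorem negBinWeight_nonneg {r p : ℝ} (hr : 0 < r) (hp : 0 < p) (hp1 : p < 1) (k : ℕ) :
    0 ≤ negBinWeight r p k :=
  mul_nonneg (mul_nonneg (multichoose_nonneg hr k) (Real.rpow_nonneg (by linarith) _))
    (pow_nonneg hp.le _)

theorem negBinWeight_hasSum {r p : ℝ} (hp : 0 < p) (hp1 : p < 1) :
    HasSum (negBinWeight r p) 1 := by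
  have h := (Real.one_div_one_sub_rpow_hasFPowerSeriesOnBall_zero r).hasSum (y := p) (by
    simp [enorm_eq_nnnorm, ← NNReal.coe_lt_coe, abs_of_pos hp, hp1])
  have hq : (1 - p) ^ r ≠ 0 := (Real.rpow_pos_of_pos (by linarith) r).ne'
  have h2 := h.mul_right ((1 - p) ^ r)
  have e : 1 / (1 - (0 + p)) ^ r * (1 - p) ^ r = 1 := by
    rw [zero_add, one_div, inv_mul_cancel₀ hq]
  rw [e] at h2
  refine h2.congr_fun fun k => ?_
  simp [negBinWeight, FormalMultilinearSeries.ofScalars, Ring.multichoose_eq]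
  ring

/-- Negative binomial distribution `NB(r, p)` with real shape `r > 0` and `0 < p < 1` (number of
successes of probability `p` before the `r`-th failure); the point mass at `0` for other
parameters. `NB(1, p)` is geometric, and the sum of `n` independent copies of `NB(r/n, p)` is
`NB(r, p)`. -/
def negBin (r p : ℝ) : PMF ℕ :=
  open Classical in
  if h : 0 < r ∧ 0 < p ∧ p < 1 then
    ⟨fun k => ENNReal.ofReal (negBinWeight r p k), by
      have hs := negBinWeight_hasSum (r := r) h.2.1 h.2.2
      have := ENNReal.ofReal_tsum_of_nonneg (negBinWeight_nonneg h.1 h.2.1 h.2.2) hs.summable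
      rw [hs.tsum_eq, ENNReal.ofReal_one] at this
      rw [this]
      exact ENNReal.summable.hasSum⟩
  else PMF.pure 0

/-- Multiset union of independent random multisets. -/
def indepUnion {α : Type*} (L : List (PMF (Multiset α))) : PMF (Multiset α) :=
  L.foldr (fun μ ν => μ.bind fun S => ν.map fun T => S + T) (PMF.pure 0)

/-- Expected number of messages in a random multiset. -/
def expectedCard {α : Type*} (μ : PMF (Multiset α)) : ℝ≥0∞ :=
  ∑' S : Multiset α, μ S * (Multiset.card S : ℝ≥0∞)

/-! ### Differential privacy -/

/-- Two data sets (of the same size) that differ in the element of a single user. -/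
def Neighbor {X : Type*} {n : ℕ} (D D' : Fin n → X) : Prop :=
  ∃ i, ∀ i', i' ≠ i → D i' = D' i'

/-- `(ε, δ)`-differential privacy of a randomized algorithm with discrete output. -/
def IsDP {X Y : Type*} {n : ℕ} (M : (Fin n → X) → PMF Y) (ε δ : ℝ) : Prop :=
  ∀ D D' : Fin n → X, Neighbor D D' → ∀ S : Set Y,
    (M D).toOuterMeasure S ≤
      ENNReal.ofReal (Real.exp ε) * (M D').toOuterMeasure S + ENNReal.ofReal δ

/-- What the analyzer of a one-round shuffle protocol with local randomizer `R` receives: the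
multiset union of the messages of all users. -/
def shuffled {X Z : Type*} {n : ℕ} (R : X → PMF (Multiset Z)) (D : Fin n → X) :
    PMF (Multiset Z) :=
  indepUnion (List.ofFn fun i => R (D i))

/-! ### BaseSumDP: one-dimensional sums over `{0, …, U}`

Invoked with `λ = 0.1` and `ζ = min(0.1, 0.1/ε)`. The sizes `U` are powers of two. -/

def lam : ℝ := 0.1

def zeta (ε : ℝ) : ℝ := min 0.1 (0.1 / ε)

/-- The reduced domain size `U'`: it is `U` if `U ≤ √(n/ζ)`, and otherwise `√(n/ζ)`, rounded down
to a power of two. -/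
def reducedSize (ε : ℝ) (n U : ℕ) : ℕ :=
  open Classical in
  if Real.sqrt (n / zeta ε) < U then 2 ^ ⌊Real.logb 2 (Real.sqrt (n / zeta ε))⌋₊ else U

/-- The width `B = U / U'` of the grid to which inputs are rounded (both are powers of two). -/
def gridWidth (ε : ℝ) (n U : ℕ) : ℕ := U / reducedSize ε n U

/-- Unbiased randomized rounding of `x / B` to one of the two neighboring integers:
`⌊x/B⌋ + 1` with probability `(x mod B)/B` and `⌊x/B⌋` otherwise. -/
def randRound (B x : ℕ) : PMF ℕ :=
  if h : B = 0 then PMF.pure x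
  else
    haveI : NeZero B := ⟨h⟩
    (PMF.uniformOfFintype (Fin B)).map fun u => if (u : ℕ) < x % B then x / B + 1 else x / B

/-- The zero-sum multisets of the correlated noise: `{1, -1}` for `v = 1`, and
`{v, -⌊v/2⌋, -⌈v/2⌉}` for `v ≥ 2`. -/
def zeroSum (v : ℕ) : Multiset ℤ :=
  if v = 1 then {1, -1} else {(v : ℤ), -((v / 2 : ℕ) : ℤ), -(((v + 1) / 2 : ℕ) : ℤ)}

/-- Bound on the number of zero-sum multisets that the change of one input can involve: two for
each of the `⌈log U'⌉` halving steps of the old and of the new value, and `{1, -1}`. -/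
def floodParts (U' : ℕ) : ℕ := 4 * Nat.clog 2 U' + 1

/-- One user's share of the zero-sum noise carried by the multiset `s` of largest absolute value
`v`. In total (over the `n` users) the number of copies of `s` is `NB(r, p)`-distributed with
`r = 3(1 + ln(1/δ₀))`, `p = exp(-0.2 ε₀/t)`, where `t = 2U'/v` bounds the number of copies that
the change of one input can account for, and `ε₀`, `δ₀` are the shares of the flooding budget
`(λε, δ)` (`ε₀` is capped at `1`). -/
def floodNoise (ε δ : ℝ) (n U' v : ℕ) (s : Multiset ℤ) : PMF (Multiset ℤ) :=
  let ε₀ : ℝ := min 1 (lam * ε / floodParts U')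
  let δ₀ : ℝ := δ / floodParts U'
  let t : ℝ := 2 * U' / v
  (negBin (3 * (1 + Real.log (1 / δ₀)) / n) (Real.exp (-(0.2 * ε₀ / t)))).map fun z => z • s

/-- One user's share of the central noise carried by the message `w ∈ {1, -1}`. In total the
numbers of copies of `1` and of `-1` are geometric, so that their difference has the discrete
Laplace distribution with mass proportional to `exp(-(1-λ)ε|k|/U')`. -/
def centralNoise (ε : ℝ) (n U' : ℕ) (w : ℤ) : PMF (Multiset ℤ) :=
  (negBin (1 / n) (Real.exp (-((1 - lam) * ε / U')))).map fun z => z • ({w} : Multiset ℤ)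

/-- The noise messages of one user, all in `{-U', …, U'} \ {0}`: central noise on `±1`, flooding
noise on `{1, -1}`, and flooding noise on `±{v, -⌊v/2⌋, -⌈v/2⌉}` for `2 ≤ v ≤ U'`. -/
def noise (ε δ : ℝ) (n U' : ℕ) : PMF (Multiset ℤ) :=
  indepUnion
    ([centralNoise ε n U' 1, centralNoise ε n U' (-1), floodNoise ε δ n U' 1 (zeroSum 1)] ++
      (List.range' 2 (U' - 1)).flatMap fun v =>
        [floodNoise ε δ n U' v (zeroSum v),
          floodNoise ε δ n U' v ((zeroSum v).map fun w => -w)])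

/-- Randomizer of BaseSumDP on the domain `{0, …, U}`. -/
def baseRandomizer (ε δ : ℝ) (n U x : ℕ) : PMF (Multiset ℤ) :=
  (randRound (gridWidth ε n U) x).bind fun x' =>
    (noise ε δ n (reducedSize ε n U)).map fun T =>
      (if x' = 0 then 0 else {(x' : ℤ)}) + T

/-- Analyzer of BaseSumDP on the domain `{0, …, U}`. -/
def baseAnalyzer (ε : ℝ) (n U : ℕ) (R : Multiset ℤ) : ℝ :=
  (gridWidth ε n U : ℝ) * (R.sum : ℝ)

/-! ### SumDP: one-dimensional sums over `{0, …, 2^J}`; a message is `(level, value)` -/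

/-- `x ∈ [2^(j-1)+1, 2^j]`, with the convention `2^(-1) = 0`. -/
def InLevel (j x : ℕ) : Prop := (if j = 0 then 0 else 2 ^ (j - 1)) < x ∧ x ≤ 2 ^ j

instance (j x : ℕ) : Decidable (InLevel j x) :=
  inferInstanceAs (Decidable (_ ∧ _))

/-- Randomizer of SumDP. -/
def sumRandomizer (ε δ : ℝ) (n J x : ℕ) : PMF (Multiset (ℕ × ℤ)) :=
  indepUnion ((List.range (J + 1)).map fun j =>
    (baseRandomizer ε δ n (2 ^ j) (if InLevel j x then x else 0)).map fun S =>
      S.map fun v => (j, v))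

/-- The estimate of the sum of the inputs in level `j`. -/
def levelEstimate (ε : ℝ) (n : ℕ) (R : Multiset (ℕ × ℤ)) (j : ℕ) : ℝ :=
  baseAnalyzer ε n (2 ^ j) ((R.filter fun m => m.1 = j).map fun m => m.2)

/-- `log τ + 1` for the threshold `τ` that SumDP selects, i.e. one more than the last level whose
estimate exceeds `1.3 · 2^j · ln(2(log U + 1)/β)/ε`, where `U = 2^J`; and `0` if there is none. -/
def levelsKept (ε β : ℝ) (n J : ℕ) (R : Multiset (ℕ × ℤ)) : ℕ :=
  open Classical in
  ((Finset.range (J + 1)).filter fun j =>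
    1.3 * 2 ^ j * Real.log (2 * (J + 1) / β) / ε < levelEstimate ε n R j).sup fun j => j + 1

/-- Analyzer of SumDP: the sum of the estimates of all levels up to `log τ`. -/
def sumAnalyzer (ε β : ℝ) (n J : ℕ) (R : Multiset (ℕ × ℤ)) : ℝ :=
  ∑ j ∈ Finset.range (levelsKept ε β n J R), levelEstimate ε n R j

/-! ### HighDimSumDP

All `log` are to base `2`. A message is `(coordinate, sign, level, value)`, where the sign is
`true` for the positive part. -/

abbrev Message (d : ℕ) := Fin d × Bool × (ℕ × ℤ)

/-- The rotation `W = H P`, where `P` is the diagonal matrix with diagonal `σ`. -/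
def rotation {d : ℕ} (H : Matrix (Fin d) (Fin d) ℤ) (σ : Fin d → ℤˣ) :
    Matrix (Fin d) (Fin d) ℤ :=
  H * Matrix.diagonal fun k => (σ k : ℤ)

/-- The bound `U √(2 log(8nd/β))` on the rotated coordinates. -/
def coordBound (d n U : ℕ) (β : ℝ) : ℝ :=
  U * Real.sqrt (2 * Real.logb 2 (8 * n * d / β))

/-- SumDP is run on the domain `{0, …, 2^J}`, where `2^J` is the bound on the rotated coordinates,
rounded up to a power of two. -/
def topLevel (d n U : ℕ) (β : ℝ) : ℕ := ⌈Real.logb 2 (coordBound d n U β)⌉₊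

/-- The positive (`s = true`) or negative (`s = false`) part of `y`, clipped at the bound. -/
def clippedPart (d n U : ℕ) (β : ℝ) (s : Bool) (y : ℤ) : ℕ :=
  min (if s then y else -y).toNat ⌊coordBound d n U β⌋₊

/-- Privacy budget `ε'` of each instance of SumDP. -/
def coordEps (d : ℕ) (ε δ : ℝ) : ℝ := ε / (4 * Real.sqrt (d * Real.logb 2 (2 / δ)))

/-- Privacy budget `δ'` of each instance of SumDP. -/
def coordDelta (d : ℕ) (δ : ℝ) : ℝ := δ / (4 * d)

/-- Randomizer of HighDimSumDP, run by one user with input `x`. -/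
def highDimRandomizer {d : ℕ} (H : Matrix (Fin d) (Fin d) ℤ) (n U : ℕ) (ε δ β : ℝ)
    (σ : Fin d → ℤˣ) (x : Fin d → ℤ) : PMF (Multiset (Message d)) :=
  indepUnion ((List.finRange d).flatMap fun k => [true, false].map fun s =>
    (sumRandomizer (coordEps d ε δ) (coordDelta d δ) n (topLevel d n U β)
      (clippedPart d n U β s ((rotation H σ).mulVec x k))).map fun S =>
        S.map fun m => (k, s, m))

/-- The estimate, from the received messages `R`, of the sum of the positive (negative) parts of
the `k`-th rotated coordinates. -/
def coordEstimate {d : ℕ} (n U : ℕ) (ε δ β : ℝ) (R : Multiset (Message d)) (k : Fin d)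
    (s : Bool) : ℝ :=
  sumAnalyzer (coordEps d ε δ) (β / (2 * d)) n (topLevel d n U β)
    ((R.filter fun m => m.1 = k ∧ m.2.1 = s).map fun m => m.2.2)

/-- Analyzer of HighDimSumDP. -/
def highDimAnalyzer {d : ℕ} (H : Matrix (Fin d) (Fin d) ℤ) (n U : ℕ) (ε δ β : ℝ)
    (σ : Fin d → ℤˣ) (R : Multiset (Message d)) : Fin d → ℝ :=
  ((rotation H σ).map fun a => (a : ℝ))⁻¹.mulVec fun k =>
    coordEstimate n U ε δ β R k true - coordEstimate n U ε δ β R k false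

/-- Output of the whole protocol on the data set `D`; the signs `σ` are public randomness. -/
def highDimOutput {d n : ℕ} (H : Matrix (Fin d) (Fin d) ℤ) (U : ℕ) (ε δ β : ℝ)
    (D : Fin n → Fin d → ℤ) : PMF (Fin d → ℝ) :=
  (PMF.uniformOfFintype (Fin d → ℤˣ)).bind fun σ =>
    (shuffled (highDimRandomizer H n U ε δ β σ) D).map (highDimAnalyzer H n U ε δ β σ)

/-- The messages that a user can possibly send. -/
def possibleMessages {d : ℕ} (H : Matrix (Fin d) (Fin d) ℤ) (n U : ℕ) (ε δ β : ℝ) :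
    Set (Message d) :=
  {m | ∃ (σ : Fin d → ℤˣ) (x : Fin d → ℤ),
    ∃ S ∈ (highDimRandomizer H n U ε δ β σ x).support, m ∈ S}

/-- Every message can be encoded by a bit string of length at most `b`. -/
def EncodableInBits {d : ℕ} (A : Set (Message d)) (b : ℝ) : Prop :=
  ∃ enc : Message d → List Bool, Set.InjOn enc A ∧ ∀ m ∈ A, ((enc m).length : ℝ) ≤ b

/-- Euclidean norm. -/
def l2norm {d : ℕ} (v : Fin d → ℝ) : ℝ := Real.sqrt (∑ k, v k ^ 2)

/-- `Max_{ℓ₂}(D)`, the largest Euclidean norm of an element of `D`. -/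
def maxL2 {d n : ℕ} (D : Fin n → Fin d → ℤ) : ℝ := ⨆ i, l2norm fun k => (D i k : ℝ)

end ShuffleSum

end

open ShuffleSum

noncomputable section

namespace ShuffleSum

/-! ### Expectations with respect to discrete distributions -/

section Expectation

variable {α β : Type*}

/-- Expectation of a nonnegative function under a discrete distribution. -/
def ev (μ : PMF α) (f : α → ℝ≥0∞) : ℝ≥0∞ := ∑' x, μ x * f x

theorem ev_pure (a : α) (f : α → ℝ≥0∞) : ev (PMF.pure a) f = f a := by
  rw [ev, tsum_eq_single a]
  · simp
  · intro b hb
    simp [PMF.pure_apply, hb]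

theorem ev_bind (μ : PMF α) (κ : α → PMF β) (f : β → ℝ≥0∞) :
    ev (μ.bind κ) f = ev μ fun a => ev (κ a) f := by
  simp only [ev, PMF.bind_apply, ← ENNReal.tsum_mul_right, ← ENNReal.tsum_mul_left]
  rw [ENNReal.tsum_comm]
  simp only [mul_assoc]

theorem ev_map (μ : PMF α) (g : α → β) (f : β → ℝ≥0∞) :
    ev (μ.map g) f = ev μ fun a => f (g a) := by
  rw [← PMF.bind_pure_comp, ev_bind]
  simp [ev_pure]

theorem ev_mono (μ : PMF α) {f g : α → ℝ≥0∞} (h : ∀ x, f x ≤ g x) : ev μ f ≤ ev μ g :=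
  ENNReal.tsum_le_tsum fun x => by gcongr; exact h x

theorem ev_mono_of_support (μ : PMF α) {f g : α → ℝ≥0∞} (h : ∀ x ∈ μ.support, f x ≤ g x) :
    ev μ f ≤ ev μ g :=
  ENNReal.tsum_le_tsum fun x => by
    by_cases hx : μ x = 0
    · simp [hx]
    · gcongr
      exact h x ((PMF.mem_support_iff _ _).2 hx)

theorem ev_add (μ : PMF α) (f g : α → ℝ≥0∞) : ev μ (fun x => f x + g x) = ev μ f + ev μ g := by
  simp [ev, mul_add, ENNReal.tsum_add]

theorem ev_const_mul (μ : PMF α) (c : ℝ≥0∞) (f : α → ℝ≥0∞) :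
    ev μ (fun x => c * f x) = c * ev μ f := by
  simp only [ev, ← ENNReal.tsum_mul_left]
  exact tsum_congr fun x => by ring

theorem ev_const (μ : PMF α) (c : ℝ≥0∞) : ev μ (fun _ => c) = c := by
  simp [ev, ENNReal.tsum_mul_right, μ.tsum_coe]

theorem ev_le_one (μ : PMF α) {f : α → ℝ≥0∞} (h : ∀ x, f x ≤ 1) : ev μ f ≤ 1 :=
  (ev_mono μ h).trans (ev_const μ 1).le

theorem toOuterMeasure_eq_ev (μ : PMF α) (S : Set α) :
    μ.toOuterMeasure S = ev μ (S.indicator 1) := by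
  classical
  rw [PMF.toOuterMeasure_apply, ev]
  refine tsum_congr fun x => ?_
  by_cases hx : x ∈ S <;> simp [hx]

theorem toOuterMeasure_le_one (μ : PMF α) (S : Set α) : μ.toOuterMeasure S ≤ 1 := by
  classical
  rw [toOuterMeasure_eq_ev]
  exact ev_le_one μ fun x => Set.indicator_le_self' (by simp) x

theorem toOuterMeasure_add_compl (μ : PMF α) (S : Set α) :
    μ.toOuterMeasure S + μ.toOuterMeasure Sᶜ = 1 := by
  classical
  rw [toOuterMeasure_eq_ev, toOuterMeasure_eq_ev, ← ev_add, ← ev_const μ 1]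
  congr 1
  funext x
  by_cases hx : x ∈ S <;> simp [hx]

/-- Markov's inequality. -/
theorem toOuterMeasure_le_ev (μ : PMF α) (S : Set α) {f : α → ℝ≥0∞} (h : ∀ x ∈ S, 1 ≤ f x) :
    μ.toOuterMeasure S ≤ ev μ f := by
  classical
  rw [toOuterMeasure_eq_ev]
  refine ev_mono μ fun x => ?_
  by_cases hx : x ∈ S
  · simpa [hx] using h x hx
  · simp [hx]

end Expectation

/-! ### Convolution of discrete distributions -/

section Convolution

variable {M N : Type*} [AddCommMonoid M] [AddCommMonoid N]

/-- Discrete distributions on a commutative monoid form a commutative monoid under convolution. -/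
instance convCommMonoid : CommMonoid (PMF M) where
  mul μ ν := μ.bind fun S => ν.map fun T => S + T
  one := PMF.pure 0
  mul_assoc μ ν ρ := by
    change (μ.bind _).bind _ = μ.bind fun S => ((ν.bind _).map _)
    simp [← PMF.bind_pure_comp, PMF.bind_bind, PMF.pure_bind, Function.comp_def, add_assoc]
  one_mul μ := by
    change (PMF.pure 0).bind _ = μ
    rw [PMF.pure_bind]
    simp only [zero_add]
    exact PMF.map_id μ
  mul_one μ := by
    change (μ.bind fun S => (PMF.pure 0).map _) = μ
    simp [PMF.pure_map]
  mul_comm μ ν := by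
    change (μ.bind fun S => ν.map _) = (ν.bind fun S => μ.map _)
    simp only [← PMF.bind_pure_comp]
    rw [PMF.bind_comm]
    simp [Function.comp_def, add_comm]

theorem conv_def (μ ν : PMF M) : μ * ν = μ.bind fun S => ν.map fun T => S + T := rfl

theorem one_conv_def : (1 : PMF M) = PMF.pure 0 := rfl

theorem indepUnion_eq_prod {α : Type*} (L : List (PMF (Multiset α))) :
    indepUnion L = L.prod := by
  induction L with
  | nil => rfl
  | cons μ L ih => rw [List.prod_cons, ← ih]; rfl

theorem ev_mul (μ ν : PMF M) (f : M → ℝ≥0∞) :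
    ev (μ * ν) f = ev μ fun x => ev ν fun y => f (x + y) := by
  rw [conv_def, ev_bind]
  simp [ev_map]

/-- The point masses, as a homomorphism. -/
def pureHom (M : Type*) [AddCommMonoid M] : Multiplicative M →* PMF M where
  toFun a := PMF.pure a.toAdd
  map_one' := rfl
  map_mul' a b := by
    rw [conv_def, PMF.pure_bind, PMF.pure_map]
    rfl

theorem pure_add (a b : M) : PMF.pure (a + b) = PMF.pure a * PMF.pure b :=
  (pureHom M).map_mul (Multiplicative.ofAdd a) (Multiplicative.ofAdd b)

theorem pure_zero : PMF.pure (0 : M) = 1 := rfl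

theorem pure_sum {ι : Type*} (s : Finset ι) (a : ι → M) :
    PMF.pure (∑ i ∈ s, a i) = ∏ i ∈ s, PMF.pure (a i) := by
  classical
  induction s using Finset.induction_on with
  | empty => simp [pure_zero]
  | insert i s hi ih => rw [Finset.sum_insert hi, Finset.prod_insert hi, pure_add, ih]

theorem pure_mul_eq_map (a : M) (μ : PMF M) : PMF.pure a * μ = μ.map fun x => a + x := by
  rw [conv_def, PMF.pure_bind]

/-- Push-forward along a homomorphism, as a homomorphism. -/
def mapHom (φ : M →+ N) : PMF M →* PMF N where
  toFun μ := μ.map φ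
  map_one' := by simp [one_conv_def, PMF.pure_map]
  map_mul' μ ν := by
    simp [conv_def, ← PMF.bind_pure_comp, Function.comp_def]

theorem map_conv (φ : M →+ N) (μ ν : PMF M) : (μ * ν).map φ = μ.map φ * ν.map φ :=
  (mapHom φ).map_mul μ ν

theorem map_conv_pow (φ : M →+ N) (μ : PMF M) (k : ℕ) : (μ ^ k).map φ = μ.map φ ^ k :=
  (mapHom φ).map_pow μ k

theorem map_conv_prod {ι : Type*} (φ : M →+ N) (s : Finset ι) (μ : ι → PMF M) :
    (∏ i ∈ s, μ i).map φ = ∏ i ∈ s, (μ i).map φ :=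
  map_prod (mapHom φ) μ s

theorem ev_mul_of_multiplicative (μ ν : PMF M) {f : M → ℝ≥0∞}
    (hf : ∀ x y, f (x + y) = f x * f y) : ev (μ * ν) f = ev μ f * ev ν f := by
  rw [ev_mul]
  simp only [hf, ev_const_mul]
  rw [mul_comm, ← ev_const_mul]
  simp only [mul_comm]

theorem ev_prod_of_multiplicative {ι : Type*} (s : Finset ι) (μ : ι → PMF M) {f : M → ℝ≥0∞}
    (h0 : f 0 = 1) (hf : ∀ x y, f (x + y) = f x * f y) :
    ev (∏ i ∈ s, μ i) f = ∏ i ∈ s, ev (μ i) f := by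
  classical
  induction s using Finset.induction_on with
  | empty => simp [one_conv_def, ev_pure, h0]
  | insert a s ha ih => rw [Finset.prod_insert ha, Finset.prod_insert ha,
      ev_mul_of_multiplicative _ _ hf, ih]

theorem ev_mul_of_additive (μ ν : PMF M) {f : M → ℝ≥0∞}
    (hf : ∀ x y, f (x + y) = f x + f y) : ev (μ * ν) f = ev μ f + ev ν f := by
  rw [ev_mul]
  simp only [hf, ev_add, ev_const]

theorem mem_support_mul {μ ν : PMF M} {x : M} :
    x ∈ (μ * ν).support ↔ ∃ a ∈ μ.support, ∃ b ∈ ν.support, a + b = x := by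
  simp [conv_def]

end Convolution

/-! ### One-sided indistinguishability -/

section Indistinguishability

variable {α β : Type*}

/-- `μ(f) ≤ c ν(f) + δ` for all test functions `f` with values in `[0, 1]`. -/
def DPLe (c δ : ℝ≥0∞) (μ ν : PMF α) : Prop :=
  ∀ f : α → ℝ≥0∞, (∀ x, f x ≤ 1) → ev μ f ≤ c * ev ν f + δ

theorem DPLe.refl (μ : PMF α) : DPLe 1 0 μ μ := fun f _ => by simp

theorem DPLe.mono {c c' δ δ' : ℝ≥0∞} {μ ν : PMF α} (h : DPLe c δ μ ν) (hc : c ≤ c')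
    (hδ : δ ≤ δ') : DPLe c' δ' μ ν := fun f hf =>
  (h f hf).trans (by gcongr)

theorem DPLe.map {c δ : ℝ≥0∞} {μ ν : PMF α} (h : DPLe c δ μ ν) (g : α → β) :
    DPLe c δ (μ.map g) (ν.map g) := fun f hf => by
  rw [ev_map, ev_map]
  exact h _ fun x => hf _

theorem DPLe.of_map {c δ : ℝ≥0∞} {μ ν : PMF α} {g : α → β} (hg : Function.Injective g)
    (h : DPLe c δ (μ.map g) (ν.map g)) : DPLe c δ μ ν := fun f hf => by
  have := h (Function.extend g f 0) fun y => by
    by_cases hy : ∃ x, g x = y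
    · obtain ⟨x, rfl⟩ := hy
      rw [hg.extend_apply]
      exact hf x
    · rw [Function.extend_apply' _ _ _ hy]
      simp
  simpa only [ev_map, hg.extend_apply] using this

theorem DPLe.bind {γ : Type*} {c δ : ℝ≥0∞} {ρ : PMF α} {ρ' : PMF β} {κ : α → PMF γ}
    {κ' : β → PMF γ} (h : ∀ a ∈ ρ.support, ∀ b ∈ ρ'.support, DPLe c δ (κ a) (κ' b)) :
    DPLe c δ (ρ.bind κ) (ρ'.bind κ') := fun f hf => by
  rw [ev_bind, ev_bind, ← ev_const ρ (c * _ + δ)]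
  refine ev_mono_of_support ρ fun a ha => ?_
  rw [← ev_const ρ' (ev (κ a) f), ← ev_const ρ' δ, ← ev_const_mul, ← ev_add]
  refine ev_mono_of_support ρ' fun b hb => ?_
  exact h a ha b hb f hf

theorem DPLe.mul {M : Type*} [AddCommMonoid M] {c₁ c₂ δ₁ δ₂ : ℝ≥0∞} {μ₁ μ₂ ν₁ ν₂ : PMF M}
    (h₁ : DPLe c₁ δ₁ μ₁ ν₁) (h₂ : DPLe c₂ δ₂ μ₂ ν₂) :
    DPLe (c₁ * c₂) (δ₁ + δ₂) (μ₁ * μ₂) (ν₁ * ν₂) := fun f hf => by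
  rw [ev_mul, ev_mul]
  set g : M → ℝ≥0∞ := fun x => min 1 (c₂ * ev ν₂ fun y => f (x + y))
  calc ev μ₁ (fun x => ev μ₂ fun y => f (x + y))
      ≤ ev μ₁ (fun x => g x + δ₂) := by
        refine ev_mono _ fun x => ?_
        rw [← min_add_add_right]
        exact le_min ((ev_le_one _ fun y => hf _).trans le_self_add) (h₂ _ fun y => hf _)
    _ = ev μ₁ g + δ₂ := by rw [ev_add, ev_const]
    _ ≤ (c₁ * ev ν₁ g + δ₁) + δ₂ := by gcongr; exact h₁ g fun x => min_le_left _ _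
    _ ≤ (c₁ * ev ν₁ (fun x => c₂ * ev ν₂ fun y => f (x + y)) + δ₁) + δ₂ := by
        gcongr
        exact ev_mono _ fun x => min_le_right _ _
    _ = _ := by rw [ev_const_mul]; ring

theorem DPLe.mul_left {M : Type*} [AddCommMonoid M] {c δ : ℝ≥0∞} {μ ν : PMF M}
    (h : DPLe c δ μ ν) (ρ : PMF M) : DPLe c δ (ρ * μ) (ρ * ν) := by
  simpa using (DPLe.refl ρ).mul h

theorem DPLe.prod {M ι : Type*} [AddCommMonoid M] (s : Finset ι) {c δ : ι → ℝ≥0∞}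
    {μ ν : ι → PMF M} (h : ∀ i ∈ s, DPLe (c i) (δ i) (μ i) (ν i)) :
    DPLe (∏ i ∈ s, c i) (∑ i ∈ s, δ i) (∏ i ∈ s, μ i) (∏ i ∈ s, ν i) := by
  classical
  induction s using Finset.induction_on with
  | empty => simpa using DPLe.refl (1 : PMF M)
  | insert a s ha ih =>
    simp only [Finset.prod_insert ha, Finset.sum_insert ha]
    exact (h a (Finset.mem_insert_self a s)).mul
      (ih fun i hi => h i (Finset.mem_insert_of_mem hi))

end Indistinguishability

/-! ### The negative binomial distribution -/

section NegBin

theorem succ_mul_multichoose_succ (r : ℝ) (k : ℕ) :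
    ((k : ℝ) + 1) * Ring.multichoose r (k + 1) = (r + k) * Ring.multichoose r k := by
  have h1 := Ring.factorial_nsmul_multichoose_eq_ascPochhammer r k
  have h2 := Ring.factorial_nsmul_multichoose_eq_ascPochhammer r (k + 1)
  rw [Polynomial.ascPochhammer_smeval_eq_eval, nsmul_eq_mul] at h1 h2
  rw [ascPochhammer_succ_eval, ← h1, Nat.factorial_succ] at h2
  push_cast at h2
  have h3 : (k.factorial : ℝ) ≠ 0 := by exact_mod_cast k.factorial_ne_zero
  apply mul_left_cancel₀ h3
  linear_combination h2

theorem succ_mul_multichoose_succ' (r : ℝ) (k : ℕ) :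
    ((k : ℝ) + 1) * Ring.multichoose r (k + 1) = r * Ring.multichoose (r + 1) k := by
  induction k with
  | zero => simp
  | succ k ih =>
    have h1 := succ_mul_multichoose_succ r (k + 1)
    have h2 := succ_mul_multichoose_succ (r + 1) k
    have h3 : ((k : ℝ) + 1) ≠ 0 := by positivity
    push_cast at h1 ⊢
    apply mul_left_cancel₀ h3
    linear_combination (k + 1 : ℝ) * h1 + (r + k + 1) * ih - r * h2

theorem multichoose_add (r s : ℝ) (k : ℕ) :
    Ring.multichoose (r + s) k =
      ∑ ij ∈ Finset.HasAntidiagonal.antidiagonal k, Ring.multichoose r ij.1 * Ring.multichoose s ij.2 := by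
  have h := Ring.add_choose_eq (r := -r) (s := -s) k (Commute.all _ _)
  rw [← neg_add, Ring.choose_neg'] at h
  have h2 : ∀ ij ∈ Finset.HasAntidiagonal.antidiagonal k, Ring.choose (-r) ij.1 * Ring.choose (-s) ij.2 =
      Int.negOnePow k • (Ring.multichoose r ij.1 * Ring.multichoose s ij.2) := by
    intro ij hij
    rw [Finset.HasAntidiagonal.mem_antidiagonal] at hij
    rw [Ring.choose_neg', Ring.choose_neg', ← hij]
    push_cast
    rw [Int.negOnePow_add, mul_smul, smul_mul_assoc, mul_smul_comm]
  rw [Finset.sum_congr rfl h2, ← Finset.smul_sum] at h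
  exact smul_left_cancel _ h

variable {r s p : ℝ}

theorem negBin_apply (hr : 0 < r) (hp : 0 < p) (hp1 : p < 1) (k : ℕ) :
    negBin r p k = ENNReal.ofReal (negBinWeight r p k) := by
  have h : negBin r p = ⟨fun k => ENNReal.ofReal (negBinWeight r p k), _⟩ :=
    dif_pos ⟨hr, hp, hp1⟩
  rw [h]
  rfl

theorem negBinWeight_succ (r p : ℝ) (k : ℕ) :
    ((k : ℝ) + 1) * negBinWeight r p (k + 1) = p * (r + k) * negBinWeight r p k := by
  have := succ_mul_multichoose_succ r k
  simp only [negBinWeight, pow_succ]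
  linear_combination (1 - p) ^ r * p ^ k * p * this

theorem negBinWeight_tilt {x : ℝ} (hp1 : p < 1) (hx : p * x < 1) (k : ℕ) :
    negBinWeight r p k * x ^ k = ((1 - p) / (1 - p * x)) ^ r * negBinWeight r (p * x) k := by
  have h1 : 0 < 1 - p * x := by linarith
  rw [Real.div_rpow (by linarith) h1.le, negBinWeight, negBinWeight, mul_pow]
  have : (1 - p * x) ^ r ≠ 0 := (Real.rpow_pos_of_pos h1 r).ne'
  field_simp

theorem ev_negBin_pow {x : ℝ} (hr : 0 < r) (hp : 0 < p) (hp1 : p < 1) (hx0 : 0 < x)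
    (hx : p * x < 1) :
    ev (negBin r p) (fun k => ENNReal.ofReal (x ^ k)) =
      ENNReal.ofReal (((1 - p) / (1 - p * x)) ^ r) := by
  have h : ∀ k, negBin r p k * ENNReal.ofReal (x ^ k) =
      ENNReal.ofReal (((1 - p) / (1 - p * x)) ^ r) * negBin r (p * x) k := fun k => by
    rw [negBin_apply hr hp hp1, negBin_apply hr (by positivity) hx,
      ← ENNReal.ofReal_mul (negBinWeight_nonneg hr hp hp1 k), negBinWeight_tilt hp1 hx,
      ENNReal.ofReal_mul]
    exact Real.rpow_nonneg (div_nonneg (by linarith) (by linarith)) _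
  rw [ev, tsum_congr h, ENNReal.tsum_mul_left, PMF.tsum_coe, mul_one]

theorem ev_negBin_id (hr : 0 < r) (hp : 0 < p) (hp1 : p < 1) :
    ev (negBin r p) (fun k => (k : ℝ≥0∞)) = ENNReal.ofReal (r * (p / (1 - p))) := by
  have h : ∀ k : ℕ, negBin r p (k + 1) * ((k + 1 : ℕ) : ℝ≥0∞) =
      ENNReal.ofReal (r * (p / (1 - p))) * negBin (r + 1) p k := fun k => by
    have e : negBinWeight r p (k + 1) * ((k + 1 : ℕ) : ℝ) =
        r * (p / (1 - p)) * negBinWeight (r + 1) p k := by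
      have h1 : (1 - p) ≠ 0 := by linarith
      simp only [negBinWeight, Real.rpow_add_one h1, pow_succ]
      push_cast
      field_simp
      linear_combination (1 - p) ^ r * succ_mul_multichoose_succ' r k
    rw [negBin_apply hr hp hp1, negBin_apply (by linarith) hp hp1, ← ENNReal.ofReal_natCast,
      ← ENNReal.ofReal_mul (negBinWeight_nonneg hr hp hp1 _), e, ENNReal.ofReal_mul]
    exact mul_nonneg hr.le (div_nonneg hp.le (by linarith))
  rw [ev, tsum_eq_zero_add' ENNReal.summable, tsum_congr h, ENNReal.tsum_mul_left, PMF.tsum_coe]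
  simp

theorem ev_negBin_id_exp_le {θ : ℝ} (hr : 0 < r) (hθ : 0 < θ) :
    ev (negBin r (Real.exp (-θ))) (fun k => (k : ℝ≥0∞)) ≤ ENNReal.ofReal (r / θ) := by
  have hp1 : Real.exp (-θ) < 1 := by rw [Real.exp_lt_one_iff]; linarith
  rw [ev_negBin_id hr (Real.exp_pos _) hp1, div_eq_mul_one_div r θ]
  refine ENNReal.ofReal_le_ofReal (mul_le_mul_of_nonneg_left ?_ hr.le)
  rw [div_le_div_iff₀ (by linarith) hθ]
  have h := Real.add_one_le_exp θ
  have h2 : Real.exp (-θ) * Real.exp θ = 1 := by rw [← Real.exp_add]; simp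
  nlinarith [Real.exp_pos (-θ), mul_le_mul_of_nonneg_left h (Real.exp_pos (-θ)).le]

theorem negBin_mul_negBin (hr : 0 < r) (hs : 0 < s) (hp : 0 < p) (hp1 : p < 1) :
    negBin r p * negBin s p = negBin (r + s) p := by
  refine PMF.ext fun k => ?_
  have h1 : (negBin r p * negBin s p) k =
      ∑' a : ℕ, ∑' b : ℕ, if a + b = k then negBin r p a * negBin s p b else 0 := by
    rw [conv_def, PMF.bind_apply]
    refine tsum_congr fun a => ?_
    rw [PMF.map_apply, ← ENNReal.tsum_mul_left]
    refine tsum_congr fun b => ?_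
    rw [mul_ite, mul_zero]
    by_cases hab : a + b = k
    · rw [if_pos hab, if_pos hab.symm]
    · rw [if_neg hab, if_neg (Ne.symm hab)]
  rw [h1, ← ENNReal.tsum_prod, tsum_eq_sum (s := Finset.HasAntidiagonal.antidiagonal k)]
  · rw [negBin_apply (by linarith) hp hp1, negBinWeight, multichoose_add, Finset.sum_mul,
      Finset.sum_mul, ENNReal.ofReal_sum_of_nonneg]
    · refine Finset.sum_congr rfl fun ij hij => ?_
      rw [Finset.HasAntidiagonal.mem_antidiagonal] at hij
      rw [if_pos hij, negBin_apply hr hp hp1, negBin_apply hs hp hp1,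
        ← ENNReal.ofReal_mul (negBinWeight_nonneg hr hp hp1 _), negBinWeight, negBinWeight,
        Real.rpow_add (by linarith), ← hij, pow_add]
      congr 1
      ring
    · intro ij _
      exact mul_nonneg (mul_nonneg (mul_nonneg (multichoose_nonneg hr _) (multichoose_nonneg hs _))
        (Real.rpow_nonneg (by linarith) _)) (by positivity)
  · intro ij hij
    rw [Finset.HasAntidiagonal.mem_antidiagonal] at hij
    rw [if_neg hij]

theorem negBin_pow (hr : 0 < r) (hp : 0 < p) (hp1 : p < 1) (n : ℕ) (hn : 0 < n) :
    negBin (r / n) p ^ n = negBin r p := by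
  have h : ∀ k : ℕ, negBin (r / n) p ^ (k + 1) = negBin ((k + 1 : ℕ) * (r / n)) p := by
    intro k
    induction k with
    | zero => simp
    | succ k ih =>
      have hn' : (0 : ℝ) < n := by exact_mod_cast hn
      rw [pow_succ, ih, negBin_mul_negBin (by positivity) (by positivity) hp hp1]
      congr 1
      push_cast
      ring
  obtain ⟨m, rfl⟩ : ∃ m, n = m + 1 := ⟨n - 1, by omega⟩
  rw [h m]
  congr 1
  field_simp

theorem mul_negBinWeight_le_succ (hr : 1 ≤ r) (hp : 0 < p) (hp1 : p < 1) (z : ℕ) :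
    p * negBinWeight r p z ≤ negBinWeight r p (z + 1) := by
  have h := negBinWeight_succ r p z
  have h0 := negBinWeight_nonneg (by linarith : 0 < r) hp hp1 z
  have hz : (0 : ℝ) < z + 1 := by positivity
  refine le_of_mul_le_mul_left ?_ hz
  rw [h]
  nlinarith [mul_nonneg (mul_nonneg hp.le h0) (sub_nonneg.2 hr)]

theorem pow_mul_negBinWeight_le_add (hr : 1 ≤ r) (hp : 0 < p) (hp1 : p < 1) (z j : ℕ) :
    p ^ j * negBinWeight r p z ≤ negBinWeight r p (z + j) := by
  induction j with
  | zero => simp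
  | succ j ih =>
    calc p ^ (j + 1) * negBinWeight r p z = p * (p ^ j * negBinWeight r p z) := by ring
      _ ≤ p * negBinWeight r p (z + j) := by gcongr
      _ ≤ _ := mul_negBinWeight_le_succ hr hp hp1 (z + j)

/-- Shifting a negative binomial variable of shape at least one downwards. -/
theorem negBin_shift_down (hr : 1 ≤ r) (hp : 0 < p) (hp1 : p < 1) (j : ℕ) :
    DPLe (ENNReal.ofReal ((p ^ j)⁻¹)) 0 ((negBin r p).map fun z : ℕ => (z : ℤ))
      ((negBin r p).map fun z : ℕ => -(j : ℤ) + z) := fun f _ => by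
  have hr0 : 0 < r := by linarith
  rw [ev_map, ev_map, add_zero, ev, ev, ← ENNReal.tsum_mul_left]
  refine le_trans (ENNReal.tsum_le_tsum fun z => ?_)
    (ENNReal.tsum_comp_le_tsum_of_injective (add_left_injective j)
      fun a : ℕ => ENNReal.ofReal ((p ^ j)⁻¹) * (negBin r p a * f (-(j : ℤ) + (a : ℤ))))
  have : -(j : ℤ) + ((z + j : ℕ) : ℤ) = z := by push_cast; ring
  rw [this, ← mul_assoc, negBin_apply hr0 hp hp1, negBin_apply hr0 hp hp1,
    ← ENNReal.ofReal_mul (by positivity)]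
  gcongr
  rw [inv_mul_eq_div, le_div_iff₀ (by positivity), mul_comm]
  exact pow_mul_negBinWeight_le_add hr hp hp1 z j

theorem negBinWeight_add_le {η : ℝ} (hr : 1 ≤ r) (hp : 0 < p) (hp1 : p < 1) (hη : 0 < η)
    (z j : ℕ) (hz : (r - 1) / (2 * η) ≤ z) :
    negBinWeight r p (z + j) ≤ Real.exp (2 * η * j) * negBinWeight r p z := by
  induction j with
  | zero => simp
  | succ j ih =>
    have hr0 : 0 < r := by linarith
    have h := negBinWeight_succ r p (z + j)
    have h0 := negBinWeight_nonneg hr0 hp hp1 (z + j)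
    have hz' : (0 : ℝ) < ((z + j : ℕ) : ℝ) + 1 := by positivity
    have h1 : negBinWeight r p (z + j + 1) ≤ Real.exp (2 * η) * negBinWeight r p (z + j) := by
      refine le_of_mul_le_mul_left ?_ hz'
      rw [h, ← mul_assoc]
      refine mul_le_mul_of_nonneg_right ?_ h0
      rw [div_le_iff₀ (by positivity)] at hz
      have h2 := Real.add_one_le_exp (2 * η)
      have h3 : r + ((z + j : ℕ) : ℝ) ≤ (((z + j : ℕ) : ℝ) + 1) * (2 * η + 1) := by
        push_cast
        have : (0 : ℝ) ≤ j * η := by positivity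
        nlinarith
      calc p * (r + ((z + j : ℕ) : ℝ)) ≤ 1 * (r + ((z + j : ℕ) : ℝ)) := by gcongr
        _ ≤ (((z + j : ℕ) : ℝ) + 1) * (2 * η + 1) := by linarith
        _ ≤ _ := by gcongr
    calc negBinWeight r p (z + (j + 1)) ≤ Real.exp (2 * η) * negBinWeight r p (z + j) := h1
      _ ≤ Real.exp (2 * η) * (Real.exp (2 * η * j) * negBinWeight r p z) := by gcongr
      _ = _ := by
        rw [← mul_assoc, ← Real.exp_add]
        push_cast
        ring_nf

theorem ev_negBin_lower_tail {η δ : ℝ} (hη : 0 < η) (hη1 : η ≤ 1 / 2) (hδ : 0 < δ) (hδ1 : δ < 1)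
    (hr : r = 3 * (1 + Real.log (1 / δ))) :
    ev (negBin r (Real.exp (-(0.2 * η))))
      (Set.indicator {z : ℕ | (z : ℝ) < r / (2 * η)} 1) ≤ ENNReal.ofReal δ := by
  classical
  have hlog : 0 < Real.log (1 / δ) := Real.log_pos (by rw [lt_div_iff₀ hδ]; linarith)
  have hr0 : 0 < r := by rw [hr]; positivity
  set p := Real.exp (-(0.2 * η)) with hpdef
  have hp : 0 < p := Real.exp_pos _
  have hp1 : p < 1 := by rw [hpdef, Real.exp_lt_one_iff]; linarith
  set x := Real.exp (-(0.8 * η)) with hxdef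
  have hx : 0 < x := Real.exp_pos _
  have hpx : p * x = Real.exp (-η) := by rw [hpdef, hxdef, ← Real.exp_add]; ring_nf
  have hpx1 : p * x < 1 := by rw [hpx, Real.exp_lt_one_iff]; linarith
  have h1 : ev (negBin r p) (Set.indicator {z : ℕ | (z : ℝ) < r / (2 * η)} 1) ≤
      ev (negBin r p) (fun z => ENNReal.ofReal (Real.exp (0.4 * r)) * ENNReal.ofReal (x ^ z)) := by
    refine ev_mono _ fun z => ?_
    by_cases hz : (z : ℝ) < r / (2 * η)
    · rw [Set.indicator_of_mem (by exact hz), Pi.one_apply, ← ENNReal.ofReal_mul (by positivity),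
        ← ENNReal.ofReal_one]
      refine ENNReal.ofReal_le_ofReal ?_
      rw [hxdef, ← Real.exp_nat_mul, ← Real.exp_add, Real.one_le_exp_iff]
      rw [lt_div_iff₀ (by positivity)] at hz
      nlinarith
    · rw [Set.indicator_of_notMem (by exact hz)]
      simp
  refine h1.trans ?_
  rw [ev_const_mul, ev_negBin_pow hr0 hp hp1 hx hpx1, ← ENNReal.ofReal_mul (by positivity)]
  refine ENNReal.ofReal_le_ofReal ?_
  have hq : (1 - p) / (1 - p * x) ≤ 0.3 := by
    rw [div_le_iff₀ (by linarith)]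
    have h2 := Real.add_one_le_exp (-(0.2 * η))
    have h3 : Real.exp (-η) * (1 + η) ≤ 1 := by
      have := Real.add_one_le_exp η
      have e : Real.exp (-η) * Real.exp η = 1 := by rw [← Real.exp_add]; simp
      calc Real.exp (-η) * (1 + η) ≤ Real.exp (-η) * Real.exp η := by gcongr; linarith
        _ = 1 := e
    rw [hpx]
    nlinarith [Real.exp_pos (-η)]
  have hq0 : 0 ≤ (1 - p) / (1 - p * x) := div_nonneg (by linarith) (by linarith)
  have h3 : (0.3 : ℝ) ≤ Real.exp (-(0.9 : ℝ)) := by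
    rw [Real.exp_neg, le_inv_comm₀ (by norm_num) (Real.exp_pos _)]
    have h5 : Real.exp 0.9 ≤ Real.exp 1 := Real.exp_le_exp.2 (by norm_num)
    have h6 := Real.exp_one_lt_d9
    refine h5.trans (h6.le.trans ?_)
    norm_num
  calc Real.exp (0.4 * r) * ((1 - p) / (1 - p * x)) ^ r
      ≤ Real.exp (0.4 * r) * (Real.exp (-(0.9 : ℝ))) ^ r := by
        gcongr
        exact hq.trans h3
    _ = Real.exp (-(0.5 * r)) := by
        rw [← Real.exp_mul, ← Real.exp_add]
        ring_nf
    _ ≤ Real.exp (Real.log δ) := by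
        refine Real.exp_le_exp.2 ?_
        have : Real.log (1 / δ) = - Real.log δ := by rw [one_div, Real.log_inv]
        rw [this] at hlog hr
        rw [hr]
        linarith
    _ = δ := Real.exp_log hδ

/-- The negative binomial noise hides shifts by up to `t / 2`. -/
theorem negBin_shift {e δ t : ℝ} (he : 0 < e) (he1 : e ≤ 1) (ht : 2 ≤ t) (hδ : 0 < δ)
    (hδ1 : δ < 1) (k : ℤ) (hk : |(k : ℝ)| ≤ t / 2) :
    DPLe (ENNReal.ofReal (Real.exp e)) (ENNReal.ofReal δ)
      ((negBin (3 * (1 + Real.log (1 / δ))) (Real.exp (-(0.2 * e / t)))).map fun z : ℕ => (z : ℤ))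
      ((negBin (3 * (1 + Real.log (1 / δ))) (Real.exp (-(0.2 * e / t)))).map
        fun z : ℕ => k + (z : ℤ)) := by
  classical
  have hlog : 0 < Real.log (1 / δ) := Real.log_pos (by rw [lt_div_iff₀ hδ]; linarith)
  set r := 3 * (1 + Real.log (1 / δ)) with hr
  have hr1 : 1 ≤ r := by linarith
  have hr0 : 0 < r := by linarith
  set η := e / t with hηdef
  have hη : 0 < η := by positivity
  have hηt : η * t = e := by rw [hηdef]; field_simp
  have hη1 : η ≤ 1 / 2 := by rw [hηdef, div_le_iff₀ (by linarith)]; linarith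
  rw [show 0.2 * e / t = 0.2 * η by rw [hηdef]; ring]
  set p := Real.exp (-(0.2 * η)) with hpdef
  have hp : 0 < p := Real.exp_pos _
  have hp1 : p < 1 := by rw [hpdef, Real.exp_lt_one_iff]; linarith
  rcases le_total k 0 with hk0 | hk0
  · obtain ⟨j, rfl⟩ : ∃ j : ℕ, k = -(j : ℤ) := ⟨k.natAbs, by omega⟩
    refine (negBin_shift_down hr1 hp hp1 j).mono (ENNReal.ofReal_le_ofReal ?_) zero_le
    rw [hpdef, ← Real.exp_nat_mul, ← Real.exp_neg]
    refine Real.exp_le_exp.2 ?_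
    have hj : (j : ℝ) ≤ t / 2 := by simpa using hk
    nlinarith
  · obtain ⟨j, rfl⟩ : ∃ j : ℕ, k = (j : ℤ) := ⟨k.natAbs, by omega⟩
    have hj : (j : ℝ) ≤ t / 2 := by simpa using hk
    intro f hf
    rw [ev_map, ev_map]
    set A : Set ℕ := {z : ℕ | (z : ℝ) < r / (2 * η)}
    have hX : (j : ℝ) + (r - 1) / (2 * η) ≤ r / (2 * η) := by
      rw [sub_div]
      have : (j : ℝ) ≤ 1 / (2 * η) := by
        rw [le_div_iff₀ (by positivity)]
        nlinarith
      linarith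
    calc ev (negBin r p) (fun z => f z)
        ≤ ev (negBin r p) (fun z => Aᶜ.indicator (fun z => f z) z + A.indicator 1 z) := by
          refine ev_mono _ fun z => ?_
          by_cases hz : z ∈ A
          · simp [hz, hf]
          · simp [hz]
      _ = ev (negBin r p) (Aᶜ.indicator fun z => f z) + ev (negBin r p) (A.indicator 1) :=
          ev_add _ _ _
      _ ≤ _ := by
          gcongr
          · have hsub : Function.support
                (fun z : ℕ => negBin r p z * (Aᶜ.indicator (fun z : ℕ => f z) z)) ⊆
                Set.range fun z => z + j := by
              intro z hz
              rw [Function.mem_support] at hz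
              by_cases hzA : z ∈ A
              · simp [hzA] at hz
              · have hzj : (j : ℝ) ≤ z := by
                  have : r / (2 * η) ≤ z := not_lt.1 hzA
                  have h0 : 0 ≤ (r - 1) / (2 * η) := div_nonneg (by linarith) (by linarith)
                  linarith
                have : j ≤ z := by exact_mod_cast hzj
                exact ⟨z - j, by simp; omega⟩
            rw [ev, ← (add_left_injective j).tsum_eq hsub, ev, ← ENNReal.tsum_mul_left]
            refine ENNReal.tsum_le_tsum fun z => ?_
            by_cases hzA : z + j ∈ A
            · simp [hzA]
            · have hz : (r - 1) / (2 * η) ≤ z := by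
                have : r / (2 * η) ≤ ((z + j : ℕ) : ℝ) := not_lt.1 hzA
                push_cast at this
                linarith
              rw [Set.indicator_of_mem (by exact hzA), ← mul_assoc, negBin_apply hr0 hp hp1,
                negBin_apply hr0 hp hp1, ← ENNReal.ofReal_mul (by positivity)]
              have e1 : ((z + j : ℕ) : ℤ) = (j : ℤ) + z := by push_cast; ring
              rw [e1]
              gcongr
              refine (negBinWeight_add_le hr1 hp hp1 hη z j hz).trans ?_
              have := negBinWeight_nonneg hr0 hp hp1 z
              gcongr
              nlinarith
          · exact ev_negBin_lower_tail hη hη1 hδ hδ1 hr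

theorem negBin_one_upper_tail {θ T : ℝ} (hθ : 0 < θ) (hT : 0 ≤ T) :
    (negBin 1 (Real.exp (-θ))).toOuterMeasure {z : ℕ | T < z} ≤
      ENNReal.ofReal (Real.exp (-(θ * T))) := by
  classical
  set p := Real.exp (-θ) with hpdef
  have hp : 0 < p := Real.exp_pos _
  have hp1 : p < 1 := by rw [hpdef, Real.exp_lt_one_iff]; linarith
  set m := ⌊T⌋₊ + 1
  rw [toOuterMeasure_eq_ev, ev]
  have hsub : Function.support
      (fun z : ℕ => negBin 1 p z * (Set.indicator {z : ℕ | T < z} 1 z)) ⊆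
      Set.range fun z => z + m := by
    intro z hz
    rw [Function.mem_support] at hz
    by_cases hzA : T < z
    · have : ⌊T⌋₊ < z := (Nat.floor_lt hT).2 hzA
      exact ⟨z - m, by simp; omega⟩
    · simp [hzA] at hz
  rw [← (add_left_injective m).tsum_eq hsub]
  calc _ ≤ ∑' z, ENNReal.ofReal (p ^ m) * negBin 1 p z := by
        refine ENNReal.tsum_le_tsum fun z => ?_
        refine (mul_le_of_le_one_right zero_le (Set.indicator_le_self _ 1 _)).trans ?_
        rw [negBin_apply one_pos hp hp1, negBin_apply one_pos hp hp1,
          ← ENNReal.ofReal_mul (by positivity)]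
        refine ENNReal.ofReal_le_ofReal (le_of_eq ?_)
        simp only [negBinWeight, Ring.multichoose_one, pow_add]
        ring
    _ = ENNReal.ofReal (p ^ m) := by rw [ENNReal.tsum_mul_left, PMF.tsum_coe, mul_one]
    _ ≤ _ := by
        refine ENNReal.ofReal_le_ofReal ?_
        rw [hpdef, ← Real.exp_nat_mul, Real.exp_le_exp]
        have : T < m := by simpa [m] using Nat.lt_floor_add_one T
        nlinarith

end NegBin

/-! ### Splitting a message by zero-sum multisets -/

section Halving

/-- The message `±a`, where zero is not sent. -/
def node (b : Bool) (a : ℕ) : Multiset ℤ :=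
  if a = 0 then 0 else {if b then (a : ℤ) else -(a : ℤ)}

/-- The multiset `±{v, -⌊v/2⌋, -⌈v/2⌉}`. -/
def signedZeroSum (b : Bool) (v : ℕ) : Multiset ℤ :=
  if b then zeroSum v else (zeroSum v).map fun w => -w

theorem signedZeroSum_eq (b : Bool) {v : ℕ} (hv : 2 ≤ v) :
    signedZeroSum b v = node b v + (node (!b) (v / 2) + node (!b) ((v + 1) / 2)) := by
  have h1 : v ≠ 1 := by omega
  have h2 : v / 2 ≠ 0 := by omega
  have h3 : (v + 1) / 2 ≠ 0 := by omega
  have h0 : v ≠ 0 := by omega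
  cases b <;> simp [signedZeroSum, zeroSum, node, h1, h0, h2, h3, Multiset.cons_swap]

theorem zeroSum_one : zeroSum 1 = node true 1 + node false 1 := by
  simp [zeroSum, node]

theorem sum_zeroSum (v : ℕ) : (zeroSum v).sum = 0 := by
  unfold zeroSum
  split_ifs with h
  · simp
  · simp only [Multiset.insert_eq_cons, Multiset.sum_cons, Multiset.sum_singleton]
    omega

theorem sum_signedZeroSum (b : Bool) (v : ℕ) : (signedZeroSum b v).sum = 0 := by
  have h := sum_zeroSum v
  cases b
  · simp [signedZeroSum, Multiset.sum_map_neg', h]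
  · simpa [signedZeroSum] using h

variable {G : Type*} [AddCommGroup G] (φ : Multiset ℤ →+ G)

/-- Combinations of zero-sum multisets. -/
def zeroSumComb (K : Bool × ℕ →₀ ℤ) : G :=
  Finsupp.linearCombination ℤ (fun q : Bool × ℕ => φ (signedZeroSum q.1 q.2)) K

theorem exists_halving (m : ℕ) : ∀ (b : Bool) (c : ℕ), c + 1 ≤ 2 ^ m →
    ∃ T : Finset (Bool × ℕ), T.card ≤ 2 * m ∧ (∀ q ∈ T, 2 ≤ q.2 ∧ q.2 ≤ 2 ^ m) ∧
      ∀ a, (a = c ∨ a = c + 1) → ∃ (K : Bool × ℕ →₀ ℤ) (α α' : ℕ), K.support ⊆ T ∧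
        (∀ q, (q.1 = b → 0 ≤ K q ∧ K q * q.2 ≤ a) ∧ (q.1 ≠ b → K q ≤ 0 ∧ -(K q * q.2) ≤ a)) ∧
        α + α' = a ∧
        φ (node b a) = zeroSumComb φ K + (α : ℤ) • φ (node b 1) - (α' : ℤ) • φ (node (!b) 1) := by
  classical
  induction m with
  | zero =>
    intro b c hc
    refine ⟨∅, by simp, by simp, fun a ha => ⟨0, a, 0, by simp, by simp, by simp, ?_⟩⟩
    have : a = 0 ∨ a = 1 := by omega
    rcases this with rfl | rfl <;> simp [zeroSumComb, node]
  | succ m ih =>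
    intro b c hc
    obtain ⟨T, hT, hTv, hTa⟩ := ih (!b) (c / 2) (by rw [pow_succ] at hc; omega)
    refine ⟨(({(b, c), (b, c + 1)} : Finset (Bool × ℕ)).filter fun q => 2 ≤ q.2) ∪ T, ?_, ?_, ?_⟩
    · have h1 := Finset.card_union_le
        (({(b, c), (b, c + 1)} : Finset (Bool × ℕ)).filter fun q => 2 ≤ q.2) T
      have h2 := Finset.card_filter_le ({(b, c), (b, c + 1)} : Finset (Bool × ℕ)) fun q => 2 ≤ q.2
      have h3 := Finset.card_le_two (a := (b, c)) (b := (b, c + 1))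
      omega
    · intro q hq
      rw [Finset.mem_union, Finset.mem_filter, Finset.mem_insert, Finset.mem_singleton] at hq
      rcases hq with ⟨rfl | rfl, h⟩ | hq
      · exact ⟨h, by simp; omega⟩
      · exact ⟨h, hc⟩
      · have := hTv q hq
        rw [pow_succ]
        omega
    · intro a ha
      by_cases ha1 : a ≤ 1
      · refine ⟨0, a, 0, by simp, by simp, by simp, ?_⟩
        have : a = 0 ∨ a = 1 := by omega
        rcases this with rfl | rfl <;> simp [zeroSumComb, node]
      have ha2 : 2 ≤ a := by omega
      obtain ⟨K₁, α₁, α₁', hs₁, hb₁, hα₁, he₁⟩ := hTa (a / 2) (by omega)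
      obtain ⟨K₂, α₂, α₂', hs₂, hb₂, hα₂, he₂⟩ := hTa ((a + 1) / 2) (by omega)
      refine ⟨Finsupp.single (b, a) 1 - K₁ - K₂, α₁' + α₂', α₁ + α₂, ?_, ?_, by omega, ?_⟩
      · intro q hq
        rw [Finset.mem_union]
        by_contra hcon
        push Not at hcon
        have e1 : K₁ q = 0 := by
          by_contra h
          exact hcon.2 (hs₁ (Finsupp.mem_support_iff.2 h))
        have e2 : K₂ q = 0 := by
          by_contra h
          exact hcon.2 (hs₂ (Finsupp.mem_support_iff.2 h))
        have e3 : q = (b, a) := by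
          by_contra h
          rw [Finsupp.mem_support_iff] at hq
          simp [e1, e2, Ne.symm h] at hq
        refine hcon.1 ?_
        rw [e3]
        rcases ha with rfl | rfl <;> simp [ha2]
      · intro q
        have h1 := hb₁ q
        have h2 := hb₂ q
        have hsum : (a : ℤ) = ((a / 2 : ℕ) : ℤ) + (((a + 1) / 2 : ℕ) : ℤ) := by omega
        by_cases hqa : q = (b, a)
        · subst hqa
          have n1 : ¬ (b = !b) := by cases b <;> simp
          have h1' := h1.2 n1
          have h2' := h2.2 n1
          simp only at h1' h2'
          have z1 : K₁ (b, a) = 0 := by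
            by_contra hne
            have : K₁ (b, a) ≤ -1 := by omega
            have : (a : ℤ) ≤ -(K₁ (b, a) * a) := by nlinarith
            omega
          have z2 : K₂ (b, a) = 0 := by
            by_contra hne
            have : K₂ (b, a) ≤ -1 := by omega
            have : (a : ℤ) ≤ -(K₂ (b, a) * a) := by nlinarith
            omega
          simp [z1, z2]
        · have hs : (Finsupp.single (b, a) (1 : ℤ)) q = 0 := by simp [Ne.symm hqa]
          simp only [Finsupp.coe_sub, Pi.sub_apply, hs, zero_sub]
          constructor
          · intro hq
            have n1 : q.1 ≠ !b := by rw [hq]; cases b <;> simp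
            have h1' := h1.2 n1
            have h2' := h2.2 n1
            exact ⟨by omega, by nlinarith⟩
          · intro hq
            have n1 : q.1 = !b := by
              exact Bool.eq_not_of_ne hq
            have h1' := h1.1 n1
            have h2' := h2.1 n1
            exact ⟨by omega, by nlinarith⟩
      · have e := congrArg φ (signedZeroSum_eq b ha2)
        rw [map_add, map_add, he₁, he₂, Bool.not_not] at e
        have hz : zeroSumComb φ (Finsupp.single (b, a) 1 - K₁ - K₂) =
            φ (signedZeroSum b a) - zeroSumComb φ K₁ - zeroSumComb φ K₂ := by
          simp [zeroSumComb]
        rw [hz, e]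
        push_cast
        simp only [add_smul]
        abel

/-- The difference of two messages, written in terms of the noise. -/
theorem exists_shift (m a a' : ℕ) (ha : a ≤ 2 ^ m) (ha' : a' ≤ 2 ^ m) :
    ∃ (K : Bool × ℕ →₀ ℤ) (k : ℤ), K.support.card ≤ 4 * m ∧
      (∀ q ∈ K.support, 2 ≤ q.2 ∧ q.2 ≤ 2 ^ m) ∧ (∀ q, |K q| * q.2 ≤ 2 ^ m) ∧ |k| ≤ 2 ^ m ∧
      φ (node true a') = φ (node true a) + (zeroSumComb φ K + k • φ (zeroSum 1) +
        (-((max a a' - min a a' : ℕ) : ℤ)) • φ (node (decide (a' ≤ a)) 1)) := by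
  classical
  have key : ∀ a : ℕ, a ≤ 2 ^ m → ∃ (K : Bool × ℕ →₀ ℤ) (α α' : ℕ), K.support.card ≤ 2 * m ∧
      (∀ q ∈ K.support, 2 ≤ q.2 ∧ q.2 ≤ 2 ^ m) ∧
      (∀ q, (q.1 = true → 0 ≤ K q ∧ K q * q.2 ≤ a) ∧
        (q.1 ≠ true → K q ≤ 0 ∧ -(K q * q.2) ≤ a)) ∧ α + α' = a ∧
      φ (node true a) = zeroSumComb φ K + (α : ℤ) • φ (node true 1) -
        (α' : ℤ) • φ (node false 1) := by
    intro a ha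
    obtain ⟨T, hT, hTv, hTa⟩ := exists_halving φ m true (a - 1)
      (by have := Nat.one_le_two_pow (n := m); omega)
    obtain ⟨K, α, α', hs, hb, hα, he⟩ := hTa a (by omega)
    exact ⟨K, α, α', (Finset.card_le_card hs).trans hT, fun q hq => hTv q (hs hq), hb, hα, he⟩
  obtain ⟨K₁, α₁, α₁', hc₁, hv₁, hb₁, hα₁, he₁⟩ := key a ha
  obtain ⟨K₂, α₂, α₂', hc₂, hv₂, hb₂, hα₂, he₂⟩ := key a' ha'
  have hs : (K₂ - K₁).support ⊆ K₂.support ∪ K₁.support := Finsupp.support_sub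
  have hsum : φ (zeroSum 1) = φ (node true 1) + φ (node false 1) := by rw [zeroSum_one, map_add]
  have hz : zeroSumComb φ (K₂ - K₁) = zeroSumComb φ K₂ - zeroSumComb φ K₁ := by
    simp [zeroSumComb]
  have ha2 : (a : ℤ) ≤ 2 ^ m := by exact_mod_cast ha
  have ha2' : (a' : ℤ) ≤ 2 ^ m := by exact_mod_cast ha'
  refine ⟨K₂ - K₁, if a' ≤ a then (α₁' : ℤ) - α₂' else (α₂ : ℤ) - α₁, ?_, ?_, ?_, ?_, ?_⟩
  · have h1 := Finset.card_le_card hs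
    have h2 := Finset.card_union_le K₂.support K₁.support
    omega
  · intro q hq
    rcases Finset.mem_union.1 (hs hq) with h | h
    · exact hv₂ q h
    · exact hv₁ q h
  · intro q
    have hq0 : (0 : ℤ) ≤ q.2 := by positivity
    have h : |(K₂ q - K₁ q) * q.2| ≤ 2 ^ m := by
      by_cases hq : q.1 = true
      · have h1 := (hb₁ q).1 hq
        have h2 := (hb₂ q).1 hq
        have := mul_nonneg h1.1 hq0
        have := mul_nonneg h2.1 hq0
        rw [abs_le]
        constructor <;> nlinarith
      · have h1 := (hb₁ q).2 hq
        have h2 := (hb₂ q).2 hq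
        have := mul_nonneg (neg_nonneg.2 h1.1) hq0
        have := mul_nonneg (neg_nonneg.2 h2.1) hq0
        rw [abs_le]
        constructor <;> nlinarith
    rwa [abs_mul, abs_of_nonneg hq0] at h
  · split_ifs <;> rw [abs_le] <;> constructor <;> omega
  · rw [he₁, he₂, hz, hsum]
    have e1 : (a : ℤ) = α₁ + α₁' := by omega
    have e2 : (a' : ℤ) = α₂ + α₂' := by omega
    by_cases h : a' ≤ a
    · rw [if_pos h, max_eq_left h, min_eq_right h, Nat.cast_sub h, e1, e2, decide_eq_true h]
      module
    · have h' : a ≤ a' := by omega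
      rw [if_neg h, max_eq_right h', min_eq_left h', Nat.cast_sub h', e1, e2,
        decide_eq_false h]
      module

end Halving

/-! ### Privacy of BaseSumDP -/

section Base

theorem zeta_pos {ε : ℝ} (hε : 0 < ε) : 0 < zeta ε := by
  unfold zeta
  exact lt_min (by norm_num) (by positivity)

theorem zeta_le (ε : ℝ) : zeta ε ≤ 0.1 := min_le_left _ _

theorem one_le_sqrt_div_zeta {ε : ℝ} (hε : 0 < ε) {n : ℕ} (hn : 0 < n) :
    1 ≤ Real.sqrt (n / zeta ε) := by
  rw [Real.one_le_sqrt, le_div_iff₀ (zeta_pos hε), one_mul]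
  have : (1 : ℝ) ≤ n := by exact_mod_cast hn
  have := zeta_le ε
  norm_num at this
  linarith

theorem exists_reducedSize_eq {ε : ℝ} (hε : 0 < ε) {n : ℕ} (hn : 0 < n) (j : ℕ) :
    ∃ m, m ≤ j ∧ reducedSize ε n (2 ^ j) = 2 ^ m ∧ gridWidth ε n (2 ^ j) = 2 ^ (j - m) ∧
      (2 : ℝ) ^ m ≤ Real.sqrt (n / zeta ε) ∧
      (m < j → Real.sqrt (n / zeta ε) < 2 * 2 ^ m) := by
  have h1 := one_le_sqrt_div_zeta hε hn
  set x := Real.sqrt (n / zeta ε) with hx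
  have hx0 : 0 < x := by linarith
  have hgrid : ∀ m, m ≤ j → reducedSize ε n (2 ^ j) = 2 ^ m →
      gridWidth ε n (2 ^ j) = 2 ^ (j - m) := fun m hm h => by
    rw [gridWidth, h, Nat.pow_div hm (by norm_num)]
  by_cases h : x < ((2 ^ j : ℕ) : ℝ)
  · have hlog0 : 0 ≤ Real.logb 2 x := Real.logb_nonneg (by norm_num) h1
    have hred : reducedSize ε n (2 ^ j) = 2 ^ ⌊Real.logb 2 x⌋₊ := if_pos h
    have hlog : Real.logb 2 x < j := by
      rw [Real.logb_lt_iff_lt_rpow (by norm_num) hx0]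
      push_cast at h
      simpa using h
    have hm : ⌊Real.logb 2 x⌋₊ ≤ j := by
      have := (Nat.floor_lt hlog0).2 hlog
      omega
    refine ⟨_, hm, hred, hgrid _ hm hred, ?_, fun _ => ?_⟩
    · have := Nat.floor_le hlog0
      rw [Real.le_logb_iff_rpow_le (by norm_num) hx0] at this
      simpa using this
    · have := Nat.lt_floor_add_one (Real.logb 2 x)
      rw [Real.logb_lt_iff_lt_rpow (by norm_num) hx0] at this
      have e : (2 : ℝ) ^ ((⌊Real.logb 2 x⌋₊ : ℝ) + 1) = 2 * 2 ^ ⌊Real.logb 2 x⌋₊ := by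
        rw [Real.rpow_add_one (by norm_num), Real.rpow_natCast]
        ring
      rwa [e] at this
  · have hred : reducedSize ε n (2 ^ j) = 2 ^ j := if_neg h
    refine ⟨j, le_rfl, hred, hgrid j le_rfl hred, ?_, fun h => absurd h (lt_irrefl _)⟩
    have := not_lt.1 h
    push_cast at this
    exact this

theorem map_indep_nsmul {G : Type*} [AddCommMonoid G] (N : PMF ℕ) (s : G) (n : ℕ) :
    (N.map fun z => z • s) ^ n = (N ^ n).map fun z => z • s :=
  (map_conv_pow (multiplesHom G s) N n).symm

/-- The total noise carried by the multiset `s` of largest absolute value `v`. -/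
def totalFlood (ε δ : ℝ) (U' v : ℕ) (s : Multiset ℤ) : PMF (Multiset ℤ) :=
  (negBin (3 * (1 + Real.log (1 / (δ / floodParts U'))))
    (Real.exp (-(0.2 * min 1 (lam * ε / floodParts U') / (2 * U' / v))))).map fun z => z • s

/-- The total central noise carried by the message `w`. -/
def totalCentral (ε : ℝ) (U' : ℕ) (w : ℤ) : PMF (Multiset ℤ) :=
  (negBin 1 (Real.exp (-((1 - lam) * ε / U')))).map fun z => z • ({w} : Multiset ℤ)

theorem floodParts_pos (U' : ℕ) : (0 : ℝ) < floodParts U' := by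
  unfold floodParts
  positivity

theorem one_le_floodParts (U' : ℕ) : (1 : ℝ) ≤ floodParts U' := by
  unfold floodParts
  push_cast
  have : (0 : ℝ) ≤ (Nat.clog 2 U' : ℝ) := by positivity
  linarith

theorem floodEps_pos {ε : ℝ} (hε : 0 < ε) (U' : ℕ) :
    0 < min 1 (lam * ε / floodParts U') := by
  have := floodParts_pos U'
  refine lt_min one_pos ?_
  unfold lam
  positivity

theorem floodDelta_lt_one {δ : ℝ} (hδ : 0 < δ) (hδ1 : δ < 1) (U' : ℕ) :
    0 < δ / floodParts U' ∧ δ / floodParts U' < 1 := by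
  have h0 := floodParts_pos U'
  have h1 := one_le_floodParts U'
  refine ⟨by positivity, ?_⟩
  rw [div_lt_one h0]
  linarith

theorem floodShape_pos {δ : ℝ} (hδ : 0 < δ) (hδ1 : δ < 1) (U' : ℕ) :
    0 < 3 * (1 + Real.log (1 / (δ / floodParts U'))) := by
  obtain ⟨h0, h1⟩ := floodDelta_lt_one hδ hδ1 U'
  have := Real.log_pos (show 1 < 1 / (δ / floodParts U') by rw [lt_div_iff₀ h0]; linarith)
  linarith

theorem exp_neg_lt_one {x : ℝ} (hx : 0 < x) : Real.exp (-x) < 1 := by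
  rw [Real.exp_lt_one_iff]
  linarith

theorem floodNoise_pow {ε δ : ℝ} (hε : 0 < ε) (hδ : 0 < δ) (hδ1 : δ < 1) {n U' v : ℕ}
    (hn : 0 < n) (hU : 0 < U') (hv : 0 < v) (s : Multiset ℤ) :
    floodNoise ε δ n U' v s ^ n = totalFlood ε δ U' v s := by
  unfold floodNoise totalFlood
  simp only
  rw [map_indep_nsmul, negBin_pow (floodShape_pos hδ hδ1 U') (Real.exp_pos _) _ n hn]
  have h1 := floodEps_pos hε U'
  have hU' : (0 : ℝ) < U' := by exact_mod_cast hU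
  have hv' : (0 : ℝ) < v := by exact_mod_cast hv
  exact exp_neg_lt_one (by positivity)

theorem one_sub_lam_pos : 0 < 1 - lam := by norm_num [lam]

theorem centralNoise_pow {ε : ℝ} (hε : 0 < ε) {n U' : ℕ} (hn : 0 < n) (hU : 0 < U') (w : ℤ) :
    centralNoise ε n U' w ^ n = totalCentral ε U' w := by
  unfold centralNoise totalCentral
  have hU' : (0 : ℝ) < U' := by exact_mod_cast hU
  have := one_sub_lam_pos
  rw [map_indep_nsmul, negBin_pow one_pos (Real.exp_pos _) (exp_neg_lt_one (by positivity)) n hn]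

theorem prod_list_range' {M : Type*} [CommMonoid M] (U : ℕ) (g : ℕ → M) :
    ((List.range' 2 (U - 1)).map g).prod = ∏ v ∈ Finset.Icc 2 U, g v := by
  have : U - 1 = U + 1 - 2 := by omega
  rw [this]
  rfl

theorem noise_eq (ε δ : ℝ) (n U' : ℕ) :
    noise ε δ n U' = centralNoise ε n U' 1 * centralNoise ε n U' (-1) *
      floodNoise ε δ n U' 1 (zeroSum 1) *
      ∏ q ∈ (Finset.univ : Finset Bool) ×ˢ Finset.Icc 2 U',
        floodNoise ε δ n U' q.2 (signedZeroSum q.1 q.2) := by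
  rw [noise, indepUnion_eq_prod, List.prod_append, List.flatMap_def, List.prod_flatten,
    List.map_map, prod_list_range', Finset.prod_product_right]
  simp [signedZeroSum, mul_assoc]

theorem noise_pow {ε δ : ℝ} (hε : 0 < ε) (hδ : 0 < δ) (hδ1 : δ < 1) {n U' : ℕ}
    (hn : 0 < n) (hU : 0 < U') :
    noise ε δ n U' ^ n = totalCentral ε U' 1 * totalCentral ε U' (-1) *
      totalFlood ε δ U' 1 (zeroSum 1) *
      ∏ q ∈ (Finset.univ : Finset Bool) ×ˢ Finset.Icc 2 U',
        totalFlood ε δ U' q.2 (signedZeroSum q.1 q.2) := by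
  rw [noise_eq, mul_pow, mul_pow, mul_pow, centralNoise_pow hε hn hU, centralNoise_pow hε hn hU,
    floodNoise_pow hε hδ hδ1 hn hU one_pos, ← Finset.prod_pow]
  congr 1
  refine Finset.prod_congr rfl fun q hq => floodNoise_pow hε hδ hδ1 hn hU ?_ _
  have := Finset.mem_Icc.1 (Finset.mem_product.1 hq).2
  omega

/-- Counting messages, as an injective homomorphism to a group. -/
def countHom : Multiset ℤ →+ (ℤ → ℤ) where
  toFun S v := (S.count v : ℤ)
  map_zero' := by ext; simp
  map_add' S T := by ext; simp

theorem countHom_injective : Function.Injective countHom := fun S T h => by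
  refine Multiset.ext.2 fun v => ?_
  exact Int.ofNat.inj (congrFun h v)

theorem DPLe.nsmul_shift {G : Type*} [AddCommGroup G] {c δ : ℝ≥0∞} {N : PMF ℕ} {k : ℤ}
    (h : DPLe c δ (N.map fun z : ℕ => (z : ℤ)) (N.map fun z : ℕ => k + (z : ℤ)))
    (φ : Multiset ℤ →+ G) (s : Multiset ℤ) :
    DPLe c δ ((N.map fun z => z • s).map φ)
      (PMF.pure (k • φ s) * (N.map fun z => z • s).map φ) := by
  have := h.map fun z : ℤ => z • φ s
  rw [PMF.map_comp, PMF.map_comp] at this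
  rw [pure_mul_eq_map, PMF.map_comp, PMF.map_comp]
  convert this using 2
  · ext z
    simp
  · ext z
    simp [add_smul]

theorem totalFlood_shift {G : Type*} [AddCommGroup G] {ε δ : ℝ} (hε : 0 < ε) (hδ : 0 < δ)
    (hδ1 : δ < 1) {U' v : ℕ} (hv : 0 < v) (hvU : v ≤ U') (φ : Multiset ℤ →+ G) (s : Multiset ℤ)
    (k : ℤ) (hk : |k| * v ≤ U') :
    DPLe (ENNReal.ofReal (Real.exp (lam * ε / floodParts U')))
      (ENNReal.ofReal (δ / floodParts U')) ((totalFlood ε δ U' v s).map φ)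
      (PMF.pure (k • φ s) * (totalFlood ε δ U' v s).map φ) := by
  obtain ⟨h0, h1⟩ := floodDelta_lt_one hδ hδ1 U'
  have hv' : (0 : ℝ) < v := by exact_mod_cast hv
  have hvU' : (v : ℝ) ≤ U' := by exact_mod_cast hvU
  have hk' : |(k : ℝ)| * v ≤ U' := by exact_mod_cast hk
  refine DPLe.nsmul_shift (DPLe.mono (negBin_shift (floodEps_pos hε U') (min_le_left _ _) ?_ h0 h1
    k ?_) ?_ le_rfl) φ s
  · rw [le_div_iff₀ hv']
    linarith
  · rw [div_div, mul_comm (v : ℝ) 2, mul_div_mul_left _ _ two_ne_zero, le_div_iff₀ hv']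
    exact hk'
  · exact ENNReal.ofReal_le_ofReal (Real.exp_le_exp.2 (min_le_right _ _))

theorem totalCentral_shift {G : Type*} [AddCommGroup G] {ε : ℝ} (hε : 0 < ε) {U' : ℕ}
    (φ : Multiset ℤ →+ G) (w : ℤ) (j : ℕ) (hj : j ≤ U') (hU : 0 < U') :
    DPLe (ENNReal.ofReal (Real.exp ((1 - lam) * ε))) 0 ((totalCentral ε U' w).map φ)
      (PMF.pure ((-(j : ℤ)) • φ {w}) * (totalCentral ε U' w).map φ) := by
  have hU' : (0 : ℝ) < U' := by exact_mod_cast hU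
  have hj' : (j : ℝ) ≤ U' := by exact_mod_cast hj
  have hl := one_sub_lam_pos
  refine DPLe.nsmul_shift (DPLe.mono (negBin_shift_down le_rfl (Real.exp_pos _)
    (exp_neg_lt_one (by positivity)) j) ?_ le_rfl) φ {w}
  refine ENNReal.ofReal_le_ofReal ?_
  rw [← Real.exp_nat_mul, ← Real.exp_neg, Real.exp_le_exp, mul_neg, neg_neg]
  calc (j : ℝ) * ((1 - lam) * ε / U') ≤ U' * ((1 - lam) * ε / U') := by gcongr
    _ = (1 - lam) * ε := by field_simp

/-- The total noise hides a single message. -/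
theorem noise_shift {ε δ : ℝ} (hε : 0 < ε) (hδ : 0 < δ) (hδ1 : δ < 1) {n m : ℕ} (hn : 0 < n)
    (a a' : ℕ) (ha : a ≤ 2 ^ m) (ha' : a' ≤ 2 ^ m) :
    DPLe (ENNReal.ofReal (Real.exp ε)) (ENNReal.ofReal δ)
      (PMF.pure (node true a) * noise ε δ n (2 ^ m) ^ n)
      (PMF.pure (node true a') * noise ε δ n (2 ^ m) ^ n) := by
  classical
  refine DPLe.of_map countHom_injective ?_
  set φ := countHom
  have hU : 0 < 2 ^ m := by positivity
  obtain ⟨K, k, hcard, hsupp, hK, hk, he⟩ := exists_shift φ m a a' ha ha'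
  rw [map_conv, map_conv, PMF.pure_map, PMF.pure_map, he, pure_add, mul_assoc]
  refine DPLe.mul_left ?_ _
  set A : Finset (Bool × ℕ) := Finset.univ ×ˢ Finset.Icc 2 (2 ^ m) with hA
  have hKA : K.support ⊆ A := fun q hq => by simpa [hA] using hsupp q hq
  have hsum : zeroSumComb φ K = ∑ q ∈ A, K q • φ (signedZeroSum q.1 q.2) := by
    rw [zeroSumComb, Finsupp.linearCombination_apply, Finsupp.sum_of_support_subset K hKA]
    simp
  set c := lam * ε / floodParts (2 ^ m) with hc
  set δ' := δ / floodParts (2 ^ m) with hδ'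
  have hΓ := floodParts_pos (2 ^ m)
  have hΓe : (floodParts (2 ^ m) : ℝ) = 4 * m + 1 := by
    rw [floodParts, Nat.clog_pow 2 m (by norm_num)]
    push_cast
    ring
  have hc0 : 0 ≤ c := by
    rw [hc]
    unfold lam
    positivity
  have hδ'0 : 0 ≤ δ' := by positivity
  have hflood : DPLe (∏ q ∈ A, if K q = 0 then 1 else ENNReal.ofReal (Real.exp c))
      (∑ q ∈ A, if K q = 0 then 0 else ENNReal.ofReal δ')
      (∏ q ∈ A, (totalFlood ε δ (2 ^ m) q.2 (signedZeroSum q.1 q.2)).map φ)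
      (∏ q ∈ A, PMF.pure (K q • φ (signedZeroSum q.1 q.2)) *
        (totalFlood ε δ (2 ^ m) q.2 (signedZeroSum q.1 q.2)).map φ) := by
    refine DPLe.prod A fun q hq => ?_
    by_cases h0 : K q = 0
    · simpa [h0, pure_zero] using DPLe.refl _
    · rw [if_neg h0, if_neg h0]
      have hq' := Finset.mem_Icc.1 (Finset.mem_product.1 hq).2
      exact totalFlood_shift hε hδ hδ1 (by omega) hq'.2 φ _ _ (by exact_mod_cast hK q)
  have hone := totalFlood_shift hε hδ hδ1 one_pos (Nat.one_le_two_pow (n := m)) φ (zeroSum 1) k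
    (by simpa using hk)
  have hcount : (A.filter fun q => ¬ K q = 0).card ≤ 4 * m := by
    refine le_trans (Finset.card_le_card fun q hq => ?_) hcard
    exact Finsupp.mem_support_iff.2 (Finset.mem_filter.1 hq).2
  have hprod : (∏ q ∈ A, if K q = 0 then 1 else ENNReal.ofReal (Real.exp c)) ≤
      ENNReal.ofReal (Real.exp (4 * m * c)) := by
    rw [Finset.prod_ite, Finset.prod_const_one, one_mul, Finset.prod_const,
      ← ENNReal.ofReal_pow (Real.exp_pos _).le, ← Real.exp_nat_mul]
    refine ENNReal.ofReal_le_ofReal (Real.exp_le_exp.2 ?_)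
    gcongr
    exact_mod_cast hcount
  have hdsum : (∑ q ∈ A, if K q = 0 then 0 else ENNReal.ofReal δ') ≤
      ENNReal.ofReal (4 * m * δ') := by
    rw [Finset.sum_ite, Finset.sum_const_zero, zero_add, Finset.sum_const, nsmul_eq_mul,
      ← ENNReal.ofReal_natCast, ← ENNReal.ofReal_mul (by positivity)]
    refine ENNReal.ofReal_le_ofReal ?_
    gcongr
    exact_mod_cast hcount
  have htot_c : (1 - lam) * ε + c + 4 * m * c = ε := by
    have : (floodParts (2 ^ m) : ℝ) * c = lam * ε := by rw [hc]; field_simp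
    rw [hΓe] at this
    linarith
  have htot_δ : 0 + ENNReal.ofReal δ' + ENNReal.ofReal (4 * m * δ') = ENNReal.ofReal δ := by
    rw [zero_add, ← ENNReal.ofReal_add hδ'0 (by positivity)]
    congr 1
    have : (floodParts (2 ^ m) : ℝ) * δ' = δ := by rw [hδ']; field_simp
    rw [hΓe] at this
    linarith
  have hj : max a a' - min a a' ≤ 2 ^ m := by omega
  have hcomb : ∀ C₁ C₂ C₁' : PMF (ℤ → ℤ), DPLe (ENNReal.ofReal (Real.exp ((1 - lam) * ε))) 0
      (C₁ * C₂) (C₁' * (C₁ * C₂)) →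
      DPLe (ENNReal.ofReal (Real.exp ε)) (ENNReal.ofReal δ)
        (C₁ * C₂ * (totalFlood ε δ (2 ^ m) 1 (zeroSum 1)).map φ *
          ∏ q ∈ A, (totalFlood ε δ (2 ^ m) q.2 (signedZeroSum q.1 q.2)).map φ)
        (PMF.pure (zeroSumComb φ K + k • φ (zeroSum 1)) * C₁' *
          (C₁ * C₂ * (totalFlood ε δ (2 ^ m) 1 (zeroSum 1)).map φ *
            ∏ q ∈ A, (totalFlood ε δ (2 ^ m) q.2 (signedZeroSum q.1 q.2)).map φ)) := by
    intro C₁ C₂ C₁' h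
    have h1 := (h.mul hone).mul hflood
    rw [Finset.prod_mul_distrib, ← pure_sum, ← hsum] at h1
    have h2 := h1.mono (c' := ENNReal.ofReal (Real.exp ε)) (δ' := ENNReal.ofReal δ) ?_ ?_
    · convert h2 using 1
      rw [pure_add]
      simp only [mul_comm, mul_left_comm, mul_assoc]
    · have e : ENNReal.ofReal (Real.exp ε) = ENNReal.ofReal (Real.exp ((1 - lam) * ε)) *
          ENNReal.ofReal (Real.exp c) * ENNReal.ofReal (Real.exp (4 * m * c)) := by
        rw [← ENNReal.ofReal_mul (by positivity), ← ENNReal.ofReal_mul (by positivity),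
          ← Real.exp_add, ← Real.exp_add, htot_c]
      rw [e]
      gcongr
    · rw [← htot_δ]
      gcongr
  rw [noise_pow hε hδ hδ1 hn hU, map_conv, map_conv, map_conv, map_conv_prod, pure_add]
  refine hcomb _ _ _ ?_
  by_cases haa : a' ≤ a
  · have h := totalCentral_shift hε φ 1 _ hj hU
    have e : node (decide (a' ≤ a)) 1 = {1} := by simp [haa, node]
    rw [e, ← mul_assoc]
    simpa using h.mul (DPLe.refl ((totalCentral ε (2 ^ m) (-1)).map φ))
  · have h := totalCentral_shift hε φ (-1) _ hj hU
    have e : node (decide (a' ≤ a)) 1 = {-1} := by simp [haa, node]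
    rw [e, mul_left_comm]
    exact h.mul_left _

theorem baseRandomizer_eq (ε δ : ℝ) (n U x : ℕ) :
    baseRandomizer ε δ n U x =
      ((randRound (gridWidth ε n U) x).map (node true)) * noise ε δ n (reducedSize ε n U) := by
  rw [conv_def, PMF.bind_map]
  simp [baseRandomizer, node, Function.comp_def]

theorem randRound_support_le {B x V : ℕ} (hB : 0 < B) (hx : x ≤ B * V) :
    ∀ a ∈ (randRound B x).support, a ≤ V := by
  intro a ha
  rw [randRound, dif_neg hB.ne', PMF.mem_support_map_iff] at ha
  obtain ⟨u, -, rfl⟩ := ha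
  have h1 : x / B ≤ V := Nat.div_le_of_le_mul hx
  split_ifs with h
  · by_contra hcon
    have h2 : x / B = V := by omega
    have h3 := Nat.div_add_mod x B
    rw [h2] at h3
    omega
  · exact h1

/-- BaseSumDP is differentially private. -/
theorem base_dp {ε δ : ℝ} (hε : 0 < ε) (hδ : 0 < δ) (hδ1 : δ < 1) {n j : ℕ}
    (x x' : Fin n → ℕ) (hx : ∀ i, x i ≤ 2 ^ j) (hx' : ∀ i, x' i ≤ 2 ^ j)
    (i₀ : Fin n) (h : ∀ i, i ≠ i₀ → x i = x' i) :
    DPLe (ENNReal.ofReal (Real.exp ε)) (ENNReal.ofReal δ)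
      (∏ i, baseRandomizer ε δ n (2 ^ j) (x i)) (∏ i, baseRandomizer ε δ n (2 ^ j) (x' i)) := by
  classical
  have hn : 0 < n := i₀.pos
  obtain ⟨m, hmj, hred, hgrid, -, -⟩ := exists_reducedSize_eq hε hn j
  simp only [baseRandomizer_eq, hred, hgrid, Finset.prod_mul_distrib, Finset.prod_const,
    Finset.card_univ, Fintype.card_fin]
  rw [← Finset.mul_prod_erase _ _ (Finset.mem_univ i₀),
    ← Finset.mul_prod_erase _ (fun i => (randRound (2 ^ (j - m)) (x' i)).map _)
      (Finset.mem_univ i₀)]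
  have e : ∏ i ∈ Finset.univ.erase i₀, (randRound (2 ^ (j - m)) (x i)).map (node true) =
      ∏ i ∈ Finset.univ.erase i₀, (randRound (2 ^ (j - m)) (x' i)).map (node true) :=
    Finset.prod_congr rfl fun i hi => by rw [h i (Finset.ne_of_mem_erase hi)]
  rw [e, mul_right_comm, mul_right_comm _ _ (noise ε δ n (2 ^ m) ^ n), mul_comm, mul_comm _ (∏ i ∈ _, _)]
  refine DPLe.mul_left ?_ _
  have hpow : 2 ^ (j - m) * 2 ^ m = 2 ^ j := by rw [← pow_add]; congr 1; omega
  have hbind : ∀ y : ℕ, (randRound (2 ^ (j - m)) y).map (node true) * noise ε δ n (2 ^ m) ^ n =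
      (randRound (2 ^ (j - m)) y).bind
        fun a => PMF.pure (node true a) * noise ε δ n (2 ^ m) ^ n := fun y => by
    rw [conv_def, PMF.bind_map]
    congr 1
    funext a
    rw [pure_mul_eq_map]
    rfl
  rw [hbind, hbind]
  refine DPLe.bind fun a ha b hb => noise_shift hε hδ hδ1 hn a b ?_ ?_
  · exact randRound_support_le (by positivity) (by rw [hpow]; exact hx i₀) a ha
  · exact randRound_support_le (by positivity) (by rw [hpow]; exact hx' i₀) b hb

end Base

/-! ### Advanced composition -/

section Composition

theorem sinh_le_self_mul_cosh {y : ℝ} (hy : 0 ≤ y) : Real.sinh y ≤ y * Real.cosh y := by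
  have hmono : MonotoneOn (fun y => y * Real.cosh y - Real.sinh y) (Set.Ici 0) := by
    refine monotoneOn_of_deriv_nonneg (convex_Ici 0) (by fun_prop) (by fun_prop) fun x hx => ?_
    rw [interior_Ici, Set.mem_Ioi] at hx
    have hd : HasDerivAt (fun y => y * Real.cosh y - Real.sinh y)
        (1 * Real.cosh x + x * Real.sinh x - Real.cosh x) x :=
      ((hasDerivAt_id' x).mul (Real.hasDerivAt_cosh x)).sub (Real.hasDerivAt_sinh x)
    rw [hd.deriv]
    have := Real.sinh_nonneg_iff.2 hx.le
    nlinarith [mul_nonneg hx.le this]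
  have := hmono (Set.mem_Ici.2 le_rfl) (Set.mem_Ici.2 hy) hy
  simp at this
  linarith

theorem cosh_mul_exp_antitone {x y : ℝ} (hx : 0 ≤ x) (hxy : x ≤ y) :
    Real.cosh y * Real.exp (-(y ^ 2 / 2)) ≤ Real.cosh x * Real.exp (-(x ^ 2 / 2)) := by
  have hanti : AntitoneOn (fun y => Real.cosh y * Real.exp (-(y ^ 2 / 2))) (Set.Ici 0) := by
    refine antitoneOn_of_deriv_nonpos (convex_Ici 0) (by fun_prop) (by fun_prop) fun z hz => ?_
    rw [interior_Ici, Set.mem_Ioi] at hz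
    have hd : HasDerivAt (fun y => Real.cosh y * Real.exp (-(y ^ 2 / 2)))
        (Real.sinh z * Real.exp (-(z ^ 2 / 2)) +
          Real.cosh z * (Real.exp (-(z ^ 2 / 2)) * (-z))) z := by
      refine (Real.hasDerivAt_cosh z).mul ?_
      have h1 : HasDerivAt (fun y : ℝ => -(y ^ 2 / 2)) (-z) z :=
        (((hasDerivAt_pow 2 z).div_const 2).neg).congr_deriv (by norm_num)
      exact h1.exp
    rw [hd.deriv]
    have h1 := sinh_le_self_mul_cosh hz.le
    nlinarith [Real.exp_pos (-(z ^ 2 / 2)), mul_le_mul_of_nonneg_left h1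
      (Real.exp_pos (-(z ^ 2 / 2))).le]
  exact hanti (Set.mem_Ici.2 hx) (Set.mem_Ici.2 (hx.trans hxy)) hxy

/-- A chord of a power function over `[exp (-ε), exp ε]`, together with its value at `1`. -/
theorem exists_chord {ε s : ℝ} (hε : 0 < ε) (hs : 0 < s) :
    ∃ A B : ℝ, 0 ≤ A ∧ 0 ≤ B ∧ A ≤ B ∧ B - A ≤ Real.exp ((s + s ^ 2) * ε ^ 2 / 2) ∧
      ∀ x, Real.exp (-ε) ≤ x → x ≤ Real.exp ε → x ^ (1 + s) + A ≤ B * x := by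
  set g := Real.exp (ε / 2) with hg
  set g' := Real.exp (-(ε / 2)) with hg'
  set c := Real.exp ((s + 1 / 2) * ε) with hc
  set c' := Real.exp (-((s + 1 / 2) * ε)) with hc'
  have hE : Real.exp ε = g * g := by rw [hg, ← Real.exp_add]; ring_nf
  have hF : Real.exp (-ε) = g' * g' := by rw [hg', ← Real.exp_add]; ring_nf
  have hEF : Real.exp (-ε) < Real.exp ε := Real.exp_lt_exp.2 (by linarith)
  have hgg : g' < g := Real.exp_lt_exp.2 (by linarith)
  have hcc : c' ≤ c := Real.exp_le_exp.2 (by nlinarith)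
  have hgpos : 0 < g := Real.exp_pos _
  have hgpos' : 0 < g' := Real.exp_pos _
  have hcpos : 0 < c := Real.exp_pos _
  have hcpos' : 0 < c' := Real.exp_pos _
  have hu : Real.exp ε ^ (1 + s) = c * g := by
    rw [hc, hg, ← Real.exp_mul, ← Real.exp_add]; ring_nf
  have hv : Real.exp (-ε) ^ (1 + s) = c' * g' := by
    rw [hc', hg', ← Real.exp_mul, ← Real.exp_add]; ring_nf
  have hD : 0 < g * g - g' * g' := by rw [← hE, ← hF]; linarith
  have hcg : c' * g ≤ c * g' := by
    rw [hc, hc', hg, hg', ← Real.exp_add, ← Real.exp_add, Real.exp_le_exp]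
    nlinarith
  have hBA : (c * g - c' * g') / (g * g - g' * g') - (c * g' - c' * g) / (g * g - g' * g') =
      (c + c') / (g + g') := by
    rw [← sub_div, div_eq_div_iff hD.ne' (by positivity)]
    ring
  refine ⟨(c * g' - c' * g) / (g * g - g' * g'), (c * g - c' * g') / (g * g - g' * g'),
    div_nonneg (by linarith) hD.le, div_nonneg ?_ hD.le, ?_, ?_, ?_⟩
  · have : c' * g' ≤ c * g := mul_le_mul hcc hgg.le hgpos'.le hcpos.le
    linarith
  · have : 0 ≤ (c + c') / (g + g') := by positivity
    linarith
  · rw [hBA]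
    have hcosh : (c + c') / (g + g') = Real.cosh ((s + 1 / 2) * ε) / Real.cosh (ε / 2) := by
      rw [Real.cosh_eq, Real.cosh_eq, div_div_div_cancel_right₀ (by norm_num)]
    rw [hcosh, div_le_iff₀ (Real.cosh_pos _)]
    have h := cosh_mul_exp_antitone (x := ε / 2) (y := (s + 1 / 2) * ε) (by linarith) (by nlinarith)
    have h2 := mul_le_mul_of_nonneg_right h (Real.exp_pos (((s + 1 / 2) * ε) ^ 2 / 2)).le
    rw [mul_assoc, mul_assoc, ← Real.exp_add, ← Real.exp_add] at h2
    have e1 : -(((s + 1 / 2) * ε) ^ 2 / 2) + ((s + 1 / 2) * ε) ^ 2 / 2 = 0 := by ring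
    have e2 : -((ε / 2) ^ 2 / 2) + ((s + 1 / 2) * ε) ^ 2 / 2 = (s + s ^ 2) * ε ^ 2 / 2 := by ring
    rw [e1, e2, Real.exp_zero, mul_one] at h2
    linarith
  · intro x hx1 hx2
    have hconv := convexOn_rpow (show 1 ≤ 1 + s by linarith)
    have hD' : 0 < Real.exp ε - Real.exp (-ε) := by linarith
    have h := hconv.2 (Set.mem_Ici.2 (Real.exp_pos (-ε)).le) (Set.mem_Ici.2 (Real.exp_pos ε).le)
      (show 0 ≤ (Real.exp ε - x) / (Real.exp ε - Real.exp (-ε)) from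
        div_nonneg (by linarith) hD'.le)
      (show 0 ≤ (x - Real.exp (-ε)) / (Real.exp ε - Real.exp (-ε)) from
        div_nonneg (by linarith) hD'.le)
      (by rw [← add_div]; field_simp; ring)
    simp only [smul_eq_mul] at h
    rw [hu, hv] at h
    have e1 : (Real.exp ε - x) / (Real.exp ε - Real.exp (-ε)) * Real.exp (-ε) +
        (x - Real.exp (-ε)) / (Real.exp ε - Real.exp (-ε)) * Real.exp ε = x := by
      field_simp
      ring
    rw [e1, hE, hF] at h
    refine (add_le_add_left h _).trans (le_of_eq ?_)
    have hgg' : g * g' = 1 := by rw [hg, hg', ← Real.exp_add]; simp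
    rw [div_mul_eq_mul_div, div_mul_eq_mul_div, div_mul_eq_mul_div, ← add_div, ← add_div]
    congr 1
    linear_combination (c' * g - c * g') * hgg'

variable {M : Type}

/-- Moment bound of order `1 + s` on the likelihood ratio of a pair of distributions, outside of
an event of probability `Δ`. -/
def MomentLe (s : ℝ) (K Δ : ℝ≥0∞) (P Q : PMF M) : Prop :=
  ∃ (Ω : Type) (p q h : Ω → ℝ≥0∞) (φ : Ω → M), (∀ ω, p ω ≠ ⊤) ∧
    (∀ f : M → ℝ≥0∞, (∀ x, f x ≤ 1) → ev P f ≤ (∑' ω, p ω * f (φ ω)) + Δ) ∧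
    (∀ f : M → ℝ≥0∞, (∀ x, f x ≤ 1) → (∑' ω, q ω * f (φ ω)) ≤ ev Q f) ∧
    (∀ ω, p ω ^ (1 + s) ≤ h ω * q ω ^ s) ∧ ∑' ω, h ω ≤ K

theorem MomentLe.refl {s : ℝ} (hs : 0 < s) (P : PMF M) : MomentLe s 1 0 P P := by
  refine ⟨M, P, P, P, id, P.apply_ne_top, fun f _ => by simp [ev], fun f _ => by simp [ev],
    fun x => ?_, P.tsum_coe.le⟩
  by_cases h0 : P x = 0
  · rw [h0, ENNReal.zero_rpow_of_pos (by linarith)]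
    simp
  · rw [ENNReal.rpow_add _ _ h0 (P.apply_ne_top x), ENNReal.rpow_one]

theorem MomentLe.mul [AddCommMonoid M] {s : ℝ} (hs : 0 < s) {K₁ K₂ Δ₁ Δ₂ : ℝ≥0∞}
    {P₁ P₂ Q₁ Q₂ : PMF M} (h₁ : MomentLe s K₁ Δ₁ P₁ Q₁) (h₂ : MomentLe s K₂ Δ₂ P₂ Q₂) :
    MomentLe s (K₁ * K₂) (Δ₁ + Δ₂) (P₁ * P₂) (Q₁ * Q₂) := by
  obtain ⟨Ω₁, p₁, q₁, g₁, φ₁, hf₁, hP₁, hQ₁, hg₁, hK₁⟩ := h₁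
  obtain ⟨Ω₂, p₂, q₂, g₂, φ₂, hf₂, hP₂, hQ₂, hg₂, hK₂⟩ := h₂
  refine ⟨Ω₁ × Ω₂, fun ω => p₁ ω.1 * p₂ ω.2, fun ω => q₁ ω.1 * q₂ ω.2, fun ω => g₁ ω.1 * g₂ ω.2,
    fun ω => φ₁ ω.1 + φ₂ ω.2, fun ω => ENNReal.mul_ne_top (hf₁ _) (hf₂ _), ?_, ?_, ?_, ?_⟩
  · intro f hf
    rw [ev_mul]
    set g : M → ℝ≥0∞ := fun x => min 1 (∑' ω, p₂ ω * f (x + φ₂ ω))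
    calc ev P₁ (fun x => ev P₂ fun y => f (x + y))
        ≤ ev P₁ (fun x => g x + Δ₂) := by
          refine ev_mono _ fun x => ?_
          rw [← min_add_add_right]
          exact le_min ((ev_le_one _ fun y => hf _).trans le_self_add) (hP₂ _ fun y => hf _)
      _ = ev P₁ g + Δ₂ := by rw [ev_add, ev_const]
      _ ≤ ((∑' ω, p₁ ω * g (φ₁ ω)) + Δ₁) + Δ₂ := by
          gcongr
          exact hP₁ g fun x => min_le_left _ _
      _ ≤ ((∑' ω, p₁ ω * (∑' ω', p₂ ω' * f (φ₁ ω + φ₂ ω'))) + Δ₁) + Δ₂ := by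
          gcongr with ω
          exact min_le_right _ _
      _ = _ := by
          rw [ENNReal.tsum_prod', add_assoc]
          simp only [← ENNReal.tsum_mul_left, mul_assoc]
  · intro f hf
    rw [ev_mul, ENNReal.tsum_prod']
    refine le_trans ?_ (hQ₁ _ fun x => ev_le_one _ fun y => hf _)
    simp only [mul_assoc, ENNReal.tsum_mul_left]
    gcongr with ω
    exact hQ₂ _ fun y => hf _
  · intro ω
    rw [ENNReal.mul_rpow_of_nonneg _ _ (by linarith), ENNReal.mul_rpow_of_nonneg _ _ hs.le]
    calc _ ≤ _ := mul_le_mul' (hg₁ ω.1) (hg₂ ω.2)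
      _ = _ := by ring
  · rw [ENNReal.tsum_prod']
    simp only [ENNReal.tsum_mul_left, ENNReal.tsum_mul_right]
    gcongr

theorem MomentLe.prod [AddCommMonoid M] {ι : Type*} {s : ℝ} (hs : 0 < s) (A : Finset ι)
    {K Δ : ι → ℝ≥0∞} {P Q : ι → PMF M} (h : ∀ i ∈ A, MomentLe s (K i) (Δ i) (P i) (Q i)) :
    MomentLe s (∏ i ∈ A, K i) (∑ i ∈ A, Δ i) (∏ i ∈ A, P i) (∏ i ∈ A, Q i) := by
  classical
  induction A using Finset.induction_on with
  | empty => simpa using MomentLe.refl hs (1 : PMF M)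
  | insert a A ha ih =>
    simp only [Finset.prod_insert ha, Finset.sum_insert ha]
    exact (h a (Finset.mem_insert_self a A)).mul hs
      (ih fun i hi => h i (Finset.mem_insert_of_mem hi))

theorem le_add_of_rpow_le {s θ : ℝ} (hs : 0 < s) (hθ : 0 < θ) {p q h : ℝ≥0∞} (hp : p ≠ ⊤)
    (hle : p ^ (1 + s) ≤ h * q ^ s) :
    p ≤ ENNReal.ofReal θ * q + ENNReal.ofReal (θ ^ (-s)) * h := by
  rcases le_or_gt p (ENNReal.ofReal θ * q) with hpq | hpq
  · exact hpq.trans le_self_add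
  · refine le_trans ?_ le_add_self
    have hp0 : p ≠ 0 := (zero_le.trans_lt hpq).ne'
    have hθ0 : ENNReal.ofReal θ ≠ 0 := by simpa using hθ
    have hps0 : p ^ s ≠ 0 := by simp [ENNReal.rpow_eq_zero_iff, hp0, hp]
    have hps : p ^ s ≠ ⊤ := by simp [ENNReal.rpow_eq_top_iff, hp0, hp]
    have hq : q ≤ (ENNReal.ofReal θ)⁻¹ * p := by
      rw [← ENNReal.mul_le_iff_le_inv hθ0 ENNReal.ofReal_ne_top]
      exact hpq.le
    have hinv : ((ENNReal.ofReal θ)⁻¹) ^ s = ENNReal.ofReal (θ ^ (-s)) := by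
      rw [← ENNReal.ofReal_inv_of_pos hθ, ENNReal.ofReal_rpow_of_pos (by positivity),
        Real.inv_rpow hθ.le, Real.rpow_neg hθ.le]
    rw [ENNReal.rpow_add _ _ hp0 hp, ENNReal.rpow_one] at hle
    have h2 : p * p ^ s ≤ (ENNReal.ofReal (θ ^ (-s)) * h) * p ^ s := by
      refine hle.trans ?_
      calc h * q ^ s ≤ h * ((ENNReal.ofReal θ)⁻¹ * p) ^ s := by gcongr
        _ = _ := by
          rw [ENNReal.mul_rpow_of_nonneg _ _ hs.le, hinv]
          ring
    exact (ENNReal.mul_le_mul_iff_left hps0 hps).1 h2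

theorem MomentLe.dpLe {s θ : ℝ} (hs : 0 < s) (hθ : 0 < θ) {K Δ : ℝ≥0∞} {P Q : PMF M}
    (h : MomentLe s K Δ P Q) :
    DPLe (ENNReal.ofReal θ) (ENNReal.ofReal (θ ^ (-s)) * K + Δ) P Q := by
  obtain ⟨Ω, p, q, g, φ, hf, hP, hQ, hg, hK⟩ := h
  intro f hf1
  calc ev P f ≤ (∑' ω, p ω * f (φ ω)) + Δ := hP f hf1
    _ ≤ (∑' ω, (ENNReal.ofReal θ * (q ω * f (φ ω)) + ENNReal.ofReal (θ ^ (-s)) * g ω)) + Δ := by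
        gcongr with ω
        calc p ω * f (φ ω) ≤ (ENNReal.ofReal θ * q ω + ENNReal.ofReal (θ ^ (-s)) * g ω) *
              f (φ ω) := by
              gcongr
              exact le_add_of_rpow_le hs hθ (hf ω) (hg ω)
          _ = ENNReal.ofReal θ * (q ω * f (φ ω)) + ENNReal.ofReal (θ ^ (-s)) * g ω * f (φ ω) := by
              ring
          _ ≤ _ := add_le_add le_rfl (mul_le_of_le_one_right zero_le (hf1 _))
    _ ≤ ENNReal.ofReal θ * ev Q f + (ENNReal.ofReal (θ ^ (-s)) * K + Δ) := by
        rw [ENNReal.tsum_add, ENNReal.tsum_mul_left, ENNReal.tsum_mul_left, add_assoc]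
        gcongr
        exact hQ f hf1

theorem one_le_tsum_min_add {c δ : ℝ≥0∞} {P Q : PMF M} (h : DPLe c δ P Q) :
    1 ≤ (∑' x, min (P x) (c * Q x)) + δ := by
  classical
  set S : Set M := {x | c * Q x < P x}
  have h1 := h (S.indicator 1) fun x => Set.indicator_le_self _ 1 _
  calc (1 : ℝ≥0∞) = ev P (S.indicator 1) + ev P (Sᶜ.indicator 1) := by
        rw [← ev_add, ← ev_const P 1]
        congr 1
        funext x
        by_cases hx : x ∈ S <;> simp [hx]
    _ ≤ (c * ev Q (S.indicator 1) + δ) + ev P (Sᶜ.indicator 1) := by gcongr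
    _ = (∑' x, min (P x) (c * Q x)) + δ := by
        rw [add_right_comm, ev, ev, ← ENNReal.tsum_mul_left, ← ENNReal.tsum_add]
        congr 1
        refine tsum_congr fun x => ?_
        by_cases hx : x ∈ S
        · have : c * Q x < P x := hx
          simp [hx, min_eq_right this.le]
        · have : P x ≤ c * Q x := not_lt.1 hx
          simp [hx, min_eq_left this]

theorem exists_interpolation {ε δ : ℝ} (hε : 0 < ε) {P Q : PMF M}
    (h₁ : DPLe (ENNReal.ofReal (Real.exp ε)) (ENNReal.ofReal δ) P Q)
    (h₂ : DPLe (ENNReal.ofReal (Real.exp ε)) (ENNReal.ofReal δ) Q P) :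
    ∃ p q : M → ℝ≥0∞, (∀ x, p x ≤ P x) ∧ (∀ x, q x ≤ Q x) ∧
      (∀ x, p x ≤ ENNReal.ofReal (Real.exp ε) * q x) ∧
      (∀ x, q x ≤ ENNReal.ofReal (Real.exp ε) * p x) ∧
      ∑' x, p x ≤ ∑' x, q x ∧ 1 ≤ (∑' x, p x) + ENNReal.ofReal δ := by
  set c := ENNReal.ofReal (Real.exp ε) with hc
  have hc1 : 1 ≤ c := by
    rw [hc, ← ENNReal.ofReal_one]
    exact ENNReal.ofReal_le_ofReal (Real.one_le_exp hε.le)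
  have hc0 : c ≠ 0 := by simp [hc, Real.exp_pos]
  have hct : c ≠ ⊤ := ENNReal.ofReal_ne_top
  set p : M → ℝ≥0∞ := fun x => min (P x) (c * Q x)
  set q : M → ℝ≥0∞ := fun x => min (Q x) (c * P x)
  have hpq : ∀ x, p x ≤ c * q x := fun x => by
    simp only [p, q, mul_min]
    refine le_min (min_le_right _ _) ((min_le_left _ _).trans ?_)
    calc P x = 1 * (1 * P x) := by simp
      _ ≤ c * (c * P x) := by gcongr
  have hqp : ∀ x, q x ≤ c * p x := fun x => by
    simp only [p, q, mul_min]
    refine le_min (min_le_right _ _) ((min_le_left _ _).trans ?_)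
    calc Q x = 1 * (1 * Q x) := by simp
      _ ≤ c * (c * Q x) := by gcongr
  have hp1 := one_le_tsum_min_add h₁
  have hq1 := one_le_tsum_min_add h₂
  rcases le_or_gt (∑' x, p x) (∑' x, q x) with hle | hlt
  · exact ⟨p, q, fun x => min_le_left _ _, fun x => min_le_left _ _, hpq, hqp, hle, hp1⟩
  · have hpt : ∑' x, p x ≠ ⊤ := ne_top_of_le_ne_top ENNReal.one_ne_top
      ((ENNReal.tsum_le_tsum fun x => min_le_left _ _).trans P.tsum_coe.le)
    have hqt : ∑' x, q x ≠ ⊤ := ne_top_of_le_ne_top ENNReal.one_ne_top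
      ((ENNReal.tsum_le_tsum fun x => min_le_left _ _).trans Q.tsum_coe.le)
    set a := (∑' x, p x).toReal with ha
    set b := (∑' x, q x).toReal with hb
    have hab : b < a := (ENNReal.toReal_lt_toReal hqt hpt).2 hlt
    have hb0 : 0 ≤ b := ENNReal.toReal_nonneg
    set e := Real.exp (-ε) with he
    have he0 : 0 < e := Real.exp_pos _
    have he1 : e ≤ 1 := (exp_neg_lt_one hε).le
    have hce : c⁻¹ = ENNReal.ofReal e := by
      rw [hc, ← ENNReal.ofReal_inv_of_pos (Real.exp_pos _), ← Real.exp_neg]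
    have hD : 0 < a - e * b := by nlinarith
    set τ := (b - e * b) / (a - e * b) with hτ
    have hτ0 : 0 ≤ τ := div_nonneg (by nlinarith) hD.le
    have hτ1 : τ ≤ 1 := by rw [hτ, div_le_one hD]; linarith
    have hτb : τ * a + (1 - τ) * (e * b) = b := by
      have : τ * (a - e * b) = b - e * b := by
        rw [hτ, div_mul_cancel₀ _ hD.ne']
      linarith
    have hcp : ∀ x, c⁻¹ * q x ≤ p x := fun x => by
      have := hqp x
      calc c⁻¹ * q x ≤ c⁻¹ * (c * p x) := by gcongr
        _ = p x := by rw [← mul_assoc, ENNReal.inv_mul_cancel hc0 hct, one_mul]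
    have hττ : ENNReal.ofReal τ + ENNReal.ofReal (1 - τ) = 1 := by
      rw [← ENNReal.ofReal_add hτ0 (by linarith)]
      simp
    set p' : M → ℝ≥0∞ := fun x => ENNReal.ofReal τ * p x + ENNReal.ofReal (1 - τ) * (c⁻¹ * q x)
    have hp'p : ∀ x, p' x ≤ p x := fun x => by
      calc p' x ≤ ENNReal.ofReal τ * p x + ENNReal.ofReal (1 - τ) * p x := by
            simp only [p']
            gcongr
            exact hcp x
        _ = p x := by rw [← add_mul, hττ, one_mul]
    have hp'q : ∀ x, c⁻¹ * q x ≤ p' x := fun x => by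
      calc c⁻¹ * q x = ENNReal.ofReal τ * (c⁻¹ * q x) + ENNReal.ofReal (1 - τ) * (c⁻¹ * q x) := by
            rw [← add_mul, hττ, one_mul]
        _ ≤ p' x := by
            simp only [p']
            gcongr
            exact hcp x
    have hsum : ∑' x, p' x = ∑' x, q x := by
      simp only [p', ENNReal.tsum_add, ENNReal.tsum_mul_left]
      rw [← ENNReal.ofReal_toReal hpt, ← ENNReal.ofReal_toReal hqt, ← ha, ← hb, hce,
        ← ENNReal.ofReal_mul he0.le, ← ENNReal.ofReal_mul hτ0, ← ENNReal.ofReal_mul (by linarith),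
        ← ENNReal.ofReal_add (by positivity)
          (mul_nonneg (by linarith) (by positivity)), hτb]
    refine ⟨p', q, fun x => (hp'p x).trans (min_le_left _ _), fun x => min_le_left _ _,
      fun x => (hp'p x).trans (hpq x), fun x => ?_, hsum.le, by rw [hsum]; exact hq1⟩
    calc q x = c * (c⁻¹ * q x) := by rw [← mul_assoc, ENNReal.mul_inv_cancel hc0 hct, one_mul]
      _ ≤ c * p' x := by gcongr; exact hp'q x

theorem rpow_div_add_le {ε s A B : ℝ} (hs : 0 < s) (hA : 0 ≤ A) (hB : 0 ≤ B)
    (hchord : ∀ x, Real.exp (-ε) ≤ x → x ≤ Real.exp ε → x ^ (1 + s) + A ≤ B * x) {p q : ℝ≥0∞}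
    (hp : p ≠ ⊤) (hq : q ≠ ⊤) (hpq : p ≤ ENNReal.ofReal (Real.exp ε) * q)
    (hqp : q ≤ ENNReal.ofReal (Real.exp ε) * p) :
    p ^ (1 + s) / q ^ s + ENNReal.ofReal A * q ≤ ENNReal.ofReal B * p := by
  by_cases hq0 : q = 0
  · have hp0 : p = 0 := by simpa [hq0] using hpq
    rw [hp0, hq0, ENNReal.zero_rpow_of_pos (by linarith)]
    simp
  · lift p to NNReal using hp
    lift q to NNReal using hq
    have hb : (0 : ℝ) < q := by
      have : q ≠ 0 := by simpa using hq0
      exact_mod_cast pos_iff_ne_zero.2 this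
    have hpq' : (p : ℝ) ≤ Real.exp ε * q := by
      rw [← ENNReal.ofReal_coe_nnreal, ← ENNReal.ofReal_coe_nnreal,
        ← ENNReal.ofReal_mul (Real.exp_pos _).le] at hpq
      exact (ENNReal.ofReal_le_ofReal_iff (by positivity)).1 hpq
    have hqp' : (q : ℝ) ≤ Real.exp ε * p := by
      rw [← ENNReal.ofReal_coe_nnreal, ← ENNReal.ofReal_coe_nnreal,
        ← ENNReal.ofReal_mul (Real.exp_pos _).le] at hqp
      exact (ENNReal.ofReal_le_ofReal_iff (by positivity)).1 hqp
    have h := hchord ((p : ℝ) / q) (by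
      rw [le_div_iff₀ hb, Real.exp_neg, inv_mul_le_iff₀ (Real.exp_pos _)]
      exact hqp') (by
      rw [div_le_iff₀ hb]
      exact hpq')
    have hbs : (0 : ℝ) < (q : ℝ) ^ s := Real.rpow_pos_of_pos hb s
    rw [← ENNReal.ofReal_coe_nnreal, ← ENNReal.ofReal_coe_nnreal,
      ENNReal.ofReal_rpow_of_nonneg (by positivity) (by linarith),
      ENNReal.ofReal_rpow_of_pos hb, ← ENNReal.ofReal_div_of_pos hbs, ← ENNReal.ofReal_mul hA,
      ← ENNReal.ofReal_mul hB, ← ENNReal.ofReal_add (by positivity) (by positivity)]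
    refine ENNReal.ofReal_le_ofReal ?_
    have h2 := mul_le_mul_of_nonneg_right h hb.le
    rw [Real.div_rpow (by positivity) hb.le, Real.rpow_add hb, Real.rpow_one, add_mul] at h2
    have e1 : (p : ℝ) ^ (1 + s) / (q * (q : ℝ) ^ s) * q = (p : ℝ) ^ (1 + s) / (q : ℝ) ^ s := by
      field_simp
    have e2 : B * ((p : ℝ) / q) * q = B * p := by field_simp
    rw [e1, e2] at h2
    exact h2

/-- Mutually indistinguishable distributions satisfy a moment bound. -/
theorem momentLe_of_dpLe {ε δ s : ℝ} (hε : 0 < ε) (hs : 0 < s) {P Q : PMF M}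
    (h₁ : DPLe (ENNReal.ofReal (Real.exp ε)) (ENNReal.ofReal δ) P Q)
    (h₂ : DPLe (ENNReal.ofReal (Real.exp ε)) (ENNReal.ofReal δ) Q P) :
    MomentLe s (ENNReal.ofReal (Real.exp ((s + s ^ 2) * ε ^ 2 / 2))) (ENNReal.ofReal δ) P Q := by
  obtain ⟨p, q, hpP, hqQ, hpq, hqp, hsum, hone⟩ := exists_interpolation hε h₁ h₂
  obtain ⟨A, B, hA, hB, hAB, hBA, hchord⟩ := exists_chord hε hs
  have hpt : ∀ x, p x ≠ ⊤ := fun x => ne_top_of_le_ne_top (P.apply_ne_top x) (hpP x)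
  have hqt : ∀ x, q x ≠ ⊤ := fun x => ne_top_of_le_ne_top (Q.apply_ne_top x) (hqQ x)
  have hsp : ∑' x, p x ≤ 1 := (ENNReal.tsum_le_tsum hpP).trans P.tsum_coe.le
  have hsq : ∑' x, q x ≤ 1 := (ENNReal.tsum_le_tsum hqQ).trans Q.tsum_coe.le
  refine ⟨M, p, q, fun x => p x ^ (1 + s) / q x ^ s, id, hpt, ?_, ?_, ?_, ?_⟩
  · intro f hf
    have hrest : ∑' x, (P x - p x) ≤ ENNReal.ofReal δ := by
      have h3 : (∑' x, (P x - p x)) + ∑' x, p x = 1 := by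
        rw [← ENNReal.tsum_add, ← P.tsum_coe]
        exact tsum_congr fun x => tsub_add_cancel_of_le (hpP x)
      have hfin : ∑' x, p x ≠ ⊤ := ne_top_of_le_ne_top ENNReal.one_ne_top hsp
      rw [← h3, add_comm] at hone
      exact (ENNReal.add_le_add_iff_left hfin).1 hone
    calc ev P f ≤ ∑' x, (p x * f x + (P x - p x)) := by
          refine ENNReal.tsum_le_tsum fun x => ?_
          calc P x * f x = (p x + (P x - p x)) * f x := by rw [add_tsub_cancel_of_le (hpP x)]
            _ = p x * f x + (P x - p x) * f x := by ring
            _ ≤ _ := by gcongr; exact mul_le_of_le_one_right zero_le (hf x)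
      _ ≤ _ := by
          rw [ENNReal.tsum_add]
          simp only [id]
          gcongr
  · intro f _
    exact ENNReal.tsum_le_tsum fun x => by simp only [id]; gcongr; exact hqQ x
  · intro x
    by_cases hq0 : q x = 0
    · have hp0 : p x = 0 := by simpa [hq0] using hpq x
      rw [hp0, ENNReal.zero_rpow_of_pos (by linarith)]
      exact zero_le
    · rw [ENNReal.div_mul_cancel]
      · simp [ENNReal.rpow_eq_zero_iff, hq0, hqt x]
      · simp [ENNReal.rpow_eq_top_iff, hq0, hqt x]
  · have h3 : (∑' x, p x ^ (1 + s) / q x ^ s) + ENNReal.ofReal A * ∑' x, q x ≤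
        ENNReal.ofReal B * ∑' x, p x := by
      rw [← ENNReal.tsum_mul_left, ← ENNReal.tsum_mul_left, ← ENNReal.tsum_add]
      exact ENNReal.tsum_le_tsum fun x =>
        rpow_div_add_le hs hA hB hchord (hpt x) (hqt x) (hpq x) (hqp x)
    have h4 : ENNReal.ofReal B * ∑' x, p x ≤
        ENNReal.ofReal (B - A) + ENNReal.ofReal A * ∑' x, q x := by
      calc ENNReal.ofReal B * ∑' x, p x
          = ENNReal.ofReal (B - A) * ∑' x, p x + ENNReal.ofReal A * ∑' x, p x := by
            rw [← add_mul, ← ENNReal.ofReal_add (by linarith) hA, sub_add_cancel]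
        _ ≤ _ := by
            gcongr
            exact mul_le_of_le_one_right zero_le hsp
    have hfin : ENNReal.ofReal A * ∑' x, q x ≠ ⊤ :=
      ENNReal.mul_ne_top ENNReal.ofReal_ne_top (ne_top_of_le_ne_top ENNReal.one_ne_top hsq)
    refine ((ENNReal.add_le_add_iff_right hfin).1 (h3.trans h4)).trans ?_
    exact ENNReal.ofReal_le_ofReal hBA

end Composition

/-! ### The protocol as a product of independent instances of BaseSumDP -/

section Protocol

theorem shuffled_eq_prod {X Z : Type*} {n : ℕ} (R : X → PMF (Multiset Z)) (D : Fin n → X) :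
    shuffled R D = ∏ i, R (D i) := by
  rw [shuffled, indepUnion_eq_prod, List.prod_ofFn]

/-- The instances of BaseSumDP: coordinate, sign and level. -/
abbrev Slot (d : ℕ) := Fin d × Bool × ℕ

/-- The instances of BaseSumDP up to the level `J`. -/
def slots (d J : ℕ) : Finset (Slot d) := Finset.univ ×ˢ Finset.univ ×ˢ Finset.range (J + 1)

/-- The input of a user to an instance of BaseSumDP. -/
def slotInput {d : ℕ} (H : Matrix (Fin d) (Fin d) ℤ) (n U : ℕ) (β : ℝ) (σ : Fin d → ℤˣ)
    (x : Fin d → ℤ) (c : Slot d) : ℕ :=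
  if InLevel c.2.2 (clippedPart d n U β c.2.1 ((rotation H σ).mulVec x c.1)) then
    clippedPart d n U β c.2.1 ((rotation H σ).mulVec x c.1) else 0

/-- Labelling the messages of an instance of BaseSumDP. -/
def labelHom {d : ℕ} (c : Slot d) : Multiset ℤ →+ Multiset (Message d) :=
  Multiset.mapAddMonoidHom fun v => (c.1, c.2.1, c.2.2, v)

variable {d n U : ℕ} {H : Matrix (Fin d) (Fin d) ℤ} {ε δ β : ℝ} {σ : Fin d → ℤˣ}

theorem sumRandomizer_eq (ε δ : ℝ) (n J x : ℕ) :
    sumRandomizer ε δ n J x = ∏ j ∈ Finset.range (J + 1),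
      (baseRandomizer ε δ n (2 ^ j) (if InLevel j x then x else 0)).map
        (Multiset.mapAddMonoidHom fun v => (j, v)) := by
  rw [sumRandomizer, indepUnion_eq_prod]
  rfl

theorem highDimRandomizer_eq (x : Fin d → ℤ) :
    highDimRandomizer H n U ε δ β σ x = ∏ c ∈ slots d (topLevel d n U β),
      (baseRandomizer (coordEps d ε δ) (coordDelta d δ) n (2 ^ c.2.2)
        (slotInput H n U β σ x c)).map (labelHom c) := by
  rw [highDimRandomizer, indepUnion_eq_prod, List.flatMap_def, List.prod_flatten, List.map_map,
    ← List.ofFn_eq_map, List.prod_ofFn, slots, Finset.prod_product]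
  refine Finset.prod_congr rfl fun k _ => ?_
  rw [Finset.prod_product]
  have key : ∀ s : Bool, (sumRandomizer (coordEps d ε δ) (coordDelta d δ) n (topLevel d n U β)
      (clippedPart d n U β s ((rotation H σ).mulVec x k))).map (fun S => S.map fun m => (k, s, m)) =
      ∏ j ∈ Finset.range (topLevel d n U β + 1),
        (baseRandomizer (coordEps d ε δ) (coordDelta d δ) n (2 ^ j)
          (slotInput H n U β σ x (k, s, j))).map (labelHom (k, s, j)) := by
    intro s
    rw [sumRandomizer_eq]
    refine (map_conv_prod (Multiset.mapAddMonoidHom fun m : ℕ × ℤ => (k, s, m)) _ _).trans ?_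
    refine Finset.prod_congr rfl fun j _ => ?_
    rw [PMF.map_comp]
    congr 1
    funext S
    simp [labelHom]
  simp [key]

theorem shuffled_highDim_eq (D : Fin n → Fin d → ℤ) :
    shuffled (highDimRandomizer H n U ε δ β σ) D = ∏ c ∈ slots d (topLevel d n U β),
      (∏ i, baseRandomizer (coordEps d ε δ) (coordDelta d δ) n (2 ^ c.2.2)
        (slotInput H n U β σ (D i) c)).map (labelHom c) := by
  rw [shuffled_eq_prod]
  simp only [highDimRandomizer_eq]
  rw [Finset.prod_comm]
  exact Finset.prod_congr rfl fun c _ => (map_conv_prod _ _ _).symm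

theorem slotInput_le (x : Fin d → ℤ) (c : Slot d) : slotInput H n U β σ x c ≤ 2 ^ c.2.2 := by
  unfold slotInput
  split_ifs with h
  · exact h.2
  · exact Nat.zero_le _

theorem InLevel.unique {j j' x : ℕ} (h : InLevel j x) (h' : InLevel j' x) : j = j' := by
  have key : ∀ {j j' : ℕ}, InLevel j x → InLevel j' x → ¬ j < j' := by
    intro j j' h h' hlt
    have h1 := h.2
    have h2 := h'.1
    rw [if_neg (by omega)] at h2
    have : 2 ^ j ≤ 2 ^ (j' - 1) := Nat.pow_le_pow_right (by norm_num) (by omega)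
    omega
  have h1 := key h h'
  have h2 := key h' h
  omega

theorem inLevel_of_slotInput_ne_zero {x : Fin d → ℤ} {c : Slot d}
    (h : slotInput H n U β σ x c ≠ 0) :
    InLevel c.2.2 (clippedPart d n U β c.2.1 ((rotation H σ).mulVec x c.1)) := by
  unfold slotInput at h
  by_contra hcon
  exact h (if_neg hcon)

/-- In each coordinate, a user has a non-zero input to at most one instance of BaseSumDP. -/
theorem slotInput_injOn (x : Fin d → ℤ) {c c' : Slot d} (h : slotInput H n U β σ x c ≠ 0)
    (h' : slotInput H n U β σ x c' ≠ 0) (hcc : c.1 = c'.1) : c = c' := by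
  have h1 := inLevel_of_slotInput_ne_zero h
  have h2 := inLevel_of_slotInput_ne_zero h'
  obtain ⟨k, s, j⟩ := c
  obtain ⟨k', s', j'⟩ := c'
  simp only at h1 h2 hcc
  subst hcc
  have hs : s = s' := by
    have p1 := (Nat.zero_le _).trans_lt h1.1
    have p2 := (Nat.zero_le _).trans_lt h2.1
    unfold clippedPart at p1 p2
    cases s <;> cases s' <;> simp at p1 p2 ⊢ <;> omega
  subst hs
  rw [h1.unique h2]

theorem card_slotInput_ne_zero_le (x : Fin d → ℤ) (J : ℕ) :
    ((slots d J).filter fun c => slotInput H n U β σ x c ≠ 0).card ≤ d := by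
  classical
  have := Finset.card_le_card_of_injOn (s := (slots d J).filter fun c => slotInput H n U β σ x c ≠ 0)
    (t := (Finset.univ : Finset (Fin d))) (fun c => c.1) (fun _ _ => Finset.mem_univ _)
    (fun c hc c' hc' hcc => slotInput_injOn x (Finset.mem_filter.1 hc).2
      (Finset.mem_filter.1 hc').2 hcc)
  simpa using this

theorem one_le_logb_two_div (hδ : 0 < δ) (hδ1 : δ < 1) : 1 ≤ Real.logb 2 (2 / δ) := by
  rw [Real.le_logb_iff_rpow_le (by norm_num) (by positivity), Real.rpow_one, le_div_iff₀ hδ]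
  linarith

theorem coordEps_pos (hd : 0 < d) (hε : 0 < ε) (hδ : 0 < δ) (hδ1 : δ < 1) :
    0 < coordEps d ε δ := by
  have h1 := one_le_logb_two_div hδ hδ1
  have hd' : (0 : ℝ) < d := by exact_mod_cast hd
  have h2 : 0 < (d : ℝ) * Real.logb 2 (2 / δ) := by positivity
  have := Real.sqrt_pos.2 h2
  unfold coordEps
  positivity

theorem coordDelta_pos (hd : 0 < d) (hδ : 0 < δ) : 0 < coordDelta d δ := by
  have hd' : (0 : ℝ) < d := by exact_mod_cast hd
  unfold coordDelta
  positivity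

theorem coordDelta_lt_one (hd : 0 < d) (hδ1 : δ < 1) : coordDelta d δ < 1 := by
  have hd' : (1 : ℝ) ≤ d := by exact_mod_cast hd
  unfold coordDelta
  rw [div_lt_one (by positivity)]
  linarith

/-- The messages received by the analyzer are differentially private. -/
theorem highDim_isDP (hd : 0 < d) (hε : 0 < ε) (hδ : 0 < δ) (hδ1 : δ < 1)
    (hεδ : ε ≤ 3 * Real.logb 2 (2 / δ)) :
    IsDP (fun D : Fin n → Fin d → ℤ => shuffled (highDimRandomizer H n U ε δ β σ) D) ε δ := by
  classical
  rintro D D' ⟨i₀, hi₀⟩ S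
  simp only
  set L := Real.logb 2 (2 / δ) with hL
  have hL1 : 1 ≤ L := one_le_logb_two_div hδ hδ1
  have hd' : (0 : ℝ) < d := by exact_mod_cast hd
  set ε' := coordEps d ε δ with hε'def
  set δ' := coordDelta d δ with hδ'def
  have hε' : 0 < ε' := coordEps_pos hd hε hδ hδ1
  have hδ' : 0 < δ' := coordDelta_pos hd hδ
  have hδ'1 : δ' < 1 := coordDelta_lt_one hd hδ1
  set s := 2 * L / ε with hs
  have hs0 : 0 < s := by positivity
  set I := slots d (topLevel d n U β)
  set P : Slot d → (Fin n → Fin d → ℤ) → PMF (Multiset (Message d)) := fun c D =>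
    (∏ i, baseRandomizer ε' δ' n (2 ^ c.2.2) (slotInput H n U β σ (D i) c)).map (labelHom c)
  set Kf := ENNReal.ofReal (Real.exp ((s + s ^ 2) * ε' ^ 2 / 2))
  set aff : Slot d → Prop := fun c =>
    slotInput H n U β σ (D i₀) c ≠ slotInput H n U β σ (D' i₀) c
  have hbase : ∀ D D' : Fin n → Fin d → ℤ, (∀ i, i ≠ i₀ → D i = D' i) → ∀ c,
      DPLe (ENNReal.ofReal (Real.exp ε')) (ENNReal.ofReal δ') (P c D) (P c D') := by
    intro D D' h c
    refine DPLe.map (base_dp hε' hδ' hδ'1 _ _ (fun i => slotInput_le _ _)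
      (fun i => slotInput_le _ _) i₀ fun i hi => ?_) _
    rw [h i hi]
  have hmom : ∀ c ∈ I, MomentLe s (if aff c then Kf else 1)
      (if aff c then ENNReal.ofReal δ' else 0) (P c D) (P c D') := by
    intro c _
    by_cases hc : aff c
    · rw [if_pos hc, if_pos hc]
      exact momentLe_of_dpLe hε' hs0 (hbase D D' hi₀ c)
        (hbase D' D (fun i hi => (hi₀ i hi).symm) c)
    · rw [if_neg hc, if_neg hc]
      have : P c D = P c D' := by
        simp only [P]
        congr 1
        refine Finset.prod_congr rfl fun i _ => ?_
        by_cases hi : i = i₀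
        · subst hi
          rw [not_not.1 hc]
        · rw [hi₀ i hi]
      rw [this]
      exact MomentLe.refl hs0 _
  have hcard : (I.filter aff).card ≤ 2 * d := by
    have hsub : I.filter aff ⊆ (I.filter fun c => slotInput H n U β σ (D i₀) c ≠ 0) ∪
        (I.filter fun c => slotInput H n U β σ (D' i₀) c ≠ 0) := by
      intro c hc
      rw [Finset.mem_filter] at hc
      rw [Finset.mem_union, Finset.mem_filter, Finset.mem_filter]
      by_cases h0 : slotInput H n U β σ (D i₀) c = 0
      · refine Or.inr ⟨hc.1, fun h => hc.2 (h0.trans h.symm)⟩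
      · exact Or.inl ⟨hc.1, h0⟩
    have h1 := Finset.card_le_card hsub
    have h2 := Finset.card_union_le (I.filter fun c => slotInput H n U β σ (D i₀) c ≠ 0)
        (I.filter fun c => slotInput H n U β σ (D' i₀) c ≠ 0)
    have h3 : (I.filter fun c => slotInput H n U β σ (D i₀) c ≠ 0).card ≤ d :=
      card_slotInput_ne_zero_le (D i₀) _
    have h4 : (I.filter fun c => slotInput H n U β σ (D' i₀) c ≠ 0).card ≤ d :=
      card_slotInput_ne_zero_le (D' i₀) _
    omega
  have hfin := (MomentLe.prod hs0 I hmom).dpLe hs0 (Real.exp_pos ε)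
  have hcard' : ((I.filter aff).card : ℝ) ≤ 2 * d := by exact_mod_cast hcard
  have hK : (∏ c ∈ I, if aff c then Kf else 1) ≤
      ENNReal.ofReal (Real.exp (d * (s + s ^ 2) * ε' ^ 2)) := by
    rw [Finset.prod_ite, Finset.prod_const_one, mul_one, Finset.prod_const,
      ← ENNReal.ofReal_pow (Real.exp_pos _).le, ← Real.exp_nat_mul]
    refine ENNReal.ofReal_le_ofReal (Real.exp_le_exp.2 ?_)
    calc ((I.filter aff).card : ℝ) * ((s + s ^ 2) * ε' ^ 2 / 2)
        ≤ 2 * d * ((s + s ^ 2) * ε' ^ 2 / 2) := by gcongr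
      _ = _ := by ring
  have hΔ : (∑ c ∈ I, if aff c then ENNReal.ofReal δ' else 0) ≤ ENNReal.ofReal (δ / 2) := by
    rw [Finset.sum_ite, Finset.sum_const_zero, add_zero, Finset.sum_const, nsmul_eq_mul,
      ← ENNReal.ofReal_natCast, ← ENNReal.ofReal_mul (by positivity)]
    refine ENNReal.ofReal_le_ofReal ?_
    calc ((I.filter aff).card : ℝ) * δ' ≤ 2 * d * δ' := by gcongr
      _ = δ / 2 := by
        rw [hδ'def, coordDelta]
        field_simp
        norm_num
  have hε'sq : d * ε' ^ 2 = ε ^ 2 / (16 * L) := by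
    rw [hε'def, coordEps, div_pow, mul_pow, Real.sq_sqrt (by positivity), ← hL]
    field_simp
    norm_num
  have hexp : Real.exp ε ^ (-s) * Real.exp (d * (s + s ^ 2) * ε' ^ 2) ≤ δ / 2 := by
    rw [← Real.exp_mul, ← Real.exp_add, ← Real.le_log_iff_exp_le (by positivity)]
    have hlog : Real.log (δ / 2) = -(L * Real.log 2) := by
      rw [hL, Real.logb, div_mul_cancel₀ _ (Real.log_pos (by norm_num)).ne', ← Real.log_inv,
        inv_div]
    have e1 : ε * -s = -(2 * L) := by rw [hs]; field_simp
    have e2 : (d : ℝ) * (s + s ^ 2) * ε' ^ 2 = ε / 8 + L / 4 := by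
      have : (d : ℝ) * (s + s ^ 2) * ε' ^ 2 = (s + s ^ 2) * (d * ε' ^ 2) := by ring
      rw [this, hε'sq, hs]
      field_simp
      ring
    rw [hlog, e1, e2]
    have := Real.log_two_lt_d9
    nlinarith
  rw [toOuterMeasure_eq_ev, toOuterMeasure_eq_ev, shuffled_highDim_eq, shuffled_highDim_eq]
  refine (hfin.mono le_rfl ?_) _ fun x => Set.indicator_le_self _ 1 _
  calc _ ≤ ENNReal.ofReal (Real.exp ε ^ (-s)) *
        ENNReal.ofReal (Real.exp (d * (s + s ^ 2) * ε' ^ 2)) + ENNReal.ofReal (δ / 2) := by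
        gcongr
    _ ≤ ENNReal.ofReal (δ / 2) + ENNReal.ofReal (δ / 2) := by
        rw [← ENNReal.ofReal_mul (by positivity)]
        gcongr
    _ = ENNReal.ofReal δ := by
        rw [← ENNReal.ofReal_add (by positivity) (by positivity), add_halves]

end Protocol

/-! ### Accuracy of BaseSumDP -/

section BaseAccuracy

/-- The sum of the messages. -/
def sumHom : Multiset ℤ →+ ℤ := Multiset.sumAddMonoidHom

theorem sumHom_apply (S : Multiset ℤ) : sumHom S = S.sum := rfl

theorem map_sumHom_totalFlood (ε δ : ℝ) (U' v : ℕ) {s : Multiset ℤ} (hs : s.sum = 0) :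
    (totalFlood ε δ U' v s).map sumHom = 1 := by
  rw [totalFlood, PMF.map_comp]
  have : (sumHom ∘ fun z : ℕ => z • s) = Function.const ℕ 0 := by
    funext z
    simp [sumHom_apply, Multiset.sum_nsmul, hs]
  rw [this, PMF.map_const]
  rfl

theorem map_sumHom_noise_pow {ε δ : ℝ} (hε : 0 < ε) (hδ : 0 < δ) (hδ1 : δ < 1) {n U' : ℕ}
    (hn : 0 < n) (hU : 0 < U') :
    (noise ε δ n U' ^ n).map sumHom =
      ((negBin 1 (Real.exp (-((1 - lam) * ε / U')))).map fun z : ℕ => (z : ℤ)) *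
      ((negBin 1 (Real.exp (-((1 - lam) * ε / U')))).map fun z : ℕ => -(z : ℤ)) := by
  rw [noise_pow hε hδ hδ1 hn hU, map_conv, map_conv, map_conv, map_conv_prod,
    map_sumHom_totalFlood _ _ _ _ (sum_zeroSum 1), mul_one, Finset.prod_eq_one, mul_one]
  · rw [totalCentral, totalCentral, PMF.map_comp, PMF.map_comp]
    congr 2
    · funext z
      simp [sumHom_apply, Multiset.sum_nsmul]
    · funext z
      simp [sumHom_apply, Multiset.sum_nsmul]
  · intro q _
    exact map_sumHom_totalFlood _ _ _ _ (sum_signedZeroSum _ _)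

theorem ev_randRound {B : ℕ} (hB : 0 < B) (x : ℕ) (f : ℕ → ℝ≥0∞) :
    ev (randRound B x) f = ENNReal.ofReal (((x % B : ℕ) : ℝ) / B) * f (x / B + 1) +
      ENNReal.ofReal (1 - ((x % B : ℕ) : ℝ) / B) * f (x / B) := by
  classical
  have : NeZero B := ⟨hB.ne'⟩
  have hmap : randRound B x = (PMF.uniformOfFintype (Fin B)).map
      fun u : Fin B => if (u : ℕ) < x % B then x / B + 1 else x / B := by
    rw [randRound, dif_neg hB.ne']
    exact PMF.map_comp (fun u : Fin B => (u : ℕ)) _ _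
  have hB' : (0 : ℝ) < B := by exact_mod_cast hB
  have hr : x % B < B := Nat.mod_lt _ hB
  have hcard : (Finset.univ.filter fun u : Fin B => (u : ℕ) < x % B).card = x % B := by
    rw [Fin.card_filter_val_lt]
    omega
  have hcard' : (Finset.univ.filter fun u : Fin B => ¬ (u : ℕ) < x % B).card = B - x % B := by
    have := Finset.card_filter_add_card_filter_not (s := (Finset.univ : Finset (Fin B)))
      (fun u : Fin B => (u : ℕ) < x % B)
    rw [hcard, Finset.card_univ, Fintype.card_fin] at this
    omega
  have hrat : ∀ a : ℕ, (a : ℝ≥0∞) * (B : ℝ≥0∞)⁻¹ = ENNReal.ofReal ((a : ℝ) / B) := fun a => by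
    rw [ENNReal.ofReal_div_of_pos hB', ENNReal.ofReal_natCast, ENNReal.ofReal_natCast]
    rfl
  rw [hmap, ev_map, ev, tsum_fintype]
  simp only [PMF.uniformOfFintype_apply, Fintype.card_fin]
  have hterm : ∀ u : Fin B, (B : ℝ≥0∞)⁻¹ * f (if (u : ℕ) < x % B then x / B + 1 else x / B) =
      if (u : ℕ) < x % B then (B : ℝ≥0∞)⁻¹ * f (x / B + 1) else (B : ℝ≥0∞)⁻¹ * f (x / B) :=
    fun u => by split_ifs <;> rfl
  rw [Finset.sum_congr rfl fun u _ => hterm u, Finset.sum_ite, Finset.sum_const, Finset.sum_const,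
    hcard, hcard', nsmul_eq_mul, nsmul_eq_mul, ← mul_assoc, ← mul_assoc, hrat, hrat,
    Nat.cast_sub hr.le, sub_div, div_self hB'.ne']

theorem randRound_zero {B : ℕ} (hB : 0 < B) : randRound B 0 = PMF.pure 0 := by
  rw [randRound, dif_neg hB.ne']
  simp only [Nat.zero_mod, Nat.not_lt_zero, if_false, Nat.zero_div]
  exact PMF.map_const _ _

theorem exp_convex_sum_le {q y : ℝ} (hq0 : 0 ≤ q) (hq1 : q ≤ 1) (hy : |y| ≤ 1) :
    q * Real.exp ((1 - q) * y) + (1 - q) * Real.exp (-(q * y)) ≤ Real.exp (y ^ 2) := by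
  have hexp : ∀ z : ℝ, |z| ≤ 1 → Real.exp z ≤ 1 + z + z ^ 2 := fun z hz => by
    have := abs_le.1 (Real.abs_exp_sub_one_sub_id_le hz)
    linarith [this.2]
  have h1 := hexp ((1 - q) * y) (by
    rw [abs_mul, abs_of_nonneg (by linarith : 0 ≤ 1 - q)]
    nlinarith [abs_nonneg y])
  have h2 := hexp (-(q * y)) (by
    rw [abs_neg, abs_mul, abs_of_nonneg hq0]
    nlinarith [abs_nonneg y])
  have h3 := Real.add_one_le_exp (y ^ 2)
  have h4 : q * (1 - q) * y ^ 2 ≤ 1 * y ^ 2 := by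
    gcongr
    nlinarith
  nlinarith [mul_le_mul_of_nonneg_left h1 hq0,
    mul_le_mul_of_nonneg_left h2 (by linarith : 0 ≤ 1 - q)]

theorem ev_randRound_exp_le {B : ℕ} (hB : 0 < B) (x : ℕ) {u : ℝ} (hu : |u * B| ≤ 1) :
    ev (randRound B x) (fun a => ENNReal.ofReal (Real.exp (u * B * a))) ≤
      ENNReal.ofReal (Real.exp (u * x + if B = 1 then 0 else (u * B) ^ 2)) := by
  have hB' : (0 : ℝ) < B := by exact_mod_cast hB
  set q := ((x % B : ℕ) : ℝ) / B with hq
  have hq0 : 0 ≤ q := by positivity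
  have hq1 : q ≤ 1 := by
    rw [hq, div_le_one hB']
    exact_mod_cast (Nat.mod_lt x hB).le
  have hx : (x : ℝ) = B * ((x / B : ℕ) + q) := by
    rw [hq, mul_add, mul_div_cancel₀ _ hB'.ne']
    exact_mod_cast (Nat.div_add_mod x B).symm
  rw [ev_randRound hB, ← hq, ← ENNReal.ofReal_mul hq0, ← ENNReal.ofReal_mul (by linarith),
    ← ENNReal.ofReal_add (by positivity) (mul_nonneg (by linarith) (Real.exp_pos _).le)]
  refine ENNReal.ofReal_le_ofReal ?_
  have e1 : Real.exp (u * B * ((x / B + 1 : ℕ) : ℝ)) =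
      Real.exp (u * x) * Real.exp ((1 - q) * (u * B)) := by
    rw [← Real.exp_add, hx]
    push_cast
    ring_nf
  have e2 : Real.exp (u * B * ((x / B : ℕ) : ℝ)) =
      Real.exp (u * x) * Real.exp (-(q * (u * B))) := by
    rw [← Real.exp_add, hx]
    ring_nf
  rw [e1, e2, Real.exp_add]
  calc q * (Real.exp (u * x) * Real.exp ((1 - q) * (u * B))) +
        (1 - q) * (Real.exp (u * x) * Real.exp (-(q * (u * B))))
      = Real.exp (u * x) * (q * Real.exp ((1 - q) * (u * B)) +
        (1 - q) * Real.exp (-(q * (u * B)))) := by ring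
    _ ≤ _ := by
      gcongr
      split_ifs with h1
      · have : q = 0 := by
          rw [hq, h1]
          simp [Nat.mod_one]
        rw [this]
        simp
      · exact exp_convex_sum_le hq0 hq1 hu

theorem ev_geometric_exp_le {θ v : ℝ} (hθ : 0 < θ) (hv : v ≤ θ / 2) :
    ev (negBin 1 (Real.exp (-θ))) (fun z => ENNReal.ofReal (Real.exp (v * z))) ≤ 2 := by
  have h1 : ∀ z : ℕ, ENNReal.ofReal (Real.exp (v * z)) ≤
      ENNReal.ofReal (Real.exp (θ / 2) ^ z) := fun z => by
    refine ENNReal.ofReal_le_ofReal ?_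
    rw [← Real.exp_nat_mul, Real.exp_le_exp, mul_comm]
    gcongr
  refine (ev_mono _ h1).trans ?_
  set g := Real.exp (-(θ / 2)) with hg
  have hg0 : 0 < g := Real.exp_pos _
  have hg1 : g < 1 := exp_neg_lt_one (by linarith)
  have e1 : Real.exp (-θ) = g * g := by rw [hg, ← Real.exp_add]; ring_nf
  have e2 : Real.exp (-θ) * Real.exp (θ / 2) = g := by rw [hg, ← Real.exp_add]; ring_nf
  rw [ev_negBin_pow one_pos (Real.exp_pos _) (exp_neg_lt_one hθ) (Real.exp_pos _)
    (by rw [e2]; exact hg1), e2, e1, Real.rpow_one]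
  have : (1 - g * g) / (1 - g) ≤ 2 := by
    rw [div_le_iff₀ (by linarith)]
    nlinarith
  calc _ ≤ ENNReal.ofReal 2 := ENNReal.ofReal_le_ofReal this
    _ = 2 := by simp

theorem ev_geometric_neg_exp_le {θ v : ℝ} (hv : 0 ≤ v) :
    ev (negBin 1 (Real.exp (-θ))) (fun z => ENNReal.ofReal (Real.exp (-(v * z)))) ≤ 1 := by
  refine ev_le_one _ fun z => ?_
  rw [← ENNReal.ofReal_one]
  refine ENNReal.ofReal_le_ofReal (Real.exp_le_one_iff.2 ?_)
  have : 0 ≤ v * (z : ℝ) := by positivity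
  linarith

theorem ev_noise_pow_exp_le {ε δ : ℝ} (hε : 0 < ε) (hδ : 0 < δ) (hδ1 : δ < 1) {n U' : ℕ}
    (hn : 0 < n) (hU : 0 < U') {v : ℝ} (hv : |v| ≤ (1 - lam) * ε / U' / 2) :
    ev (noise ε δ n U' ^ n) (fun R => ENNReal.ofReal (Real.exp (v * R.sum))) ≤ 2 := by
  have hU' : (0 : ℝ) < U' := by exact_mod_cast hU
  have hl := one_sub_lam_pos
  have hθ : 0 < (1 - lam) * ε / U' := by positivity
  have h := ev_map (noise ε δ n U' ^ n) sumHom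
    (fun z : ℤ => ENNReal.ofReal (Real.exp (v * z)))
  simp only [sumHom_apply] at h
  rw [← h, map_sumHom_noise_pow hε hδ hδ1 hn hU, ev_mul_of_multiplicative, ev_map, ev_map]
  · push_cast
    rcases le_total 0 v with h0 | h0
    · rw [abs_of_nonneg h0] at hv
      calc _ ≤ (2 : ℝ≥0∞) * 1 := by
            refine mul_le_mul' (ev_geometric_exp_le hθ hv) ?_
            simpa only [mul_neg] using ev_geometric_neg_exp_le h0
        _ = 2 := by simp
    · rw [abs_of_nonpos h0] at hv
      calc _ ≤ 1 * (2 : ℝ≥0∞) := by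
            refine mul_le_mul' ?_ ?_
            · have := ev_geometric_neg_exp_le (θ := (1 - lam) * ε / U') (neg_nonneg.2 h0)
              simpa only [neg_mul, neg_neg] using this
            · have := ev_geometric_exp_le hθ hv
              simpa only [neg_mul, mul_neg] using this
        _ = 2 := by simp
  · intro x y
    rw [← ENNReal.ofReal_mul (Real.exp_pos _).le, ← Real.exp_add]
    push_cast
    ring_nf

theorem prod_baseRandomizer_eq (ε δ : ℝ) {n U : ℕ} (x : Fin n → ℕ) :
    ∏ i, baseRandomizer ε δ n U (x i) =
      (∏ i, (randRound (gridWidth ε n U) (x i)).map (node true)) *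
        noise ε δ n (reducedSize ε n U) ^ n := by
  simp [baseRandomizer_eq, Finset.prod_mul_distrib]

theorem sum_node_true (a : ℕ) : (node true a).sum = a := by
  by_cases h : a = 0 <;> simp [node, h]

/-- Exponential moments of the error of BaseSumDP. -/
theorem ev_base_exp_le {ε δ E : ℝ} (hε : 0 < ε) (hE : 1 ≤ E) (hεE : ε ≤ E) (hδ : 0 < δ)
    (hδ1 : δ < 1) {n j : ℕ} (hn : 0 < n) (x : Fin n → ℕ) {u : ℝ}
    (hu : |u| = 0.4 / E * ε / 2 ^ j) :
    ev (∏ i, baseRandomizer ε δ n (2 ^ j) (x i))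
      (fun R => ENNReal.ofReal (Real.exp (u * (baseAnalyzer ε n (2 ^ j) R - ∑ i, (x i : ℝ))))) ≤
      6 := by
  obtain ⟨m, hmj, hred, hgrid, hle, hlt⟩ := exists_reducedSize_eq hε hn j
  have hBV : ((2 ^ (j - m) : ℕ) : ℝ) * 2 ^ m = 2 ^ j := by
    push_cast
    rw [← pow_add]
    congr 1
    omega
  set B := 2 ^ (j - m) with hB
  have hB0 : 0 < B := by positivity
  have hV : (0 : ℝ) < 2 ^ m := by positivity
  have hV1 : (1 : ℝ) ≤ 2 ^ m := one_le_pow₀ (by norm_num)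
  have hBpos : (0 : ℝ) < B := by exact_mod_cast hB0
  have hE0 : 0 < E := by linarith
  have huB : |u * B| = 0.4 / E * ε / 2 ^ m := by
    rw [abs_mul, hu, abs_of_pos hBpos, ← hBV]
    field_simp
  have hεE' : ε / E ≤ 1 := by rw [div_le_one hE0]; exact hεE
  have huB1 : |u * B| ≤ 0.4 * (ε / E) := by
    rw [huB, div_le_iff₀ hV]
    have : (0 : ℝ) ≤ 0.4 * (ε / E) := by positivity
    calc 0.4 / E * ε = 0.4 * (ε / E) * 1 := by ring
      _ ≤ _ := by gcongr
  have huB' : |u * B| ≤ 1 := by linarith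
  have huθ : |u * B| ≤ (1 - lam) * ε / ((2 ^ m : ℕ) : ℝ) / 2 := by
    rw [huB]
    push_cast
    rw [div_right_comm]
    gcongr
    unfold lam
    have : 0.4 / E * ε ≤ 0.4 * ε := by
      gcongr
      rw [div_le_iff₀ hE0]
      linarith
    linarith
  set τ : ℝ := if B = 1 then 0 else (u * B) ^ 2 with hτ
  have hnτ : n * τ ≤ 1 := by
    rw [hτ]
    split_ifs with h1
    · simp
    · have hmj' : m < j := by
        by_contra hcon
        apply h1
        rw [hB, show j - m = 0 by omega, pow_zero]
      have h2 := hlt hmj'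
      have hz := zeta_pos hε
      rw [Real.sqrt_lt' (by positivity), div_lt_iff₀ hz] at h2
      have hz2 : zeta ε * ε ≤ 0.1 := by
        have : zeta ε ≤ 0.1 / ε := min_le_right _ _
        rwa [le_div_iff₀ hε] at this
      have h3 : (u * B) ^ 2 = (0.4 / E * ε / 2 ^ m) ^ 2 := by rw [← huB, sq_abs]
      rw [h3]
      calc (n : ℝ) * (0.4 / E * ε / 2 ^ m) ^ 2
          ≤ ((2 * 2 ^ m) ^ 2 * zeta ε) * (0.4 / E * ε / 2 ^ m) ^ 2 := by gcongr
        _ = 0.64 * (zeta ε * ε) * (ε / E) * (1 / E) := by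
            field_simp
            norm_num
        _ ≤ 0.64 * 0.1 * 1 * 1 := by
            gcongr
            rw [div_le_one hE0]
            exact hE
        _ ≤ 1 := by norm_num
  set f : Multiset ℤ → ℝ≥0∞ := fun R => ENNReal.ofReal (Real.exp (u * B * R.sum)) with hf
  have hf0 : f 0 = 1 := by simp [hf]
  have hfm : ∀ S T, f (S + T) = f S * f T := fun S T => by
    simp only [hf]
    rw [← ENNReal.ofReal_mul (Real.exp_pos _).le, ← Real.exp_add, Multiset.sum_add]
    push_cast
    ring_nf
  have hsplit : ∀ R : Multiset ℤ,
      ENNReal.ofReal (Real.exp (u * (baseAnalyzer ε n (2 ^ j) R - ∑ i, (x i : ℝ)))) =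
      ENNReal.ofReal (Real.exp (-(u * ∑ i, (x i : ℝ)))) * f R := fun R => by
    simp only [hf]
    rw [← ENNReal.ofReal_mul (Real.exp_pos _).le, ← Real.exp_add, baseAnalyzer, hgrid]
    ring_nf
  simp only [hsplit]
  rw [ev_const_mul, prod_baseRandomizer_eq, ev_mul_of_multiplicative _ _ hfm,
    ev_prod_of_multiplicative _ _ hf0 hfm, hgrid, hred]
  have hround : ∏ i, ev ((randRound B (x i)).map (node true)) f ≤
      ENNReal.ofReal (Real.exp (u * (∑ i, (x i : ℝ)) + 1)) := by
    calc ∏ i, ev ((randRound B (x i)).map (node true)) f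
        ≤ ∏ i, ENNReal.ofReal (Real.exp (u * x i + τ)) := by
          refine Finset.prod_le_prod' fun i _ => ?_
          rw [ev_map]
          simp only [hf, sum_node_true, Int.cast_natCast]
          exact ev_randRound_exp_le hB0 (x i) huB'
      _ = ENNReal.ofReal (Real.exp (∑ i, (u * x i + τ))) := by
          rw [Real.exp_sum, ENNReal.ofReal_prod_of_nonneg fun i _ => (Real.exp_pos _).le]
      _ ≤ _ := by
          refine ENNReal.ofReal_le_ofReal (Real.exp_le_exp.2 ?_)
          rw [Finset.sum_add_distrib, ← Finset.mul_sum]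
          simpa using hnτ
  calc ENNReal.ofReal (Real.exp (-(u * ∑ i, (x i : ℝ)))) *
        ((∏ i, ev ((randRound B (x i)).map (node true)) f) * ev (noise ε δ n (2 ^ m) ^ n) f)
      ≤ ENNReal.ofReal (Real.exp (-(u * ∑ i, (x i : ℝ)))) *
        (ENNReal.ofReal (Real.exp (u * (∑ i, (x i : ℝ)) + 1)) * 2) := by
        gcongr
        exact ev_noise_pow_exp_le hε hδ hδ1 hn (by positivity) huθ
    _ = ENNReal.ofReal (Real.exp 1) * 2 := by
        rw [← mul_assoc, ← ENNReal.ofReal_mul (Real.exp_pos _).le, ← Real.exp_add]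
        ring_nf
    _ ≤ ENNReal.ofReal 3 * 2 := by
        gcongr
        have := Real.exp_one_lt_d9
        linarith
    _ = 6 := by
        rw [show ENNReal.ofReal 3 = 3 by simp]
        norm_num

/-- Tail bound for the error of BaseSumDP. -/
theorem base_error_tail {ε δ E : ℝ} (hε : 0 < ε) (hE : 1 ≤ E) (hεE : ε ≤ E) (hδ : 0 < δ)
    (hδ1 : δ < 1) {n j : ℕ} (hn : 0 < n) (x : Fin n → ℕ) (Λ : ℝ) :
    (∏ i, baseRandomizer ε δ n (2 ^ j) (x i)).toOuterMeasure
      {R | 2 ^ j * (E / 0.4 * Λ / ε) < |baseAnalyzer ε n (2 ^ j) R - ∑ i, (x i : ℝ)|} ≤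
      ENNReal.ofReal (12 * Real.exp (-Λ)) := by
  set u := 0.4 / E * ε / 2 ^ j with hu
  have hu0 : 0 < u := by positivity
  have h1 := ev_base_exp_le hε hE hεE hδ hδ1 (j := j) hn x (u := u) (abs_of_pos hu0)
  have h2 := ev_base_exp_le hε hE hεE hδ hδ1 (j := j) hn x (u := -u)
    (by rw [abs_neg]; exact abs_of_pos hu0)
  set err : Multiset ℤ → ℝ := fun R => baseAnalyzer ε n (2 ^ j) R - ∑ i, (x i : ℝ) with herr
  have hT : u * (2 ^ j * (E / 0.4 * Λ / ε)) = Λ := by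
    rw [hu]
    field_simp
  refine (toOuterMeasure_le_ev _ _ (f := fun R => ENNReal.ofReal (Real.exp (-Λ)) *
    (ENNReal.ofReal (Real.exp (u * err R)) + ENNReal.ofReal (Real.exp (-u * err R)))) ?_).trans ?_
  · intro R hR
    rw [Set.mem_ofPred_eq] at hR
    have hR2 : Λ < |u * err R| := by
      rw [abs_mul, abs_of_pos hu0, ← hT]
      gcongr
    rw [mul_add, ← ENNReal.ofReal_mul (Real.exp_pos _).le, ← ENNReal.ofReal_mul (Real.exp_pos _).le,
      ← Real.exp_add, ← Real.exp_add]
    rcases lt_abs.1 hR2 with h | h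
    · refine le_trans ?_ le_self_add
      rw [← ENNReal.ofReal_one]
      exact ENNReal.ofReal_le_ofReal (Real.one_le_exp (by linarith))
    · refine le_trans ?_ le_add_self
      rw [← ENNReal.ofReal_one]
      exact ENNReal.ofReal_le_ofReal (Real.one_le_exp (by linarith))
  · rw [ev_const_mul, ev_add]
    calc _ ≤ ENNReal.ofReal (Real.exp (-Λ)) * (6 + 6) := by gcongr
      _ = _ := by
        rw [mul_comm, show (6 + 6 : ℝ≥0∞) = ENNReal.ofReal 12 by norm_num,
          ← ENNReal.ofReal_mul (by norm_num)]

/-- Without inputs, the estimate of BaseSumDP is unlikely to exceed the threshold of SumDP. -/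
theorem base_zero_tail {ε δ : ℝ} (hε : 0 < ε) (hδ : 0 < δ)
    (hδ1 : δ < 1) {n j : ℕ} (hn : 0 < n) {Λ : ℝ} (hΛ : 0 ≤ Λ) :
    (∏ _i : Fin n, baseRandomizer ε δ n (2 ^ j) 0).toOuterMeasure
      {R | 1.3 * 2 ^ j * Λ / ε < baseAnalyzer ε n (2 ^ j) R} ≤ ENNReal.ofReal (Real.exp (-Λ)) := by
  obtain ⟨m, hmj, hred, hgrid, -, -⟩ := exists_reducedSize_eq hε hn j
  have hBV : ((2 ^ (j - m) : ℕ) : ℝ) * 2 ^ m = 2 ^ j := by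
    push_cast
    rw [← pow_add]
    congr 1
    omega
  have hl := one_sub_lam_pos
  have hV : (0 : ℝ) < 2 ^ m := by positivity
  set T := 1.3 * 2 ^ m * Λ / ε with hT
  have hT0 : 0 ≤ T := by positivity
  have hset : {R | 1.3 * 2 ^ j * Λ / ε < baseAnalyzer ε n (2 ^ j) R} =
      sumHom ⁻¹' {z : ℤ | T < (z : ℝ)} := by
    ext R
    simp only [Set.mem_ofPred_eq, Set.mem_preimage, baseAnalyzer, hgrid, sumHom_apply]
    have : 1.3 * 2 ^ j * Λ / ε = ((2 ^ (j - m) : ℕ) : ℝ) * T := by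
      rw [hT, ← hBV]
      ring
    rw [this, mul_lt_mul_iff_right₀ (by positivity)]
  rw [prod_baseRandomizer_eq, hred, hgrid, randRound_zero (by positivity), PMF.pure_map]
  have : node true 0 = 0 := rfl
  rw [this, pure_zero, Finset.prod_const_one, one_mul, hset, ← PMF.toOuterMeasure_map_apply,
    map_sumHom_noise_pow hε hδ hδ1 hn (by positivity), toOuterMeasure_eq_ev, ev_mul, ev_map]
  set θ := (1 - lam) * ε / ((2 ^ m : ℕ) : ℝ) with hθ
  have hθ0 : 0 < θ := by positivity
  calc _ ≤ ev (negBin 1 (Real.exp (-θ))) (Set.indicator {z : ℕ | T < z} 1) := by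
        refine ev_mono _ fun a => ?_
        rw [ev_map]
        by_cases ha : T < (a : ℝ)
        · rw [Set.indicator_of_mem (by exact ha)]
          exact ev_le_one _ fun y => Set.indicator_le_self _ 1 _
        · rw [Set.indicator_of_notMem (by exact ha), ← ev_const (negBin 1 (Real.exp (-θ))) 0]
          refine ev_mono _ fun b => ?_
          rw [Set.indicator_of_notMem]
          simp only [Set.mem_ofPred_eq]
          push_cast
          have : (0 : ℝ) ≤ b := by positivity
          linarith
    _ ≤ ENNReal.ofReal (Real.exp (-(θ * T))) := by
        rw [← toOuterMeasure_eq_ev]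
        exact negBin_one_upper_tail hθ0 hT0
    _ ≤ _ := by
        refine ENNReal.ofReal_le_ofReal (Real.exp_le_exp.2 ?_)
        have : θ * T = 1.17 * Λ := by
          rw [hθ, hT]
          unfold lam
          push_cast
          field_simp
          ring
        rw [this]
        linarith

end BaseAccuracy

/-! ### Accuracy of SumDP -/

section SumAccuracy

theorem sum_pow_filter_le {y : ℝ} (hy : 0 ≤ y) (N : ℕ) :
    ∑ j ∈ Finset.range N, (if (2 : ℝ) ^ j ≤ y then (2 : ℝ) ^ j else 0) ≤ 2 * y := by
  induction N with
  | zero => simpa using hy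
  | succ N ih =>
    rw [Finset.sum_range_succ]
    split_ifs with h
    · have h1 : ∑ j ∈ Finset.range N, (if (2 : ℝ) ^ j ≤ y then (2 : ℝ) ^ j else 0) ≤ 2 ^ N := by
        calc _ ≤ ∑ j ∈ Finset.range N, (2 : ℝ) ^ j := by
              refine Finset.sum_le_sum fun j _ => ?_
              split_ifs
              · exact le_rfl
              · positivity
          _ = 2 ^ N - 1 := by rw [geom_sum_eq (by norm_num)]; norm_num
          _ ≤ _ := by linarith
      linarith
    · simpa using ih

theorem levelsKept_le (ε β : ℝ) (n J : ℕ) (R : Multiset (ℕ × ℤ)) :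
    levelsKept ε β n J R ≤ J + 1 := by
  classical
  unfold levelsKept
  refine Finset.sup_le fun j hj => ?_
  have := Finset.mem_range.1 (Finset.mem_filter.1 hj).1
  omega

theorem threshold_lt_of_levelsKept {ε β : ℝ} {n J : ℕ} {R : Multiset (ℕ × ℤ)}
    (h : 0 < levelsKept ε β n J R) :
    1.3 * 2 ^ (levelsKept ε β n J R - 1) * Real.log (2 * (J + 1) / β) / ε <
      levelEstimate ε n R (levelsKept ε β n J R - 1) := by
  classical
  have hne : ((Finset.range (J + 1)).filter fun j =>
      1.3 * 2 ^ j * Real.log (2 * (J + 1) / β) / ε < levelEstimate ε n R j).Nonempty := by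
    by_contra hcon
    rw [Finset.not_nonempty_iff_eq_empty] at hcon
    unfold levelsKept at h
    rw [hcon] at h
    simp at h
  obtain ⟨j, hj, hsup⟩ := Finset.exists_mem_eq_sup _ hne fun j => j + 1
  have e : levelsKept ε β n J R = j + 1 := by
    unfold levelsKept
    convert hsup
  rw [e]
  exact (Finset.mem_filter.1 hj).2

theorem estimate_le_of_levelsKept_le {ε β : ℝ} {n J : ℕ} {R : Multiset (ℕ × ℤ)} {j : ℕ}
    (hj : j ≤ J) (h : levelsKept ε β n J R ≤ j) :
    levelEstimate ε n R j ≤ 1.3 * 2 ^ j * Real.log (2 * (J + 1) / β) / ε := by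
  classical
  by_contra hcon
  have hmem : j ∈ (Finset.range (J + 1)).filter fun j =>
      1.3 * 2 ^ j * Real.log (2 * (J + 1) / β) / ε < levelEstimate ε n R j :=
    Finset.mem_filter.2 ⟨Finset.mem_range.2 (by omega), not_le.1 hcon⟩
  have h1 := Finset.le_sup (f := fun j => j + 1) hmem
  have h2 : j + 1 ≤ levelsKept ε β n J R := by
    unfold levelsKept
    convert h1
  omega

/-- Error of the analyzer of SumDP in terms of the errors of the levels. -/
theorem sumAnalyzer_error {ε β : ℝ} {n J : ℕ} {R : Multiset (ℕ × ℤ)} {a b M : ℝ} {S : ℕ → ℝ}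
    (ha : 0 ≤ a) (hb : 0 ≤ b) (hM : 0 ≤ M) (hbdef : b = 1.3 * Real.log (2 * (J + 1) / β) / ε)
    (hS0 : ∀ j ≤ J, 0 ≤ S j) (herr : ∀ j ≤ J, |levelEstimate ε n R j - S j| ≤ 2 ^ j * a)
    (hzero : ∀ j ≤ J, S j = 0 →
      levelEstimate ε n R j ≤ 1.3 * 2 ^ j * Real.log (2 * (J + 1) / β) / ε)
    (hact : ∀ j ≤ J, S j ≠ 0 → (2 : ℝ) ^ j ≤ 2 * M) :
    |sumAnalyzer ε β n J R - ∑ j ∈ Finset.range (J + 1), S j| ≤ 4 * M * (a + b) := by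
  set k := levelsKept ε β n J R with hk
  have hkJ : k ≤ J + 1 := levelsKept_le ε β n J R
  have hthr : ∀ j : ℕ, 1.3 * 2 ^ j * Real.log (2 * (J + 1) / β) / ε = 2 ^ j * b := fun j => by
    rw [hbdef]
    ring
  have hsum : sumAnalyzer ε β n J R =
      ∑ j ∈ Finset.range (J + 1), if j < k then levelEstimate ε n R j else 0 := by
    rw [sumAnalyzer, ← hk, ← Finset.sum_filter]
    refine Finset.sum_congr ?_ fun _ _ => rfl
    ext j
    simp only [Finset.mem_range, Finset.mem_filter]
    omega
  have hk2 : ∀ j < k, (2 : ℝ) ^ j ≤ 2 * M := by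
    intro j hj
    have h1 := threshold_lt_of_levelsKept (ε := ε) (β := β) (n := n) (J := J) (R := R) (by omega)
    rw [← hk] at h1
    have h2 : S (k - 1) ≠ 0 := fun h0 => absurd (hzero (k - 1) (by omega) h0) (not_le.2 h1)
    calc (2 : ℝ) ^ j ≤ 2 ^ (k - 1) := pow_le_pow_right₀ (by norm_num) (by omega)
      _ ≤ 2 * M := hact _ (by omega) h2
  rw [hsum, ← Finset.sum_sub_distrib]
  calc |∑ j ∈ Finset.range (J + 1), ((if j < k then levelEstimate ε n R j else 0) - S j)|
      ≤ ∑ j ∈ Finset.range (J + 1), |(if j < k then levelEstimate ε n R j else 0) - S j| :=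
        Finset.abs_sum_le_sum_abs _ _
    _ ≤ ∑ j ∈ Finset.range (J + 1),
        (if (2 : ℝ) ^ j ≤ 2 * M then (2 : ℝ) ^ j else 0) * (a + b) := by
        refine Finset.sum_le_sum fun j hj => ?_
        have hjJ : j ≤ J := by have := Finset.mem_range.1 hj; omega
        have hpow : (0 : ℝ) < 2 ^ j := by positivity
        by_cases hjk : j < k
        · rw [if_pos hjk, if_pos (hk2 j hjk)]
          refine (herr j hjJ).trans ?_
          gcongr
          linarith
        · rw [if_neg hjk, zero_sub, abs_neg, abs_of_nonneg (hS0 j hjJ)]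
          by_cases h0 : S j = 0
          · rw [h0]
            split_ifs
            · positivity
            · simp
          · rw [if_pos (hact j hjJ h0)]
            have h1 := estimate_le_of_levelsKept_le (ε := ε) (β := β) (n := n) (R := R) hjJ
              (not_lt.1 hjk)
            rw [hthr] at h1
            have h2 := abs_le.1 (herr j hjJ)
            linarith [h2.1]
    _ = (∑ j ∈ Finset.range (J + 1), (if (2 : ℝ) ^ j ≤ 2 * M then (2 : ℝ) ^ j else 0)) *
        (a + b) := by rw [Finset.sum_mul]
    _ ≤ (2 * (2 * M)) * (a + b) := by
        gcongr
        exact sum_pow_filter_le (by linarith) _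
    _ = _ := by ring

theorem exists_inLevel {x : ℕ} (hx : 0 < x) : InLevel (Nat.clog 2 x) x := by
  refine ⟨?_, Nat.le_pow_clog (by norm_num) x⟩
  rcases Nat.lt_or_ge 1 x with h1 | h1
  · have h2 := Nat.clog_pos (by norm_num : 1 < 2) h1
    rw [if_neg h2.ne']
    exact Nat.pow_pred_clog_lt_self (by norm_num) h1
  · have : x = 1 := by omega
    subst this
    simp

theorem sum_inLevel {x J : ℕ} (hx : x ≤ 2 ^ J) :
    ∑ j ∈ Finset.range (J + 1), (if InLevel j x then x else 0) = x := by
  rcases Nat.eq_zero_or_pos x with rfl | hpos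
  · simp
  · have h1 := exists_inLevel hpos
    have hJ : Nat.clog 2 x ≤ J := Nat.clog_le_of_le_pow hx
    rw [Finset.sum_eq_single (Nat.clog 2 x)]
    · rw [if_pos h1]
    · intro j _ hj
      rw [if_neg]
      exact fun h => hj (h.unique h1)
    · intro h
      exact absurd (Finset.mem_range.2 (by omega)) h

theorem InLevel.two_pow_le {j x : ℕ} (h : InLevel j x) : 2 ^ j ≤ 2 * x := by
  have h1 := h.1
  rcases j with _ | j
  · simp at h1 ⊢
    omega
  · rw [if_neg (by omega), Nat.add_sub_cancel] at h1
    rw [pow_succ]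
    omega

end SumAccuracy

/-! ### The estimates of the instances of BaseSumDP -/

section Slots

variable {d n U : ℕ} {H : Matrix (Fin d) (Fin d) ℤ} {ε δ β : ℝ} {σ : Fin d → ℤˣ}

/-- The sum of the messages of an instance of BaseSumDP. -/
def slotHom {d : ℕ} (c : Slot d) : Multiset (Message d) →+ ℤ :=
  sumHom.comp (Multiset.mapAddMonoidHom fun m =>
    if (m.1 = c.1 ∧ m.2.1 = c.2.1) ∧ m.2.2.1 = c.2.2 then m.2.2.2 else 0)

theorem levelEstimate_eq_slotHom (ε : ℝ) (R : Multiset (Message d)) (k : Fin d) (s : Bool) (j : ℕ) :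
    levelEstimate ε n ((R.filter fun m => m.1 = k ∧ m.2.1 = s).map fun m => m.2.2) j =
      gridWidth ε n (2 ^ j) * (slotHom (k, s, j) R : ℝ) := by
  unfold levelEstimate baseAnalyzer
  congr 2
  induction R using Multiset.induction_on with
  | empty => simp
  | cons m R ih =>
    rw [← Multiset.singleton_add, map_add, ← ih, Multiset.filter_add, Multiset.map_add,
      Multiset.filter_add, Multiset.map_add, Multiset.sum_add]
    congr 1
    simp only [slotHom, AddMonoidHom.comp_apply, Multiset.coe_mapAddMonoidHom, sumHom_apply,
      Multiset.map_singleton, Multiset.sum_singleton]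
    by_cases h1 : m.1 = k ∧ m.2.1 = s
    · by_cases h2 : m.2.2.1 = j
      · simp [Multiset.filter_singleton, h1, h2]
      · simp [Multiset.filter_singleton, h1, h2]
    · simp [Multiset.filter_singleton, h1]

theorem slotHom_labelHom_self (c : Slot d) (S : Multiset ℤ) :
    slotHom c (labelHom c S) = sumHom S := by
  simp [slotHom, labelHom]

theorem slotHom_labelHom_of_ne {c c' : Slot d} (h : c' ≠ c) (S : Multiset ℤ) :
    slotHom c (labelHom c' S) = 0 := by
  have h2 : ¬ ((c'.1 = c.1 ∧ c'.2.1 = c.2.1) ∧ c'.2.2 = c.2.2) := fun hc =>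
    h (Prod.ext hc.1.1 (Prod.ext hc.1.2 hc.2))
  simp [slotHom, labelHom, h2, sumHom_apply]

theorem map_slotHom_shuffled (D : Fin n → Fin d → ℤ) {c : Slot d}
    (hc : c ∈ slots d (topLevel d n U β)) :
    (shuffled (highDimRandomizer H n U ε δ β σ) D).map (slotHom c) =
      (∏ i, baseRandomizer (coordEps d ε δ) (coordDelta d δ) n (2 ^ c.2.2)
        (slotInput H n U β σ (D i) c)).map sumHom := by
  rw [shuffled_highDim_eq, map_conv_prod, Finset.prod_eq_single c]
  · rw [PMF.map_comp]
    congr 1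
    funext S
    exact slotHom_labelHom_self c S
  · intro c' _ hc'
    rw [PMF.map_comp]
    have : (slotHom c ∘ labelHom c') = Function.const _ 0 := by
      funext S
      exact slotHom_labelHom_of_ne hc' S
    rw [this, PMF.map_const]
    rfl
  · intro h
    exact absurd hc h

theorem card_slots (d J : ℕ) : (slots d J).card = 2 * d * (J + 1) := by
  simp [slots, Finset.card_product]
  ring

end Slots

/-! ### Random signs -/

section Signs

variable {d n U : ℕ} {H : Matrix (Fin d) (Fin d) ℤ} {σ : Fin d → ℤˣ}

theorem rotation_mulVec (x : Fin d → ℤ) (k : Fin d) :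
    (rotation H σ).mulVec x k = ∑ l, H k l * (σ l : ℤ) * x l := by
  simp [rotation, Matrix.mulVec, dotProduct, Matrix.mul_diagonal]

theorem ev_signs_exp_le (a : Fin d → ℝ) (u : ℝ) :
    ev (PMF.uniformOfFintype (Fin d → ℤˣ))
      (fun σ => ENNReal.ofReal (Real.exp (u * ∑ l, a l * ((σ l : ℤ) : ℝ)))) ≤
      ENNReal.ofReal (Real.exp (u ^ 2 * (∑ l, a l ^ 2) / 2)) := by
  classical
  have hcard : Fintype.card (Fin d → ℤˣ) = 2 ^ d := by simp
  have hreal : ∑ σ : Fin d → ℤˣ, Real.exp (u * ∑ l, a l * ((σ l : ℤ) : ℝ)) =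
      2 ^ d * ∏ l, Real.cosh (u * a l) := by
    have h1 : ∀ σ : Fin d → ℤˣ, Real.exp (u * ∑ l, a l * ((σ l : ℤ) : ℝ)) =
        ∏ l, Real.exp (u * a l * ((σ l : ℤ) : ℝ)) := fun σ => by
      rw [← Real.exp_sum, Finset.mul_sum]
      simp only [mul_assoc]
    rw [Finset.sum_congr rfl fun σ _ => h1 σ,
      ← Fintype.prod_sum (fun (l : Fin d) (s : ℤˣ) => Real.exp (u * a l * ((s : ℤ) : ℝ)))]
    have h2 : ∀ l, ∑ s : ℤˣ, Real.exp (u * a l * ((s : ℤ) : ℝ)) = 2 * Real.cosh (u * a l) := by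
      intro l
      rw [UnitsInt.univ, Finset.sum_pair (by decide), Real.cosh_eq]
      push_cast
      ring_nf
    simp only [h2, Finset.prod_mul_distrib]
    simp
  have hev : ev (PMF.uniformOfFintype (Fin d → ℤˣ))
      (fun σ => ENNReal.ofReal (Real.exp (u * ∑ l, a l * ((σ l : ℤ) : ℝ)))) =
      ENNReal.ofReal (∏ l, Real.cosh (u * a l)) := by
    rw [ev, tsum_fintype]
    simp only [PMF.uniformOfFintype_apply, hcard]
    rw [← Finset.mul_sum, ← ENNReal.ofReal_sum_of_nonneg fun σ _ => (Real.exp_pos _).le, hreal,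
      ENNReal.ofReal_mul (by positivity), ← mul_assoc]
    have : ((2 ^ d : ℕ) : ℝ≥0∞)⁻¹ * ENNReal.ofReal (2 ^ d) = 1 := by
      rw [ENNReal.ofReal_pow (by norm_num)]
      push_cast
      rw [show ENNReal.ofReal 2 = 2 by simp]
      exact ENNReal.inv_mul_cancel (by simp) (by simp)
    rw [this, one_mul]
  rw [hev]
  refine ENNReal.ofReal_le_ofReal ?_
  calc ∏ l, Real.cosh (u * a l) ≤ ∏ l, Real.exp ((u * a l) ^ 2 / 2) :=
        Finset.prod_le_prod (fun l _ => (Real.cosh_pos _).le) fun l _ => Real.cosh_le_exp_half_sq _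
    _ = _ := by
        rw [← Real.exp_sum, Finset.mul_sum, Finset.sum_div]
        simp only [mul_pow]

/-- Tail bound for random signs. -/
theorem signs_tail (a : Fin d → ℝ) {r A : ℝ} (hr : 0 < r) (hA : 0 ≤ A) (ha : ∑ l, a l ^ 2 ≤ r ^ 2) :
    (PMF.uniformOfFintype (Fin d → ℤˣ)).toOuterMeasure
      {σ | r * Real.sqrt (2 * A) < |∑ l, a l * ((σ l : ℤ) : ℝ)|} ≤
      ENNReal.ofReal (2 * Real.exp (-A)) := by
  set w := Real.sqrt (2 * A) with hw
  have hw0 : 0 ≤ w := Real.sqrt_nonneg _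
  have hw2 : w ^ 2 = 2 * A := Real.sq_sqrt (by linarith)
  set u := w / r with hu
  have hur : u * r = w := by rw [hu]; field_simp
  have hu0 : 0 ≤ u := by positivity
  have hb : Real.exp (u ^ 2 * (∑ l, a l ^ 2) / 2) ≤ Real.exp A := by
    refine Real.exp_le_exp.2 ?_
    calc u ^ 2 * (∑ l, a l ^ 2) / 2 ≤ u ^ 2 * r ^ 2 / 2 := by gcongr
      _ = (u * r) ^ 2 / 2 := by ring
      _ = A := by rw [hur, hw2]; ring
  refine (toOuterMeasure_le_ev _ _ (f := fun σ => ENNReal.ofReal (Real.exp (-(2 * A))) *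
    (ENNReal.ofReal (Real.exp (u * ∑ l, a l * ((σ l : ℤ) : ℝ))) +
      ENNReal.ofReal (Real.exp (-u * ∑ l, a l * ((σ l : ℤ) : ℝ))))) ?_).trans ?_
  · intro σ hσ
    rw [Set.mem_ofPred_eq] at hσ
    have hσ2 : 2 * A ≤ |u * ∑ l, a l * ((σ l : ℤ) : ℝ)| := by
      rw [abs_mul, abs_of_nonneg hu0, ← hw2]
      calc w ^ 2 = u * (r * w) := by rw [← mul_assoc, hur]; ring
        _ ≤ _ := by gcongr
    rw [mul_add, ← ENNReal.ofReal_mul (Real.exp_pos _).le, ← ENNReal.ofReal_mul (Real.exp_pos _).le,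
      ← Real.exp_add, ← Real.exp_add]
    rcases le_abs.1 hσ2 with h | h
    · refine le_trans ?_ le_self_add
      rw [← ENNReal.ofReal_one]
      exact ENNReal.ofReal_le_ofReal (Real.one_le_exp (by linarith))
    · refine le_trans ?_ le_add_self
      rw [← ENNReal.ofReal_one]
      exact ENNReal.ofReal_le_ofReal (Real.one_le_exp (by linarith))
  · rw [ev_const_mul, ev_add]
    have h1 := ev_signs_exp_le a u
    have h2 := ev_signs_exp_le a (-u)
    rw [neg_sq] at h2
    calc _ ≤ ENNReal.ofReal (Real.exp (-(2 * A))) *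
          (ENNReal.ofReal (Real.exp A) + ENNReal.ofReal (Real.exp A)) := by
          gcongr
          · exact h1.trans (ENNReal.ofReal_le_ofReal hb)
          · exact h2.trans (ENNReal.ofReal_le_ofReal hb)
      _ = _ := by
          rw [← ENNReal.ofReal_add (by positivity) (by positivity),
            ← ENNReal.ofReal_mul (by positivity), mul_add, ← Real.exp_add]
          ring_nf

end Signs

/-! ### Accuracy of HighDimSumDP -/

section HighDimAccuracy

variable {d n U : ℕ} {H : Matrix (Fin d) (Fin d) ℤ} {ε δ β : ℝ} {σ : Fin d → ℤˣ}

theorem IsHadamard.sq_apply (hH : H.IsHadamard) (k l : Fin d) : H k l * H k l = 1 := by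
  have := (Unitary.mem_iff.1 (hH.apply_mem k l)).1
  simpa using this

theorem rotation_mul_transpose (hH : H.IsHadamard) (σ : Fin d → ℤˣ) :
    rotation H σ * (rotation H σ).transpose = (d : ℤ) • (1 : Matrix (Fin d) (Fin d) ℤ) := by
  have h := hH.mul_conjTranspose
  rw [Matrix.conjTranspose_eq_transpose_of_trivial] at h
  rw [rotation, Matrix.transpose_mul, Matrix.diagonal_transpose, Matrix.mul_assoc,
    ← Matrix.mul_assoc (Matrix.diagonal _), Matrix.diagonal_mul_diagonal]
  have : (Matrix.diagonal fun i => ((σ i : ℤˣ) : ℤ) * (σ i : ℤ)) =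
      (1 : Matrix (Fin d) (Fin d) ℤ) := by
    rw [← Matrix.diagonal_one]
    congr 1
    funext i
    rw [← Units.val_mul, Int.units_mul_self, Units.val_one]
  rw [this, Matrix.one_mul, h]
  simp

/-- The rotation as a real matrix. -/
def realRotation (H : Matrix (Fin d) (Fin d) ℤ) (σ : Fin d → ℤˣ) : Matrix (Fin d) (Fin d) ℝ :=
  (rotation H σ).map fun a => (a : ℝ)

theorem realRotation_mul_transpose (hH : H.IsHadamard) (σ : Fin d → ℤˣ) :
    realRotation H σ * (realRotation H σ).transpose =
      (d : ℝ) • (1 : Matrix (Fin d) (Fin d) ℝ) := by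
  have h := congrArg (fun A : Matrix (Fin d) (Fin d) ℤ => A.map (Int.castRingHom ℝ))
    (rotation_mul_transpose hH σ)
  simp only [Matrix.map_mul] at h
  refine h.trans ?_
  ext i j
  rw [Matrix.map_apply, Matrix.smul_apply, Matrix.smul_apply, Matrix.one_apply, Matrix.one_apply]
  split_ifs <;> simp

theorem realRotation_inv (hd : 0 < d) (hH : H.IsHadamard) (σ : Fin d → ℤˣ) :
    (realRotation H σ)⁻¹ = (d : ℝ)⁻¹ • (realRotation H σ).transpose := by
  have hd' : (d : ℝ) ≠ 0 := by exact_mod_cast hd.ne'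
  refine Matrix.inv_eq_right_inv ?_
  rw [Matrix.mul_smul, realRotation_mul_transpose hH, smul_smul, inv_mul_cancel₀ hd', one_smul]

theorem l2norm_inv_mulVec_le (hd : 0 < d) (hH : H.IsHadamard) (σ : Fin d → ℤˣ) {v : Fin d → ℝ}
    {t : ℝ} (ht : 0 ≤ t) (hv : ∀ k, |v k| ≤ t) :
    l2norm ((realRotation H σ)⁻¹.mulVec v) ≤ t := by
  have hd' : (0 : ℝ) < d := by exact_mod_cast hd
  set W := realRotation H σ
  have h1 : ∑ k, (W⁻¹.mulVec v k) ^ 2 = (d : ℝ)⁻¹ * ∑ k, v k ^ 2 := by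
    have e : ∀ w : Fin d → ℝ, ∑ k, w k ^ 2 = dotProduct w w := fun w => by
      simp [dotProduct, sq]
    rw [e, e, realRotation_inv hd hH, Matrix.smul_mulVec, smul_dotProduct, dotProduct_smul,
      Matrix.mulVec_transpose, ← Matrix.dotProduct_mulVec, ← Matrix.mulVec_transpose,
      Matrix.mulVec_mulVec, realRotation_mul_transpose hH, Matrix.smul_mulVec, Matrix.one_mulVec,
      dotProduct_smul]
    simp only [smul_eq_mul]
    field_simp
  rw [l2norm, h1]
  refine Real.sqrt_le_iff.2 ⟨ht, ?_⟩
  calc (d : ℝ)⁻¹ * ∑ k, v k ^ 2 ≤ (d : ℝ)⁻¹ * ∑ _k : Fin d, t ^ 2 := by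
        refine mul_le_mul_of_nonneg_left (Finset.sum_le_sum fun k _ => ?_) (by positivity)
        exact sq_le_sq.2 (by rw [abs_of_nonneg ht]; exact hv k)
    _ = t ^ 2 := by
        simp
        field_simp

theorem realRotation_mulVec_sum (D : Fin n → Fin d → ℤ) (k : Fin d) :
    (realRotation H σ).mulVec (fun l => ∑ i, (D i l : ℝ)) k =
      ∑ i, (((rotation H σ).mulVec (D i) k : ℤ) : ℝ) := by
  simp only [Matrix.mulVec, dotProduct, realRotation, Matrix.map_apply, Finset.mul_sum]
  rw [Finset.sum_comm]
  push_cast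
  rfl

theorem isUnit_realRotation (hd : 0 < d) (hH : H.IsHadamard) (σ : Fin d → ℤˣ) :
    IsUnit (realRotation H σ).det := by
  have hd' : (d : ℝ) ≠ 0 := by exact_mod_cast hd.ne'
  refine Matrix.isUnit_det_of_right_inverse (B := (d : ℝ)⁻¹ • (realRotation H σ).transpose) ?_
  rw [Matrix.mul_smul, realRotation_mul_transpose hH, smul_smul, inv_mul_cancel₀ hd', one_smul]

theorem analyzer_error_le (hd : 0 < d) (hH : H.IsHadamard) (σ : Fin d → ℤˣ)
    (D : Fin n → Fin d → ℤ) (R : Multiset (Message d)) {t : ℝ} (ht : 0 ≤ t)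
    (h : ∀ k, |coordEstimate n U ε δ β R k true - coordEstimate n U ε δ β R k false -
      ∑ i, (((rotation H σ).mulVec (D i) k : ℤ) : ℝ)| ≤ t) :
    l2norm (fun k => highDimAnalyzer H n U ε δ β σ R k - ∑ i, (D i k : ℝ)) ≤ t := by
  set est : Fin d → ℝ := fun k =>
    coordEstimate n U ε δ β R k true - coordEstimate n U ε δ β R k false
  have e : (fun k => highDimAnalyzer H n U ε δ β σ R k - ∑ i, (D i k : ℝ)) =
      (realRotation H σ)⁻¹.mulVec
        (est - (realRotation H σ).mulVec fun l => ∑ i, (D i l : ℝ)) := by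
    rw [Matrix.mulVec_sub, Matrix.mulVec_mulVec,
      Matrix.nonsing_inv_mul _ (isUnit_realRotation hd hH σ), Matrix.one_mulVec]
    rfl
  rw [e]
  refine l2norm_inv_mulVec_le hd hH σ ht fun k => ?_
  rw [Pi.sub_apply, realRotation_mulVec_sum]
  exact h k

theorem abs_rotation_mulVec_le (hH : H.IsHadamard) (σ : Fin d → ℤˣ) (x : Fin d → ℤ) (k : Fin d) :
    |(((rotation H σ).mulVec x k : ℤ) : ℝ)| ≤ l2norm (fun l => (x l : ℝ)) * Real.sqrt d := by
  rw [rotation_mulVec, l2norm, ← Real.sqrt_mul (Finset.sum_nonneg fun _ _ => sq_nonneg _)]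
  refine Real.abs_le_sqrt ?_
  push_cast
  refine (Finset.sum_mul_sq_le_sq_mul_sq _ _ _).trans ?_
  rw [mul_comm]
  gcongr
  have : ∀ l, (((H k l : ℤ) : ℝ) * ((σ l : ℤ) : ℝ)) ^ 2 = 1 := fun l => by
    have h1 := IsHadamard.sq_apply hH k l
    have h2 : (σ l : ℤ) * (σ l : ℤ) = 1 := by
      rw [← Units.val_mul, Int.units_mul_self, Units.val_one]
    have h3 : ((H k l : ℤ) * (σ l : ℤ)) ^ 2 = 1 := by
      linear_combination h1 * ((σ l : ℤ) * (σ l : ℤ)) + h2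
    exact_mod_cast h3
  simp [this]

theorem l2norm_le_maxL2 (D : Fin n → Fin d → ℤ) (i : Fin n) :
    l2norm (fun k => (D i k : ℝ)) ≤ maxL2 D :=
  le_ciSup (f := fun i => l2norm fun k => (D i k : ℝ)) (Set.finite_range _).bddAbove i

theorem maxL2_nonneg (D : Fin n → Fin d → ℤ) : 0 ≤ maxL2 D :=
  Real.iSup_nonneg fun _ => Real.sqrt_nonneg _

theorem three_le_logb (hd : 0 < d) (hn : 0 < n) (hβ : 0 < β) (hβ1 : β < 1) :
    3 ≤ Real.logb 2 (8 * n * d / β) := by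
  have hd' : (1 : ℝ) ≤ d := by exact_mod_cast hd
  have hn' : (1 : ℝ) ≤ n := by exact_mod_cast hn
  rw [Real.le_logb_iff_rpow_le (by norm_num) (by positivity), le_div_iff₀ hβ]
  norm_num
  nlinarith [mul_le_mul hn' hd' zero_le_one (by linarith)]

theorem one_le_coordBound (hd : 0 < d) (hn : 0 < n) (hU : 0 < U) (hβ : 0 < β) (hβ1 : β < 1) :
    1 ≤ coordBound d n U β := by
  have h := three_le_logb hd hn hβ hβ1
  have hU' : (1 : ℝ) ≤ U := by exact_mod_cast hU
  have hs : 1 ≤ Real.sqrt (2 * Real.logb 2 (8 * n * d / β)) := by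
    rw [Real.one_le_sqrt]
    linarith
  unfold coordBound
  nlinarith

theorem floor_coordBound_le (hd : 0 < d) (hn : 0 < n) (hU : 0 < U) (hβ : 0 < β) (hβ1 : β < 1) :
    ⌊coordBound d n U β⌋₊ ≤ 2 ^ topLevel d n U β := by
  have h1 := one_le_coordBound hd hn hU hβ hβ1
  have h2 : Real.logb 2 (coordBound d n U β) ≤ topLevel d n U β := Nat.le_ceil _
  rw [Real.logb_le_iff_le_rpow (by norm_num) (by linarith), Real.rpow_natCast] at h2
  have h3 : ((⌊coordBound d n U β⌋₊ : ℕ) : ℝ) ≤ 2 ^ topLevel d n U β :=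
    (Nat.floor_le (by linarith)).trans h2
  exact_mod_cast h3

/-- The estimate of a coordinate is accurate if the estimates of all levels are. -/
theorem coordEstimate_error (hd : 0 < d) (hn : 0 < n) (hU : 0 < U) (hβ : 0 < β) (hβ1 : β < 1)
    (D : Fin n → Fin d → ℤ) (R : Multiset (Message d)) {a b Y : ℝ} (ha : 0 ≤ a) (hb : 0 ≤ b)
    (hY0 : 0 ≤ Y)
    (hbdef : b = 1.3 * Real.log (2 * (topLevel d n U β + 1) / (β / (2 * d))) / coordEps d ε δ)
    (hY : ∀ i k, |(((rotation H σ).mulVec (D i) k : ℤ) : ℝ)| ≤ Y)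
    (hclip : ∀ i k, |(((rotation H σ).mulVec (D i) k : ℤ) : ℝ)| ≤ coordBound d n U β)
    (herr : ∀ c ∈ slots d (topLevel d n U β),
      |gridWidth (coordEps d ε δ) n (2 ^ c.2.2) * (slotHom c R : ℝ) -
        ∑ i, (slotInput H n U β σ (D i) c : ℝ)| ≤ 2 ^ c.2.2 * a)
    (hzero : ∀ c ∈ slots d (topLevel d n U β), (∀ i, slotInput H n U β σ (D i) c = 0) →
      gridWidth (coordEps d ε δ) n (2 ^ c.2.2) * (slotHom c R : ℝ) ≤
        1.3 * 2 ^ c.2.2 * Real.log (2 * (topLevel d n U β + 1) / (β / (2 * d))) / coordEps d ε δ)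
    (k : Fin d) :
    |coordEstimate n U ε δ β R k true - coordEstimate n U ε δ β R k false -
      ∑ i, (((rotation H σ).mulVec (D i) k : ℤ) : ℝ)| ≤ 8 * Y * (a + b) := by
  set J := topLevel d n U β with hJ
  set y : Fin n → ℤ := fun i => (rotation H σ).mulVec (D i) k with hy
  have hpart : ∀ s i, clippedPart d n U β s (y i) = (if s then y i else -(y i)).toNat := by
    intro s i
    refine min_eq_left (Nat.le_floor ?_)
    have h := hclip i k
    have h2 : (((if s then y i else -(y i)).toNat : ℕ) : ℝ) ≤ |((y i : ℤ) : ℝ)| := by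
      have : (((if s then y i else -(y i)).toNat : ℕ) : ℤ) ≤ |y i| := by
        cases s <;> simp <;> first | exact neg_le_abs _ | exact le_abs_self _
      exact_mod_cast this
    exact h2.trans h
  have key : ∀ s, |coordEstimate n U ε δ β R k s -
      ∑ i, (((if s then y i else -(y i)).toNat : ℕ) : ℝ)| ≤ 4 * Y * (a + b) := by
    intro s
    have hmem : ∀ j ≤ J, (k, s, j) ∈ slots d J := fun j hj => by
      simp [slots]
      omega
    have hsum : ∑ i, (((if s then y i else -(y i)).toNat : ℕ) : ℝ) =
        ∑ j ∈ Finset.range (J + 1), ∑ i, (slotInput H n U β σ (D i) (k, s, j) : ℝ) := by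
      rw [Finset.sum_comm]
      refine Finset.sum_congr rfl fun i _ => ?_
      rw [← hpart s i]
      have := sum_inLevel (x := clippedPart d n U β s (y i)) (J := J)
        ((min_le_right _ _).trans (floor_coordBound_le hd hn hU hβ hβ1))
      exact_mod_cast this.symm
    rw [hsum]
    unfold coordEstimate
    refine sumAnalyzer_error ha hb hY0 hbdef (fun j _ => by positivity) ?_ ?_ ?_
    · intro j hj
      rw [levelEstimate_eq_slotHom]
      exact herr (k, s, j) (hmem j hj)
    · intro j hj h0
      rw [levelEstimate_eq_slotHom]
      refine hzero (k, s, j) (hmem j hj) fun i => ?_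
      rw [Finset.sum_eq_zero_iff_of_nonneg (fun i _ => by positivity)] at h0
      exact_mod_cast h0 i (Finset.mem_univ i)
    · intro j hj h0
      obtain ⟨i, -, hi⟩ := Finset.exists_ne_zero_of_sum_ne_zero h0
      have hi' : slotInput H n U β σ (D i) (k, s, j) ≠ 0 := by exact_mod_cast hi
      have h1 := (inLevel_of_slotInput_ne_zero hi').two_pow_le
      simp only at h1
      have h2 : (2 : ℝ) ^ j ≤ 2 * (clippedPart d n U β s (y i) : ℝ) := by exact_mod_cast h1
      have h3 : ((clippedPart d n U β s (y i) : ℕ) : ℝ) ≤ |((y i : ℤ) : ℝ)| := by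
        rw [hpart]
        have : (((if s then y i else -(y i)).toNat : ℕ) : ℤ) ≤ |y i| := by
          cases s <;> simp <;> first | exact neg_le_abs _ | exact le_abs_self _
        exact_mod_cast this
      linarith [hY i k]
  have e : ∑ i, ((y i : ℤ) : ℝ) = ∑ i, (((if true then y i else -(y i)).toNat : ℕ) : ℝ) -
      ∑ i, (((if false then y i else -(y i)).toNat : ℕ) : ℝ) := by
    rw [← Finset.sum_sub_distrib]
    refine Finset.sum_congr rfl fun i _ => ?_
    have : (y i : ℤ) = ((y i).toNat : ℤ) - ((-(y i)).toNat : ℤ) := by omega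
    simp
    exact_mod_cast this
  have h1 := key true
  have h2 := key false
  rw [e]
  rw [abs_le] at h1 h2 ⊢
  constructor <;> linarith [h1.1, h1.2, h2.1, h2.2]

/-- Accuracy of the estimates of all coordinates, for fixed signs. -/
theorem fixed_signs_accuracy (hd : 0 < d) (hn : 0 < n) (hU : 0 < U) (hβ : 0 < β) (hβ1 : β < 1)
    (hε : 0 < ε) (hδ : 0 < δ) (hδ1 : δ < 1) {E : ℝ} (hE : 1 ≤ E) (hεE : coordEps d ε δ ≤ E)
    (hH : H.IsHadamard) (D : Fin n → Fin d → ℤ) {a b Y : ℝ} (hY0 : 0 ≤ Y)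
    (hadef : a = E / 0.4 * Real.log (96 * d * (topLevel d n U β + 1) / β) / coordEps d ε δ)
    (hbdef : b = 1.3 * Real.log (2 * (topLevel d n U β + 1) / (β / (2 * d))) / coordEps d ε δ)
    (hY : ∀ i k, |(((rotation H σ).mulVec (D i) k : ℤ) : ℝ)| ≤ Y)
    (hclip : ∀ i k, |(((rotation H σ).mulVec (D i) k : ℤ) : ℝ)| ≤ coordBound d n U β) :
    (shuffled (highDimRandomizer H n U ε δ β σ) D).toOuterMeasure
      {R | ¬ l2norm (fun k => highDimAnalyzer H n U ε δ β σ R k - ∑ i, (D i k : ℝ)) ≤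
        8 * Y * (a + b)} ≤ ENNReal.ofReal (3 * β / 4) := by
  classical
  have hε' := coordEps_pos hd hε hδ hδ1
  have hδ' := coordDelta_pos hd hδ
  have hδ'1 := coordDelta_lt_one hd hδ1
  set ε' := coordEps d ε δ
  set J := topLevel d n U β
  have hd' : (1 : ℝ) ≤ d := by exact_mod_cast hd
  set Λ := Real.log (2 * (J + 1) / (β / (2 * d))) with hΛ
  set Λ₂ := Real.log (96 * d * (J + 1) / β) with hΛ₂
  have hJ1 : (1 : ℝ) ≤ (J : ℝ) + 1 := by linarith [Nat.cast_nonneg (α := ℝ) J]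
  have hdJ : (1 : ℝ) ≤ d * ((J : ℝ) + 1) := by nlinarith
  have hΛ0 : 0 ≤ Λ := by
    refine Real.log_nonneg ?_
    rw [le_div_iff₀ (by positivity), one_mul, div_le_iff₀ (by positivity)]
    nlinarith
  have hΛ₂0 : 0 ≤ Λ₂ := by
    refine Real.log_nonneg ?_
    rw [le_div_iff₀ (by positivity)]
    nlinarith
  have ha : 0 ≤ a := by rw [hadef]; positivity
  have hb : 0 ≤ b := by rw [hbdef]; positivity
  set μ := shuffled (highDimRandomizer H n U ε δ β σ) D
  set B₁ : Slot d → Set (Multiset (Message d)) := fun c => slotHom c ⁻¹'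
    {z : ℤ | 2 ^ c.2.2 * a < |gridWidth ε' n (2 ^ c.2.2) * (z : ℝ) -
      ∑ i, (slotInput H n U β σ (D i) c : ℝ)|}
  set B₂ : Slot d → Set (Multiset (Message d)) := fun c =>
    if ∀ i, slotInput H n U β σ (D i) c = 0 then slotHom c ⁻¹'
      {z : ℤ | 1.3 * 2 ^ c.2.2 * Λ / ε' < gridWidth ε' n (2 ^ c.2.2) * (z : ℝ)} else ∅
  have hsub : {R | ¬ l2norm (fun k => highDimAnalyzer H n U ε δ β σ R k - ∑ i, (D i k : ℝ)) ≤
        8 * Y * (a + b)} ⊆ ⋃ c ∈ slots d J, (B₁ c ∪ B₂ c) := by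
    intro R hR
    by_contra hcon
    simp only [Set.mem_iUnion, not_exists, Set.mem_union, not_or] at hcon
    refine hR (analyzer_error_le hd hH σ D R (by positivity) fun k => ?_)
    refine coordEstimate_error hd hn hU hβ hβ1 D R ha hb hY0 hbdef hY hclip ?_ ?_ k
    · intro c hc
      exact not_lt.1 (hcon c hc).1
    · intro c hc h0
      have := (hcon c hc).2
      simp only [B₂, if_pos h0] at this
      exact not_lt.1 this
  have hB₁ : ∀ c ∈ slots d J, μ.toOuterMeasure (B₁ c) ≤ ENNReal.ofReal (12 * Real.exp (-Λ₂)) := by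
    intro c hc
    simp only [B₁]
    rw [← PMF.toOuterMeasure_map_apply, map_slotHom_shuffled D hc, PMF.toOuterMeasure_map_apply,
      hadef]
    exact base_error_tail hε' hE hεE hδ' hδ'1 hn _ Λ₂
  have hB₂ : ∀ c ∈ slots d J, μ.toOuterMeasure (B₂ c) ≤ ENNReal.ofReal (Real.exp (-Λ)) := by
    intro c hc
    simp only [B₂]
    split_ifs with h0
    · rw [← PMF.toOuterMeasure_map_apply, map_slotHom_shuffled D hc, PMF.toOuterMeasure_map_apply]
      simp only [h0]
      exact base_zero_tail hε' hδ' hδ'1 hn hΛ0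
    · simp
  have hexp : Real.exp (-Λ) = β / (4 * d * (J + 1)) := by
    rw [hΛ, Real.exp_neg, Real.exp_log (by positivity)]
    field_simp
    norm_num
  have hexp₂ : 12 * Real.exp (-Λ₂) = β / (8 * d * (J + 1)) := by
    rw [hΛ₂, Real.exp_neg, Real.exp_log (by positivity)]
    field_simp
    norm_num
  calc _ ≤ μ.toOuterMeasure (⋃ c ∈ slots d J, (B₁ c ∪ B₂ c)) := MeasureTheory.measure_mono hsub
    _ ≤ ∑ c ∈ slots d J, μ.toOuterMeasure (B₁ c ∪ B₂ c) :=
        MeasureTheory.measure_biUnion_finset_le _ _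
    _ ≤ ∑ _c ∈ slots d J, ENNReal.ofReal (12 * Real.exp (-Λ₂) + Real.exp (-Λ)) := by
        refine Finset.sum_le_sum fun c hc => ?_
        refine (MeasureTheory.measure_union_le _ _).trans ?_
        rw [ENNReal.ofReal_add (by positivity) (by positivity)]
        exact add_le_add (hB₁ c hc) (hB₂ c hc)
    _ = ENNReal.ofReal (3 * β / 4) := by
        rw [Finset.sum_const, card_slots, nsmul_eq_mul, ← ENNReal.ofReal_natCast,
          ← ENNReal.ofReal_mul (by positivity), hexp, hexp₂]
        congr 1
        push_cast
        field_simp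
        norm_num

theorem signs_event (hd : 0 < d) (hn : 0 < n) (hβ : 0 < β) (hβ1 : β < 1) (hH : H.IsHadamard)
    (D : Fin n → Fin d → ℤ) :
    (PMF.uniformOfFintype (Fin d → ℤˣ)).toOuterMeasure
      {σ | ¬ ∀ i k, |(((rotation H σ).mulVec (D i) k : ℤ) : ℝ)| ≤
        maxL2 D * Real.sqrt (2 * Real.logb 2 (8 * n * d / β))} ≤ ENNReal.ofReal (β / 4) := by
  set A := Real.logb 2 (8 * n * d / β) with hA
  have hA3 : 3 ≤ A := three_le_logb hd hn hβ hβ1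
  have hd' : (0 : ℝ) < d := by exact_mod_cast hd
  have hn' : (0 : ℝ) < n := by exact_mod_cast hn
  have hexp : Real.exp (-A) ≤ β / (8 * n * d) := by
    have hlog : Real.log (8 * n * d / β) = A * Real.log 2 := by
      rw [hA, Real.logb, div_mul_cancel₀ _ (Real.log_pos (by norm_num)).ne']
    have h2 := Real.log_two_lt_d9
    have : Real.exp (-A) ≤ Real.exp (-Real.log (8 * n * d / β)) := by
      rw [Real.exp_le_exp, hlog]
      nlinarith
    rwa [Real.exp_neg (Real.log _), Real.exp_log (by positivity), inv_div] at this
  have hcoord : ∀ (σ : Fin d → ℤˣ) i k, (((rotation H σ).mulVec (D i) k : ℤ) : ℝ) =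
      ∑ l, ((H k l : ℝ) * (D i l : ℝ)) * ((σ l : ℤ) : ℝ) := fun σ i k => by
    rw [rotation_mulVec]
    push_cast
    exact Finset.sum_congr rfl fun l _ => by ring
  have hsq : ∀ i k, ∑ l, ((H k l : ℝ) * (D i l : ℝ)) ^ 2 ≤ maxL2 D ^ 2 := fun i k => by
    have h1 : ∀ l, ((H k l : ℝ) * (D i l : ℝ)) ^ 2 = (D i l : ℝ) ^ 2 := fun l => by
      have h := IsHadamard.sq_apply hH k l
      have h' : (H k l : ℝ) * (H k l : ℝ) = 1 := by exact_mod_cast h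
      linear_combination (D i l : ℝ) ^ 2 * h'
    rw [Finset.sum_congr rfl fun l _ => h1 l]
    have h2 := l2norm_le_maxL2 D i
    rw [l2norm] at h2
    exact (Real.sqrt_le_left (maxL2_nonneg D)).1 h2
  have hone : ∀ i k, (PMF.uniformOfFintype (Fin d → ℤˣ)).toOuterMeasure
      {σ | maxL2 D * Real.sqrt (2 * A) < |(((rotation H σ).mulVec (D i) k : ℤ) : ℝ)|} ≤
      ENNReal.ofReal (β / (4 * n * d)) := by
    intro i k
    rcases (maxL2_nonneg D).eq_or_lt with h0 | h0
    · have hempty : {σ : Fin d → ℤˣ | maxL2 D * Real.sqrt (2 * A) <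
          |(((rotation H σ).mulVec (D i) k : ℤ) : ℝ)|} = ∅ := by
        ext σ
        simp only [Set.mem_ofPred_eq, Set.mem_empty_iff_false, iff_false, not_lt]
        have h1 := abs_rotation_mulVec_le hH σ (D i) k
        have h2 := l2norm_le_maxL2 D i
        rw [← h0] at h2 ⊢
        have h3 : l2norm (fun l => (D i l : ℝ)) = 0 := le_antisymm h2 (Real.sqrt_nonneg _)
        rw [h3, zero_mul] at h1
        linarith
      rw [hempty]
      simp
    · simp only [hcoord]
      refine (signs_tail _ h0 (by linarith) (hsq i k)).trans (ENNReal.ofReal_le_ofReal ?_)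
      calc 2 * Real.exp (-A) ≤ 2 * (β / (8 * n * d)) := by gcongr
        _ = _ := by
          field_simp
          norm_num
  have hset : {σ : Fin d → ℤˣ | ¬ ∀ i k, |(((rotation H σ).mulVec (D i) k : ℤ) : ℝ)| ≤
        maxL2 D * Real.sqrt (2 * A)} ⊆ ⋃ q ∈ (Finset.univ : Finset (Fin n × Fin d)),
      {σ | maxL2 D * Real.sqrt (2 * A) < |(((rotation H σ).mulVec (D q.1) q.2 : ℤ) : ℝ)|} := by
    intro σ hσ
    rw [Set.mem_ofPred_eq] at hσ
    push Not at hσ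
    obtain ⟨i, k, h⟩ := hσ
    simp only [Set.mem_iUnion]
    exact ⟨(i, k), Finset.mem_univ _, h⟩
  calc _ ≤ _ := MeasureTheory.measure_mono hset
    _ ≤ _ := MeasureTheory.measure_biUnion_finset_le _ _
    _ ≤ ∑ _q : Fin n × Fin d, ENNReal.ofReal (β / (4 * n * d)) :=
        Finset.sum_le_sum fun q _ => hone q.1 q.2
    _ = ENNReal.ofReal (β / 4) := by
        rw [Finset.sum_const, Finset.card_univ, Fintype.card_prod, Fintype.card_fin,
          Fintype.card_fin, nsmul_eq_mul, ← ENNReal.ofReal_natCast,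
          ← ENNReal.ofReal_mul (by positivity)]
        congr 1
        push_cast
        field_simp

/-- Accuracy of HighDimSumDP, with an explicit bound. -/
theorem highDim_accuracy (hd : 0 < d) (hn : 0 < n) (hU : 0 < U) (hβ : 0 < β) (hβ1 : β < 1)
    (hε : 0 < ε) (hδ : 0 < δ) (hδ1 : δ < 1) {E : ℝ} (hE : 1 ≤ E) (hεE : coordEps d ε δ ≤ E)
    (hH : H.IsHadamard) (D : Fin n → Fin d → ℤ) (hD : maxL2 D ≤ U) {a b Y t : ℝ}
    (hYdef : Y = maxL2 D * min (Real.sqrt d) (Real.sqrt (2 * Real.logb 2 (8 * n * d / β))))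
    (hadef : a = E / 0.4 * Real.log (96 * d * (topLevel d n U β + 1) / β) / coordEps d ε δ)
    (hbdef : b = 1.3 * Real.log (2 * (topLevel d n U β + 1) / (β / (2 * d))) / coordEps d ε δ)
    (ht : 8 * Y * (a + b) ≤ t) :
    ENNReal.ofReal (1 - β) ≤ (highDimOutput H U ε δ β D).toOuterMeasure
      {y | l2norm (fun k => y k - ∑ i, (D i k : ℝ)) ≤ t} := by
  classical
  set G : Set (Fin d → ℝ) := {y | l2norm (fun k => y k - ∑ i, (D i k : ℝ)) ≤ t} with hG
  set A := Real.logb 2 (8 * n * d / β) with hA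
  set bad : Set (Fin d → ℤˣ) := {σ | ¬ ∀ i k, |(((rotation H σ).mulVec (D i) k : ℤ) : ℝ)| ≤
        maxL2 D * Real.sqrt (2 * A)}
  have hY0 : 0 ≤ Y := by
    rw [hYdef]
    exact mul_nonneg (maxL2_nonneg D) (le_min (Real.sqrt_nonneg _) (Real.sqrt_nonneg _))
  have hbad : (highDimOutput H U ε δ β D).toOuterMeasure Gᶜ ≤ ENNReal.ofReal β := by
    rw [highDimOutput, toOuterMeasure_eq_ev, ev_bind]
    calc _ ≤ ev (PMF.uniformOfFintype (Fin d → ℤˣ))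
          (fun σ => bad.indicator 1 σ + ENNReal.ofReal (3 * β / 4)) := by
          refine ev_mono _ fun σ => ?_
          rw [← toOuterMeasure_eq_ev, PMF.toOuterMeasure_map_apply]
          by_cases hσ : σ ∈ bad
          · rw [Set.indicator_of_mem hσ]
            exact (toOuterMeasure_le_one _ _).trans le_self_add
          · refine le_trans ?_ le_add_self
            have hσ' : ∀ i k, |(((rotation H σ).mulVec (D i) k : ℤ) : ℝ)| ≤
                maxL2 D * Real.sqrt (2 * A) := not_not.1 hσ
            refine le_trans (MeasureTheory.measure_mono ?_)
              (fixed_signs_accuracy hd hn hU hβ hβ1 hε hδ hδ1 hE hεE hH D hY0 hadef hbdef ?_ ?_)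
            · intro R hR hcon
              exact hR (hcon.trans ht)
            · intro i k
              rw [hYdef, mul_min_of_nonneg _ _ (maxL2_nonneg D)]
              refine le_min ((abs_rotation_mulVec_le hH σ (D i) k).trans ?_) (hσ' i k)
              gcongr
              exact l2norm_le_maxL2 D i
            · intro i k
              refine (hσ' i k).trans ?_
              unfold coordBound
              gcongr
      _ ≤ ENNReal.ofReal (β / 4) + ENNReal.ofReal (3 * β / 4) := by
          rw [ev_add, ev_const, ← toOuterMeasure_eq_ev]
          gcongr
          exact signs_event hd hn hβ hβ1 hH D
      _ = ENNReal.ofReal β := by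
          rw [← ENNReal.ofReal_add (by positivity) (by positivity)]
          congr 1
          ring
  have htot := toOuterMeasure_add_compl (highDimOutput H U ε δ β D) G
  rw [ENNReal.ofReal_sub _ hβ.le, ENNReal.ofReal_one]
  refine tsub_le_iff_right.2 ?_
  rw [← htot]
  gcongr

end HighDimAccuracy

/-! ### The order of magnitude of the error -/

section ErrorOrder

variable {d n U : ℕ} {ε δ β c : ℝ}

theorem exists_one_le_mul_logb {x₀ : ℝ} (hx₀ : x₀ < 1) :
    ∃ c : ℝ, 1 ≤ c ∧ ∀ x, 0 < x → x ≤ x₀ → 1 ≤ c * Real.logb 2 (1 / x) := by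
  set y := max x₀ (1 / 2)
  have hy : 0 < y := lt_max_of_lt_right (by norm_num)
  have hy1 : y < 1 := max_lt hx₀ (by norm_num)
  have hpos : 0 < Real.logb 2 (1 / y) :=
    Real.logb_pos (by norm_num) (by rw [lt_div_iff₀ hy]; linarith)
  refine ⟨max 1 (1 / Real.logb 2 (1 / y)), le_max_left _ _, fun x hx hxx => ?_⟩
  have h1 : Real.logb 2 (1 / y) ≤ Real.logb 2 (1 / x) :=
    Real.logb_le_logb_of_le (by norm_num) (by positivity)
      (one_div_le_one_div_of_le hx (hxx.trans (le_max_left _ _)))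
  calc (1 : ℝ) = 1 / Real.logb 2 (1 / y) * Real.logb 2 (1 / y) := by field_simp
    _ ≤ _ := mul_le_mul (le_max_right _ _) h1 hpos.le (by positivity)

theorem logb_two_le_two_mul_log {x : ℝ} (hx : 1 ≤ x) : Real.logb 2 x ≤ 2 * Real.log x := by
  rw [Real.logb, div_le_iff₀ (Real.log_pos (by norm_num))]
  nlinarith [Real.log_two_gt_d9, Real.log_nonneg hx]

theorem log_le_logb_two {x : ℝ} (hx : 1 ≤ x) : Real.log x ≤ Real.logb 2 x := by
  rw [Real.logb, le_div_iff₀ (Real.log_pos (by norm_num))]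
  nlinarith [Real.log_two_lt_d9, Real.log_nonneg hx]

theorem one_le_logb_two {x : ℝ} (hx : 2 ≤ x) : 1 ≤ Real.logb 2 x := by
  rw [Real.le_logb_iff_rpow_le (by norm_num) (by linarith), Real.rpow_one]
  exact hx

theorem logb_eight_mul (hd : 0 < d) (hn : 0 < n) (hβ : 0 < β) :
    Real.logb 2 (8 * n * d / β) = 3 + Real.logb 2 (n * d / β) := by
  have hd' : (0 : ℝ) < d := by exact_mod_cast hd
  have hn' : (0 : ℝ) < n := by exact_mod_cast hn
  rw [show 8 * n * d / β = 2 ^ (3 : ℝ) * (n * d / β) by norm_num; ring,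
    Real.logb_mul (by positivity) (by positivity), Real.logb_rpow (by norm_num) (by norm_num)]

theorem topLevel_add_one_le (hd : 0 < d) (hn : 0 < n) (hU : 0 < U) (hβ : 0 < β) (hβ1 : β < 1) :
    (topLevel d n U β : ℝ) + 1 ≤
      Real.logb 2 U + Real.logb 2 (2 * Real.logb 2 (8 * n * d / β)) / 2 + 2 := by
  have h1 := one_le_coordBound hd hn hU hβ hβ1
  have hA := three_le_logb hd hn hβ hβ1
  have hU' : (0 : ℝ) < U := by exact_mod_cast hU
  have h2 : (topLevel d n U β : ℝ) < Real.logb 2 (coordBound d n U β) + 1 :=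
    Nat.ceil_lt_add_one (Real.logb_nonneg (by norm_num) h1)
  have h3 : Real.logb 2 (coordBound d n U β) =
      Real.logb 2 U + Real.logb 2 (2 * Real.logb 2 (8 * n * d / β)) / 2 := by
    rw [coordBound, Real.logb_mul hU'.ne' (Real.sqrt_pos.2 (by linarith)).ne',
      Real.sqrt_eq_rpow, Real.logb_rpow_eq_mul_logb_of_pos (by linarith)]
    ring
  linarith

theorem log_three_mul_mul_min_le {A Q : ℝ} (hd : 0 < d) (hA : 3 ≤ A) (hc : 1 ≤ c)
    (hQ : 1 ≤ c * Q) (hQd : Real.log d ≤ Q) :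
    Real.log (3 * A) * min (Real.sqrt d) (Real.sqrt (2 * A)) ≤ 8 * c * Q * Real.sqrt A := by
  have hd' : (1 : ℝ) ≤ d := by exact_mod_cast hd
  have hT : 0 ≤ Real.log (3 * A) := Real.log_nonneg (by linarith)
  have hQ0 : 0 ≤ Q := le_trans (Real.log_nonneg hd') hQd
  have hs : 0 ≤ Real.sqrt A := Real.sqrt_nonneg _
  rcases le_or_gt (d : ℝ) (Real.sqrt A) with h | h
  · set q := Real.sqrt (Real.sqrt A) with hq
    have hq2 : q ^ 2 = Real.sqrt A := Real.sq_sqrt hs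
    have hq4 : q ^ 4 = A := by
      rw [show q ^ 4 = (q ^ 2) ^ 2 by ring, hq2, Real.sq_sqrt (by linarith)]
    have hq0 : 0 < q := Real.sqrt_pos.2 (Real.sqrt_pos.2 (by linarith))
    have h1 : Real.log (3 * A) ≤ 8 * q := by
      calc Real.log (3 * A) ≤ Real.log ((2 * q) ^ 4) :=
            Real.log_le_log (by linarith) (by rw [mul_pow, hq4]; linarith)
        _ = 4 * Real.log (2 * q) := by rw [Real.log_pow]; norm_num
        _ ≤ 4 * (2 * q) := by
            have := Real.log_le_sub_one_of_pos (show 0 < 2 * q by positivity)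
            linarith
        _ = 8 * q := by ring
    calc _ ≤ 8 * q * q := by
          refine mul_le_mul h1 ((min_le_left _ _).trans (Real.sqrt_le_sqrt h)) ?_ (by positivity)
          exact le_min (Real.sqrt_nonneg _) (Real.sqrt_nonneg _)
      _ = 8 * 1 * Real.sqrt A := by rw [← hq2]; ring
      _ ≤ 8 * (c * Q) * Real.sqrt A := by gcongr
      _ = _ := by ring
  · have hAd : A ≤ (d : ℝ) ^ 2 := by
      rw [← Real.sq_sqrt (show 0 ≤ A by linarith)]
      gcongr
    have h1 : Real.log (3 * A) ≤ 4 * (c * Q) := by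
      calc Real.log (3 * A) ≤ Real.log (3 * (d : ℝ) ^ 2) := by gcongr
        _ = Real.log 3 + 2 * Real.log d := by
            rw [Real.log_mul (by norm_num) (by positivity), Real.log_pow]
            norm_num
        _ ≤ 2 + 2 * Q := by
            have := Real.log_le_sub_one_of_pos (show (0 : ℝ) < 3 by norm_num)
            linarith
        _ ≤ 4 * (c * Q) := by nlinarith
    have h2 : min (Real.sqrt d) (Real.sqrt (2 * A)) ≤ 2 * Real.sqrt A := by
      refine (min_le_right _ _).trans ?_
      rw [Real.sqrt_mul (by norm_num)]
      gcongr
      rw [Real.sqrt_le_left (by norm_num)]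
      norm_num
    calc _ ≤ 4 * (c * Q) * (2 * Real.sqrt A) :=
          mul_le_mul h1 h2 (le_min (Real.sqrt_nonneg _) (Real.sqrt_nonneg _)) (by linarith)
      _ = _ := by ring

theorem log_levels_mul_min_le (hd : 0 < d) (hn : 0 < n) (hU : 2 ≤ U) (hβ : 0 < β) (hβ1 : β < 1)
    (hc : 1 ≤ c) (hcβ : 1 ≤ c * Real.logb 2 (1 / β)) :
    Real.log (96 * d * (topLevel d n U β + 1) / β) *
        min (Real.sqrt d) (Real.sqrt (2 * Real.logb 2 (8 * n * d / β))) ≤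
      20 * c * Real.logb 2 (d * Real.logb 2 U / β) * Real.sqrt (Real.logb 2 (8 * n * d / β)) := by
  have hd' : (1 : ℝ) ≤ d := by exact_mod_cast hd
  have hU' : (2 : ℝ) ≤ U := by exact_mod_cast hU
  have hA := three_le_logb hd hn hβ hβ1
  have hJ := topLevel_add_one_le hd hn (by omega : 0 < U) hβ hβ1
  set A := Real.logb 2 (8 * n * d / β)
  set J := topLevel d n U β
  have hu : 1 ≤ Real.logb 2 U := one_le_logb_two hU'
  set u := Real.logb 2 (U : ℝ)
  set Q := Real.logb 2 (d * u / β) with hQdef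
  set m := min (Real.sqrt d) (Real.sqrt (2 * A))
  have hdu : (1 : ℝ) ≤ d * u := by nlinarith
  have hβQ : Real.logb 2 (1 / β) ≤ Q :=
    Real.logb_le_logb_of_le (by norm_num) (by positivity) (by gcongr)
  have hQ : 1 ≤ c * Q := hcβ.trans (by gcongr)
  have hx1 : 1 ≤ d * u / β := by rw [le_div_iff₀ hβ]; linarith
  have hlogQ : Real.log (d * u / β) ≤ Q := log_le_logb_two hx1
  have hQd : Real.log d ≤ Q := by
    refine le_trans (Real.log_le_log (by linarith) ?_) hlogQ
    rw [le_div_iff₀ hβ]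
    nlinarith
  have hQ0 : 0 ≤ Q := le_trans (Real.log_nonneg hx1) hlogQ
  have hm0 : 0 ≤ m := le_min (Real.sqrt_nonneg _) (Real.sqrt_nonneg _)
  have hm : m ≤ 2 * Real.sqrt A := by
    refine (min_le_right _ _).trans ?_
    rw [Real.sqrt_mul (by norm_num)]
    gcongr
    rw [Real.sqrt_le_left (by norm_num)]
    norm_num
  have hJu : (J : ℝ) + 1 ≤ u * (3 * A) := by
    have h1 := logb_two_le_two_mul_log (show 1 ≤ 2 * A by linarith)
    have h2 := Real.log_le_sub_one_of_pos (show 0 < 2 * A by linarith)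
    nlinarith
  have hlog : Real.log (96 * d * (J + 1) / β) ≤ 5 * (c * Q) + Q + Real.log (3 * A) := by
    calc Real.log (96 * d * (J + 1) / β) ≤ Real.log (96 * (d * u / β) * (3 * A)) := by
          refine Real.log_le_log (by positivity) ?_
          calc 96 * d * (J + 1) / β ≤ 96 * d * (u * (3 * A)) / β := by gcongr
            _ = _ := by ring
      _ = Real.log 96 + Real.log (d * u / β) + Real.log (3 * A) := by
          rw [Real.log_mul (by positivity) (by positivity),
            Real.log_mul (by norm_num) (by positivity)]
      _ ≤ _ := by
          have h96 : Real.log 96 ≤ 5 := by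
            rw [Real.log_le_iff_le_exp (by norm_num)]
            have h := Real.exp_one_gt_d9
            calc (96 : ℝ) ≤ 2.7 ^ 5 := by norm_num
              _ ≤ Real.exp 1 ^ 5 := by gcongr; linarith
              _ = Real.exp 5 := by rw [← Real.exp_nat_mul]; norm_num
          linarith
  calc _ ≤ (5 * (c * Q) + Q + Real.log (3 * A)) * m := by gcongr
    _ = (5 * c + 1) * Q * m + Real.log (3 * A) * m := by ring
    _ ≤ (6 * c) * Q * (2 * Real.sqrt A) + 8 * c * Q * Real.sqrt A := by
        refine add_le_add ?_ (log_three_mul_mul_min_le hd hA hc hQ hQd)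
        gcongr
        linarith
    _ = _ := by ring

theorem logb_two_div_le (hδ : 0 < δ) (hc : 1 ≤ c) (hcδ : 1 ≤ c * Real.logb 2 (1 / δ)) :
    Real.logb 2 (2 / δ) ≤ 2 * c * Real.logb 2 (1 / δ) := by
  have h : Real.logb 2 (2 / δ) = 1 + Real.logb 2 (1 / δ) := by
    rw [show 2 / δ = 2 * (1 / δ) by ring, Real.logb_mul (by norm_num) (by positivity),
      Real.logb_self_eq_one (by norm_num)]
  have h0 : 0 < Real.logb 2 (1 / δ) := by
    by_contra h0
    nlinarith
  nlinarith

theorem coordEps_le (hd : 0 < d) (hε : 0 < ε) (hδ : 0 < δ) (hδ1 : δ < 1) :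
    coordEps d ε δ ≤ ε := by
  have h := one_le_logb_two (show 2 ≤ 2 / δ by rw [le_div_iff₀ hδ]; linarith)
  have hd' : (1 : ℝ) ≤ d := by exact_mod_cast hd
  refine div_le_self hε.le ?_
  have : 1 ≤ Real.sqrt (d * Real.logb 2 (2 / δ)) := by
    rw [Real.one_le_sqrt]
    nlinarith
  linarith

theorem error_order (hd : 0 < d) (hn : 0 < n) (hU : 2 ≤ U) (hβ : 0 < β) (hβ1 : β < 1)
    (hε : 0 < ε) (hδ : 0 < δ) (hδ1 : δ < 1) (hc : 1 ≤ c) (hcβ : 1 ≤ c * Real.logb 2 (1 / β))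
    (hcδ : 1 ≤ c * Real.logb 2 (1 / δ)) {E M : ℝ} (hE : 1 ≤ E) (hM : 0 ≤ M) :
    8 * (M * min (Real.sqrt d) (Real.sqrt (2 * Real.logb 2 (8 * n * d / β)))) *
      (E / 0.4 * Real.log (96 * d * (topLevel d n U β + 1) / β) / coordEps d ε δ +
        1.3 * Real.log (2 * (topLevel d n U β + 1) / (β / (2 * d))) / coordEps d ε δ) ≤
    7680 * E * c ^ 2 * (M * Real.sqrt (d * Real.logb 2 (n * d / β) * Real.logb 2 (1 / δ)) *
      Real.logb 2 (d * Real.logb 2 U / β) / ε) := by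
  have hd' : (1 : ℝ) ≤ d := by exact_mod_cast hd
  have hn' : (1 : ℝ) ≤ n := by exact_mod_cast hn
  have hU' : (2 : ℝ) ≤ U := by exact_mod_cast hU
  have hkey := log_levels_mul_min_le hd hn hU hβ hβ1 hc hcβ
  have hε' := coordEps_pos hd hε hδ hδ1
  have hA3 := three_le_logb hd hn hβ hβ1
  have hAeq := logb_eight_mul hd hn hβ
  set A := Real.logb 2 (8 * n * d / β)
  set m := min (Real.sqrt d) (Real.sqrt (2 * A))
  have hm0 : 0 ≤ m := le_min (Real.sqrt_nonneg _) (Real.sqrt_nonneg _)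
  set J := topLevel d n U β
  have hJ0 : (0 : ℝ) ≤ J := Nat.cast_nonneg _
  set Λ := Real.log (96 * d * (J + 1) / β)
  have hΛ : Real.log (2 * (J + 1) / (β / (2 * d))) ≤ Λ := by
    refine Real.log_le_log (by positivity) ?_
    rw [div_div_eq_mul_div, show 2 * ((J : ℝ) + 1) * (2 * d) = 4 * d * (J + 1) by ring]
    gcongr
    norm_num
  have hΛ0 : 0 ≤ Λ := by
    refine Real.log_nonneg ?_
    rw [le_div_iff₀ hβ]
    nlinarith
  set ℓ := Real.logb 2 (n * d / β)
  set lδ := Real.logb 2 (1 / δ)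
  set Q := Real.logb 2 (d * Real.logb 2 U / β) with hQ
  have hQ0 : 0 ≤ Q := by
    refine Real.logb_nonneg (by norm_num) ?_
    rw [le_div_iff₀ hβ]
    nlinarith [one_le_logb_two hU']
  have hℓ : 1 ≤ c * ℓ := by
    refine hcβ.trans (mul_le_mul_of_nonneg_left ?_ (by linarith))
    refine Real.logb_le_logb_of_le (by norm_num) (by positivity) ?_
    gcongr
    nlinarith
  have hℓ0 : 0 < ℓ := by
    by_contra h0
    nlinarith
  have hlδ0 : 0 < lδ := by
    by_contra h0
    nlinarith
  have hAℓ : A ≤ 4 * c * ℓ := by nlinarith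
  have hL := logb_two_div_le hδ hc hcδ
  set L := Real.logb 2 (2 / δ)
  have hL1 : 1 ≤ L := one_le_logb_two (by rw [le_div_iff₀ hδ]; linarith)
  have hsum : E / 0.4 * Λ / coordEps d ε δ +
      1.3 * Real.log (2 * (J + 1) / (β / (2 * d))) / coordEps d ε δ ≤
      4 * E * Λ / coordEps d ε δ := by
    rw [← add_div]
    gcongr
    rw [show E / 0.4 * Λ = 2.5 * (E * Λ) by ring]
    nlinarith
  have hinv : 1 / coordEps d ε δ = 4 * Real.sqrt (d * L) / ε := by
    rw [coordEps, one_div_div]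
  have hsq : Real.sqrt A * Real.sqrt (d * L) ≤ 3 * c * Real.sqrt (d * ℓ * lδ) := by
    rw [← Real.sqrt_mul (by linarith)]
    refine Real.sqrt_le_iff.2 ⟨by positivity, ?_⟩
    have hnn : 0 ≤ d * ℓ * lδ := by positivity
    rw [mul_pow, Real.sq_sqrt hnn]
    calc A * (d * L) ≤ (4 * c * ℓ) * (d * (2 * c * lδ)) := by gcongr
      _ = 8 * c ^ 2 * (d * ℓ * lδ) := by ring
      _ ≤ (3 * c) ^ 2 * (d * ℓ * lδ) := by
          gcongr
          nlinarith
  calc _ ≤ 8 * (M * m) * (4 * E * Λ / coordEps d ε δ) := by gcongr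
    _ = 32 * E * M * (Λ * m) * (1 / coordEps d ε δ) := by ring
    _ ≤ 32 * E * M * (20 * c * Q * Real.sqrt A) * (1 / coordEps d ε δ) := by gcongr
    _ = 2560 * E * c * M * Q / ε * (Real.sqrt A * Real.sqrt (d * L)) := by rw [hinv]; ring
    _ ≤ 2560 * E * c * M * Q / ε * (3 * c * Real.sqrt (d * ℓ * lδ)) := by gcongr
    _ = _ := by ring

/-- The error of HighDimSumDP. -/
theorem highDim_utility {H : Matrix (Fin d) (Fin d) ℤ} (hd : 0 < d) (hn : 0 < n) (hU : 2 ≤ U)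
    (hβ : 0 < β) (hβ1 : β < 1) (hε : 0 < ε) (hδ : 0 < δ) (hδ1 : δ < 1) (hc : 1 ≤ c)
    (hcβ : 1 ≤ c * Real.logb 2 (1 / β)) (hcδ : 1 ≤ c * Real.logb 2 (1 / δ)) {E C : ℝ}
    (hE : 1 ≤ E) (hεE : ε ≤ E) (hH : H.IsHadamard) (hC : 7680 * E * c ^ 2 ≤ C)
    (D : Fin n → Fin d → ℤ) (hD : maxL2 D ≤ U) :
    ENNReal.ofReal (1 - β) ≤ (highDimOutput H U ε δ β D).toOuterMeasure
      {y | l2norm (fun k => y k - ∑ i, (D i k : ℝ)) ≤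
        C * (maxL2 D * Real.sqrt (d * Real.logb 2 (n * d / β) * Real.logb 2 (1 / δ)) *
          Real.logb 2 (d * Real.logb 2 U / β) / ε)} := by
  refine highDim_accuracy hd hn (by omega) hβ hβ1 hε hδ hδ1 hE
    ((coordEps_le hd hε hδ hδ1).trans hεE) hH D hD rfl rfl rfl ?_
  refine (error_order hd hn hU hβ hβ1 hε hδ hδ1 hc hcβ hcδ hE (maxL2_nonneg D)).trans ?_
  refine mul_le_mul_of_nonneg_right hC ?_
  have hd' : (1 : ℝ) ≤ d := by exact_mod_cast hd
  have hU' : (2 : ℝ) ≤ U := by exact_mod_cast hU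
  have hQ0 : 0 ≤ Real.logb 2 (d * Real.logb 2 U / β) := by
    refine Real.logb_nonneg (by norm_num) ?_
    rw [le_div_iff₀ hβ]
    nlinarith [one_le_logb_two hU']
  have := maxL2_nonneg D
  positivity

end ErrorOrder

/-! ### Communication -/

section Communication

variable {d n U : ℕ} {H : Matrix (Fin d) (Fin d) ℤ} {ε δ β : ℝ} {σ : Fin d → ℤˣ}

theorem ev_prod_of_additive {M ι : Type*} [AddCommMonoid M] (s : Finset ι) (μ : ι → PMF M)
    {f : M → ℝ≥0∞} (h0 : f 0 = 0) (hf : ∀ x y, f (x + y) = f x + f y) :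
    ev (∏ i ∈ s, μ i) f = ∑ i ∈ s, ev (μ i) f := by
  classical
  induction s using Finset.induction_on with
  | empty => simp [one_conv_def, ev_pure, h0]
  | insert i s hi ih =>
    rw [Finset.prod_insert hi, Finset.sum_insert hi, ev_mul_of_additive _ _ hf, ih]

theorem expectedCard_eq_ev {α : Type*} (μ : PMF (Multiset α)) :
    expectedCard μ = ev μ fun S => (Multiset.card S : ℝ≥0∞) := rfl

theorem expectedCard_mul {α : Type*} (μ ν : PMF (Multiset α)) :
    expectedCard (μ * ν) = expectedCard μ + expectedCard ν :=
  ev_mul_of_additive μ ν fun S T => by rw [Multiset.card_add, Nat.cast_add]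

theorem expectedCard_prod {α ι : Type*} (s : Finset ι) (μ : ι → PMF (Multiset α)) :
    expectedCard (∏ i ∈ s, μ i) = ∑ i ∈ s, expectedCard (μ i) :=
  ev_prod_of_additive s μ (by simp) fun S T => by rw [Multiset.card_add, Nat.cast_add]

theorem expectedCard_map_labelHom (c : Slot d) (μ : PMF (Multiset ℤ)) :
    expectedCard (μ.map (labelHom c)) = expectedCard μ := by
  rw [expectedCard_eq_ev, ev_map]
  simp [labelHom, expectedCard_eq_ev]

theorem expectedCard_negBin_nsmul_le {α : Type*} {r θ : ℝ} (hr : 0 < r) (hθ : 0 < θ)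
    (s : Multiset α) {k : ℕ} (hs : Multiset.card s ≤ k) :
    expectedCard ((negBin r (Real.exp (-θ))).map fun z => z • s) ≤
      ENNReal.ofReal (k * (r / θ)) := by
  rw [expectedCard_eq_ev, ev_map]
  calc _ ≤ ev (negBin r (Real.exp (-θ))) (fun z => (k : ℝ≥0∞) * (z : ℝ≥0∞)) := by
        refine ev_mono _ fun z => ?_
        rw [Multiset.card_nsmul, mul_comm]
        exact_mod_cast Nat.mul_le_mul_right z hs
    _ ≤ k * ENNReal.ofReal (r / θ) := by
        rw [ev_const_mul]
        gcongr
        exact ev_negBin_id_exp_le hr hθ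
    _ = _ := by rw [ENNReal.ofReal_mul (by positivity), ENNReal.ofReal_natCast]

theorem card_zeroSum_le (v : ℕ) : Multiset.card (zeroSum v) ≤ 3 := by
  unfold zeroSum
  split_ifs <;> simp

theorem card_signedZeroSum_le (b : Bool) (v : ℕ) : Multiset.card (signedZeroSum b v) ≤ 3 := by
  have := card_zeroSum_le v
  unfold signedZeroSum
  split_ifs
  · exact this
  · rwa [Multiset.card_map]

/-- The shape parameter of the total flooding noise. -/
def floodShape (δ : ℝ) (V : ℕ) : ℝ := 3 * (1 + Real.log (1 / (δ / floodParts V)))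

theorem three_le_floodShape (hδ : 0 < δ) (hδ1 : δ < 1) (V : ℕ) : 3 ≤ floodShape δ V := by
  have h : 0 ≤ Real.log (1 / (δ / floodParts V)) := by
    have := floodParts_pos V
    refine Real.log_nonneg ?_
    rw [le_div_iff₀ (by positivity), one_mul]
    exact (floodDelta_lt_one hδ hδ1 V).2.le
  unfold floodShape
  linarith

theorem expectedCard_floodNoise_le {E : ℝ} (hE : 1 ≤ E) (hε : 0 < ε) (hεE : ε ≤ E) (hδ : 0 < δ)
    (hδ1 : δ < 1) (hn : 0 < n) {V v : ℕ} (hV : 0 < V) (hv : 0 < v) {s : Multiset ℤ}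
    (hs : Multiset.card s ≤ 3) :
    expectedCard (floodNoise ε δ n V v s) ≤
      ENNReal.ofReal (330 * E * floodShape δ V * floodParts V * V / (n * ε) * (1 / v)) := by
  have hn' : (0 : ℝ) < n := by exact_mod_cast hn
  have hV' : (0 : ℝ) < V := by exact_mod_cast hV
  have hv' : (0 : ℝ) < v := by exact_mod_cast hv
  have hr := three_le_floodShape hδ hδ1 V
  have hΓ := one_le_floodParts V
  have he := floodEps_pos hε V
  refine (expectedCard_negBin_nsmul_le (k := 3) ?_ ?_ s hs).trans (ENNReal.ofReal_le_ofReal ?_)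
  · have : 0 < floodShape δ V := by linarith
    exact div_pos this hn'
  · positivity
  change ((3 : ℕ) : ℝ) * (floodShape δ V / n / _) ≤ _
  set Γ : ℝ := (floodParts V : ℝ)
  set r := floodShape δ V
  set e := min 1 (lam * ε / Γ)
  have hinv : 1 / e ≤ 11 * E * Γ / ε := by
    rw [div_le_div_iff₀ he hε, one_mul]
    rcases min_choice 1 (lam * ε / Γ) with h | h
    · simp only [e, h]
      nlinarith [mul_le_mul hE hΓ zero_le_one (by linarith)]
    · simp only [e, h, lam]
      have : 11 * E * Γ * (0.1 * ε / Γ) = 1.1 * E * ε := by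
        field_simp
        norm_num
      rw [this]
      nlinarith
  calc ((3 : ℕ) : ℝ) * (r / n / (0.2 * e / (2 * V / v)))
      = 30 * r * V / (n * v) * (1 / e) := by
        push_cast
        field_simp
        norm_num
    _ ≤ 30 * r * V / (n * v) * (11 * E * Γ / ε) := by gcongr
    _ = _ := by
        field_simp
        norm_num

theorem expectedCard_centralNoise_le (hε : 0 < ε) (hn : 0 < n) {V : ℕ} (hV : 0 < V) (w : ℤ) :
    expectedCard (centralNoise ε n V w) ≤ ENNReal.ofReal (2 * V / (n * ε)) := by
  have hn' : (0 : ℝ) < n := by exact_mod_cast hn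
  have hV' : (0 : ℝ) < V := by exact_mod_cast hV
  have h1 := one_sub_lam_pos
  refine (expectedCard_negBin_nsmul_le (k := 1) (by positivity) (by positivity) {w}
    (by simp)).trans (ENNReal.ofReal_le_ofReal ?_)
  have : ((1 : ℕ) : ℝ) * (1 / n / ((1 - lam) * ε / V)) = V / (n * ε) * (1 / (1 - lam)) := by
    push_cast
    field_simp
  rw [this]
  calc V / (n * ε) * (1 / (1 - lam)) ≤ V / (n * ε) * 2 := by
        gcongr
        norm_num [lam]
    _ = _ := by ring

theorem sum_one_div_le {V : ℕ} :
    ∑ v ∈ Finset.Icc 1 V, 1 / (v : ℝ) ≤ 1 + Real.log V := by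
  have h := harmonic_le_one_add_log V
  rw [harmonic_eq_sum_Icc] at h
  push_cast at h
  simpa using h

/-- The expected number of noise messages of one user in one instance of BaseSumDP. -/
theorem expectedCard_noise_le {E : ℝ} (hE : 1 ≤ E) (hε : 0 < ε) (hεE : ε ≤ E) (hδ : 0 < δ)
    (hδ1 : δ < 1) (hn : 0 < n) {V : ℕ} (hV : 0 < V) :
    expectedCard (noise ε δ n V) ≤ ENNReal.ofReal
      (664 * E * floodShape δ V * floodParts V * (1 + Real.log V) * V / (n * ε)) := by
  have hn' : (0 : ℝ) < n := by exact_mod_cast hn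
  have hV' : (1 : ℝ) ≤ V := by exact_mod_cast hV
  have hr := three_le_floodShape hδ hδ1 V
  have hΓ := one_le_floodParts V
  have hlog := Real.log_nonneg hV'
  set r := floodShape δ V with hrdef
  set Γ : ℝ := (floodParts V : ℝ) with hΓdef
  set K := 330 * E * r * Γ * V / (n * ε) with hK
  have hK0 : 0 ≤ K := by positivity
  rw [noise_eq, expectedCard_mul, expectedCard_mul, expectedCard_mul, expectedCard_prod]
  have hflood : ∑ q ∈ (Finset.univ : Finset Bool) ×ˢ Finset.Icc 2 V,
      expectedCard (floodNoise ε δ n V q.2 (signedZeroSum q.1 q.2)) ≤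
      ENNReal.ofReal (2 * K * ∑ v ∈ Finset.Icc 2 V, 1 / (v : ℝ)) := by
    calc _ ≤ ∑ q ∈ (Finset.univ : Finset Bool) ×ˢ Finset.Icc 2 V,
          ENNReal.ofReal (K * (1 / (q.2 : ℝ))) := by
          refine Finset.sum_le_sum fun q hq => ?_
          have hq2 : 2 ≤ q.2 := (Finset.mem_Icc.1 (Finset.mem_product.1 hq).2).1
          exact expectedCard_floodNoise_le hE hε hεE hδ hδ1 hn hV (by omega)
            (card_signedZeroSum_le _ _)
      _ = _ := by
          rw [← ENNReal.ofReal_sum_of_nonneg (fun q _ => by positivity), Finset.sum_product]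
          simp only [← Finset.mul_sum, Finset.sum_const, Finset.card_univ, Fintype.card_bool,
            nsmul_eq_mul, Nat.cast_ofNat, mul_assoc]
          rw [mul_left_comm]
  have hone : expectedCard (floodNoise ε δ n V 1 (zeroSum 1)) ≤ ENNReal.ofReal (2 * K) := by
    refine (expectedCard_floodNoise_le hE hε hεE hδ hδ1 hn hV one_pos (card_zeroSum_le 1)).trans
      (ENNReal.ofReal_le_ofReal ?_)
    simp only [Nat.cast_one, div_one, mul_one]
    linarith
  have hc := expectedCard_centralNoise_le hε hn hV
  have hsum0 : 0 ≤ ∑ v ∈ Finset.Icc 2 V, 1 / (v : ℝ) := Finset.sum_nonneg fun v _ => by positivity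
  have hsum : 1 + ∑ v ∈ Finset.Icc 2 V, 1 / (v : ℝ) ≤ 1 + Real.log V := by
    have h := sum_one_div_le (V := V)
    rw [← Finset.add_sum_Ioc_eq_sum_Icc hV] at h
    have e : Finset.Ioc 1 V = Finset.Icc 2 V := by
      ext v
      simp [Nat.succ_le_iff]
    rw [e] at h
    simpa using h
  calc _ ≤ ENNReal.ofReal (2 * V / (n * ε)) + ENNReal.ofReal (2 * V / (n * ε)) +
        ENNReal.ofReal (2 * K) +
        ENNReal.ofReal (2 * K * ∑ v ∈ Finset.Icc 2 V, 1 / (v : ℝ)) := by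
        gcongr
        · exact hc 1
        · exact hc (-1)
    _ = ENNReal.ofReal (4 * V / (n * ε) + 2 * K * (1 + ∑ v ∈ Finset.Icc 2 V, 1 / (v : ℝ))) := by
        rw [← ENNReal.ofReal_add (by positivity) (by positivity),
          ← ENNReal.ofReal_add (by positivity) (by positivity),
          ← ENNReal.ofReal_add (by positivity) (by positivity)]
        congr 1
        ring
    _ ≤ _ := by
        refine ENNReal.ofReal_le_ofReal ?_
        calc _ ≤ 4 * (E * r * Γ * (1 + Real.log V)) * V / (n * ε) +
              2 * K * (1 + Real.log V) := by
              gcongr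
              have h1 : 1 ≤ E * r := by nlinarith
              have h2 : 1 ≤ E * r * Γ := by nlinarith
              nlinarith
          _ = _ := by
              rw [hK]
              ring

theorem expectedCard_rounded_le {B : ℕ} (hB : 0 < B) (x : ℕ) :
    expectedCard ((randRound B x).map (node true)) ≤ if x ≠ 0 then 1 else 0 := by
  rw [expectedCard_eq_ev, ev_map]
  split_ifs with hx
  · refine ev_le_one _ fun a => ?_
    unfold node
    split_ifs <;> simp
  · rw [not_not.1 hx, randRound_zero hB, ev_pure]
    simp [node]

theorem expectedCard_highDim_le {N : ℝ} (hd : 0 < d) (hn : 0 < n) (hε : 0 < ε) (hδ : 0 < δ)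
    (hδ1 : δ < 1) (hN0 : 0 ≤ N)
    (hN : ∀ j, expectedCard (noise (coordEps d ε δ) (coordDelta d δ) n
      (reducedSize (coordEps d ε δ) n (2 ^ j))) ≤ ENNReal.ofReal N) (x : Fin d → ℤ) :
    expectedCard (highDimRandomizer H n U ε δ β σ x) ≤
      ENNReal.ofReal (d + 2 * d * (topLevel d n U β + 1) * N) := by
  classical
  have hε' := coordEps_pos hd hε hδ hδ1
  rw [highDimRandomizer_eq, expectedCard_prod]
  set J := topLevel d n U β
  calc _ ≤ ∑ c ∈ slots d J, ((if slotInput H n U β σ x c ≠ 0 then 1 else 0) +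
        ENNReal.ofReal N) := by
        refine Finset.sum_le_sum fun c _ => ?_
        rw [expectedCard_map_labelHom, baseRandomizer_eq, expectedCard_mul]
        obtain ⟨m, -, -, hg, -⟩ := exists_reducedSize_eq hε' hn c.2.2
        exact add_le_add (expectedCard_rounded_le (by rw [hg]; positivity) _) (hN _)
    _ = (((slots d J).filter fun c => slotInput H n U β σ x c ≠ 0).card : ℝ≥0∞) +
        ((2 * d * (J + 1) : ℕ) : ℝ≥0∞) * ENNReal.ofReal N := by
        rw [Finset.sum_add_distrib, Finset.sum_boole, Finset.sum_const, card_slots, nsmul_eq_mul]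
    _ ≤ (d : ℝ≥0∞) + ((2 * d * (J + 1) : ℕ) : ℝ≥0∞) * ENNReal.ofReal N := by
        gcongr
        exact card_slotInput_ne_zero_le x J
    _ = _ := by
        rw [ENNReal.ofReal_add (by positivity) (by positivity), ENNReal.ofReal_natCast,
          ENNReal.ofReal_mul (by positivity), ← ENNReal.ofReal_natCast (2 * d * (J + 1))]
        push_cast
        rfl

end Communication

/-! ### The order of magnitude of the communication -/

section CommunicationOrder

variable {d n U : ℕ} {H : Matrix (Fin d) (Fin d) ℤ} {ε δ β E : ℝ} {σ : Fin d → ℤˣ}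

theorem one_div_zeta_le (hε : 0 < ε) (hE : 1 ≤ E) (hεE : ε ≤ E) : 1 / zeta ε ≤ 10 * E := by
  rw [div_le_iff₀ (zeta_pos hε)]
  rcases min_choice (0.1 : ℝ) (0.1 / ε) with h | h
  · rw [zeta, h]
    linarith
  · rw [zeta, h, mul_div_assoc', le_div_iff₀ hε]
    linarith

theorem sqrt_div_zeta_le (hε : 0 < ε) (hE : 1 ≤ E) (hεE : ε ≤ E) (n : ℕ) :
    Real.sqrt (n / zeta ε) ≤ 10 * E * Real.sqrt n := by
  refine Real.sqrt_le_iff.2 ⟨by positivity, ?_⟩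
  rw [mul_pow, Real.sq_sqrt (Nat.cast_nonneg n), div_eq_mul_one_div, mul_comm]
  refine mul_le_mul_of_nonneg_right ((one_div_zeta_le hε hE hεE).trans ?_) (Nat.cast_nonneg n)
  nlinarith

theorem one_add_log_le (hE : 1 ≤ E) (hn : 2 ≤ n) {V : ℝ} (hV : 0 < V)
    (hVn : V ≤ 10 * E * Real.sqrt n) : 1 + Real.log V ≤ 11 * E * Real.logb 2 n := by
  have hn' : (2 : ℝ) ≤ n := by exact_mod_cast hn
  have h1 : Real.log V ≤ Real.log (10 * E) + Real.log n / 2 := by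
    refine (Real.log_le_log hV hVn).trans ?_
    rw [Real.log_mul (by positivity) (by positivity), Real.log_sqrt (by positivity)]
  have h2 := Real.log_le_sub_one_of_pos (show 0 < 10 * E by linarith)
  have h3 := log_le_logb_two (show (1 : ℝ) ≤ n by linarith)
  have h4 := one_le_logb_two hn'
  have h5 : 0 ≤ Real.log n := Real.log_nonneg (by linarith)
  nlinarith

theorem floodParts_two_pow_le (m : ℕ) :
    (floodParts (2 ^ m) : ℝ) ≤ 8 * (1 + Real.log ((2 ^ m : ℕ) : ℝ)) := by
  rw [floodParts, Nat.clog_pow 2 m (by norm_num)]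
  push_cast
  rw [Real.log_pow]
  nlinarith [Real.log_two_gt_d9, Nat.cast_nonneg (α := ℝ) m]

theorem floodShape_le (hd : 0 < d) (hE : 1 ≤ E) (hn : 2 ≤ n) (hδ : 0 < δ) (hδn : δ ≤ 1 / n) {V : ℕ}
    (hV : (floodParts V : ℝ) ≤ 88 * E * Real.logb 2 n) :
    floodShape (coordDelta d δ) V ≤ 543 * E * Real.logb 2 (d / δ) := by
  have hd' : (1 : ℝ) ≤ d := by exact_mod_cast hd
  have hn' : (2 : ℝ) ≤ n := by exact_mod_cast hn
  have hnδ : n ≤ d / δ := by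
    rw [le_div_iff₀ hδ]
    rw [le_div_iff₀ (by linarith)] at hδn
    linarith
  have hL := one_le_logb_two (hn'.trans hnδ)
  have hlog := log_le_logb_two (show 1 ≤ d / δ by linarith)
  have hΓ0 := floodParts_pos V
  set y := d / δ
  have hy0 : 0 < y := by linarith
  have hln : Real.logb 2 n ≤ 2 * y := by
    have h1 := logb_two_le_two_mul_log (show (1 : ℝ) ≤ n by linarith)
    have h2 := Real.log_le_sub_one_of_pos (show (0 : ℝ) < n by linarith)
    linarith
  have hΓ : Real.log (floodParts V) ≤ 176 * E - 1 + Real.log y := by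
    calc Real.log (floodParts V) ≤ Real.log (176 * E * y) := by
          refine Real.log_le_log hΓ0 (hV.trans ?_)
          nlinarith
      _ = Real.log (176 * E) + Real.log y := by
          rw [Real.log_mul (by positivity) (by positivity)]
      _ ≤ _ := by
          have := Real.log_le_sub_one_of_pos (show 0 < 176 * E by linarith)
          linarith
  have e : 1 / (coordDelta d δ / floodParts V) = floodParts V * (4 * y) := by
    simp only [coordDelta, y]
    field_simp
  rw [floodShape, e, Real.log_mul hΓ0.ne' (by positivity), Real.log_mul (by norm_num) hy0.ne']
  have h4 := Real.log_le_sub_one_of_pos (show (0 : ℝ) < 4 by norm_num)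
  nlinarith

theorem expectedCard_noise_order (hd : 0 < d) (hE : 1 ≤ E) (hε : 0 < ε) (hεE : ε ≤ E)
    (hn : 2 ≤ n) (hδ : 0 < δ) (hδn : δ ≤ 1 / n) (j : ℕ) :
    expectedCard (noise ε (coordDelta d δ) n (reducedSize ε n (2 ^ j))) ≤ ENNReal.ofReal
      (3490143360 * E ^ 5 * (Real.logb 2 (d / δ) * Real.logb 2 n ^ 2 / (ε * Real.sqrt n))) := by
  have hn' : (2 : ℝ) ≤ n := by exact_mod_cast hn
  have hδ1 : δ < 1 := by
    refine hδn.trans_lt ?_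
    rw [div_lt_one (by linarith)]
    linarith
  have hδ'1 := coordDelta_lt_one hd hδ1
  have hδ' := coordDelta_pos hd hδ
  obtain ⟨m, -, hV, -, hVle, -⟩ := exists_reducedSize_eq hε (by omega : 0 < n) j
  rw [hV]
  refine (expectedCard_noise_le hE hε hεE hδ' hδ'1 (by omega) (by positivity)).trans
    (ENNReal.ofReal_le_ofReal ?_)
  have hVn : ((2 ^ m : ℕ) : ℝ) ≤ 10 * E * Real.sqrt n := by
    push_cast
    exact hVle.trans (sqrt_div_zeta_le hε hE hεE n)
  have hlog := one_add_log_le hE hn (by positivity) hVn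
  have hΓ := floodParts_two_pow_le m
  have hΓ' : (floodParts (2 ^ m) : ℝ) ≤ 88 * E * Real.logb 2 n := by linarith
  have hr := floodShape_le hd hE hn hδ hδn hΓ'
  have hr0 := three_le_floodShape hδ' hδ'1 (2 ^ m)
  have hΓ0 := floodParts_pos (2 ^ m)
  have hl0 : 0 ≤ Real.log ((2 ^ m : ℕ) : ℝ) :=
    Real.log_nonneg (by exact_mod_cast Nat.one_le_two_pow)
  have hs0 : 0 < Real.sqrt n := Real.sqrt_pos.2 (by linarith)
  have hln := one_le_logb_two hn'
  set ℓ := Real.logb 2 (n : ℝ)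
  set Ld := Real.logb 2 (d / δ)
  set V : ℝ := ((2 ^ m : ℕ) : ℝ)
  have hLd : 0 ≤ 543 * E * Ld := by linarith
  calc 664 * E * floodShape (coordDelta d δ) (2 ^ m) * floodParts (2 ^ m) * (1 + Real.log V) * V /
        (n * ε)
      ≤ 664 * E * (543 * E * Ld) * (88 * E * ℓ) * (11 * E * ℓ) * (10 * E * Real.sqrt n) /
        (n * ε) := by gcongr
    _ = _ := by
        field_simp
        rw [Real.sq_sqrt (by linarith)]
        ring

theorem logb_two_mul_div_le (hd : 0 < d) (hn : 2 ≤ n) (hβ : 0 < β) (hβ1 : β < 1) :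
    1 ≤ Real.logb 2 (n * d / β) := by
  have hd' : (1 : ℝ) ≤ d := by exact_mod_cast hd
  have hn' : (2 : ℝ) ≤ n := by exact_mod_cast hn
  refine one_le_logb_two ?_
  rw [le_div_iff₀ hβ]
  nlinarith

theorem topLevel_add_one_le_mul_logb (hd : 0 < d) (hn : 2 ≤ n) (hU : 2 ≤ U) (hβ : 0 < β)
    (hβ1 : β < 1) :
    (topLevel d n U β : ℝ) + 1 ≤ 5 * Real.logb 2 (U * Real.logb 2 (n * d / β)) := by
  have hU' : (2 : ℝ) ≤ U := by exact_mod_cast hU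
  have h := topLevel_add_one_le hd (by omega : 0 < n) (by omega : 0 < U) hβ hβ1
  have hℓ := logb_two_mul_div_le hd hn hβ hβ1
  rw [logb_eight_mul hd (by omega) hβ] at h
  set ℓ := Real.logb 2 (n * d / β)
  have hu := one_le_logb_two hU'
  have hℓ0 : 0 ≤ Real.logb 2 ℓ := Real.logb_nonneg (by norm_num) hℓ
  have h8 : Real.logb 2 (2 * (3 + ℓ)) ≤ 3 + Real.logb 2 ℓ := by
    calc Real.logb 2 (2 * (3 + ℓ)) ≤ Real.logb 2 (2 ^ (3 : ℝ) * ℓ) := by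
          refine Real.logb_le_logb_of_le (by norm_num) (by linarith) ?_
          norm_num
          linarith
      _ = _ := by
          rw [Real.logb_mul (by positivity) (by positivity),
            Real.logb_rpow (by norm_num) (by norm_num)]
  rw [Real.logb_mul (by positivity) (by positivity)]
  linarith

theorem one_div_coordEps_le (hd : 0 < d) (hε : 0 < ε) (hδ : 0 < δ) (hδ2 : δ ≤ 1 / 2) :
    1 / coordEps d ε δ ≤ 8 * (Real.sqrt d * Real.sqrt (Real.logb 2 (d / δ))) / ε := by
  have hd' : (1 : ℝ) ≤ d := by exact_mod_cast hd
  rw [coordEps, one_div_div]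
  have h2 : 2 ≤ d / δ := by
    rw [le_div_iff₀ hδ]
    linarith
  have hL := one_le_logb_two h2
  have h : Real.logb 2 (2 / δ) ≤ 4 * Real.logb 2 (d / δ) := by
    calc Real.logb 2 (2 / δ) ≤ Real.logb 2 (2 * (d / δ)) := by
          refine Real.logb_le_logb_of_le (by norm_num) (by positivity) ?_
          rw [mul_div_assoc']
          gcongr
          linarith
      _ = 1 + Real.logb 2 (d / δ) := by
          rw [Real.logb_mul (by norm_num) (by linarith), Real.logb_self_eq_one (by norm_num)]
      _ ≤ _ := by linarith
  have hs : Real.sqrt (Real.logb 2 (2 / δ)) ≤ 2 * Real.sqrt (Real.logb 2 (d / δ)) := by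
    refine Real.sqrt_le_iff.2 ⟨by positivity, ?_⟩
    rw [mul_pow, Real.sq_sqrt (by linarith)]
    linarith
  rw [Real.sqrt_mul (by linarith)]
  refine div_le_div_of_nonneg_right ?_ hε.le
  nlinarith [Real.sqrt_nonneg (d : ℝ)]

theorem rpow_three_halves {x : ℝ} (hx : 0 < x) : x ^ (1.5 : ℝ) = x * Real.sqrt x := by
  rw [Real.sqrt_eq_rpow, show (1.5 : ℝ) = 1 + 1 / 2 by norm_num, Real.rpow_add hx, Real.rpow_one]

/-- The communication of HighDimSumDP. -/
theorem highDim_communication (hd : 0 < d) (hn : 2 ≤ n) (hU : 2 ≤ U) (hβ : 0 < β) (hβ1 : β < 1)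
    (hε : 0 < ε) (hE : 1 ≤ E) (hεE : ε ≤ E) (hδ : 0 < δ) (hδn : δ ≤ 1 / n) {C : ℝ}
    (hC : 280000000000 * E ^ 5 ≤ C) (x : Fin d → ℤ) :
    expectedCard (highDimRandomizer H n U ε δ β σ x) ≤
      ENNReal.ofReal (d + C * ((d : ℝ) ^ (1.5 : ℝ) *
        Real.logb 2 (U * Real.logb 2 (n * d / β)) * Real.logb 2 (d / δ) ^ (1.5 : ℝ) *
        Real.logb 2 n ^ 2 / (ε * Real.sqrt n))) := by
  have hd' : (1 : ℝ) ≤ d := by exact_mod_cast hd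
  have hn' : (2 : ℝ) ≤ n := by exact_mod_cast hn
  have hδ2 : δ ≤ 1 / 2 := hδn.trans (one_div_le_one_div_of_le (by norm_num) hn')
  have hδ1 : δ < 1 := by linarith
  have hε' := coordEps_pos hd hε hδ hδ1
  have hs0 : 0 < Real.sqrt n := Real.sqrt_pos.2 (by linarith)
  have hL := one_le_logb_two (show 2 ≤ d / δ by rw [le_div_iff₀ hδ]; linarith)
  have hJ := topLevel_add_one_le_mul_logb hd hn hU hβ hβ1
  have hinv := one_div_coordEps_le hd hε hδ hδ2
  refine (expectedCard_highDim_le hd (by omega) hε hδ hδ1 (by positivity)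
    (expectedCard_noise_order hd hE hε' ((coordEps_le hd hε hδ hδ1).trans hεE) hn hδ hδn)
    x).trans (ENNReal.ofReal_le_ofReal ?_)
  rw [rpow_three_halves (by linarith), rpow_three_halves (by linarith)]
  set Ld := Real.logb 2 (d / δ)
  set X := Real.logb 2 (U * Real.logb 2 (n * d / β))
  set ℓ := Real.logb 2 (n : ℝ)
  have hX : 0 ≤ X := by
    have := Nat.cast_nonneg (α := ℝ) (topLevel d n U β)
    linarith
  refine add_le_add_right ?_ _
  calc 2 * d * (topLevel d n U β + 1) *
        (3490143360 * E ^ 5 * (Ld * ℓ ^ 2 / (coordEps d ε δ * Real.sqrt n)))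
      = 2 * d * (topLevel d n U β + 1) *
        (3490143360 * E ^ 5 * (Ld * ℓ ^ 2 / Real.sqrt n * (1 / coordEps d ε δ))) := by
        field_simp
    _ ≤ 2 * d * (5 * X) * (3490143360 * E ^ 5 *
        (Ld * ℓ ^ 2 / Real.sqrt n * (8 * (Real.sqrt d * Real.sqrt Ld) / ε))) := by gcongr
    _ = 279211468800 * E ^ 5 * (d * Real.sqrt d * X * (Ld * Real.sqrt Ld) * ℓ ^ 2 /
        (ε * Real.sqrt n)) := by
        field_simp
        ring
    _ ≤ _ := by
        refine mul_le_mul_of_nonneg_right (le_trans ?_ hC) (by positivity)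
        gcongr
        norm_num

end CommunicationOrder

/-! ### Message size -/

section MessageSize

variable {d n U : ℕ} {H : Matrix (Fin d) (Fin d) ℤ} {ε δ β E : ℝ} {σ : Fin d → ℤˣ}

/-- All messages that can occur in a random multiset satisfy `P`. -/
def Sends {α : Type*} (μ : PMF (Multiset α)) (P : α → Prop) : Prop :=
  ∀ S ∈ μ.support, ∀ m ∈ S, P m

theorem Sends.mul {α : Type*} {μ ν : PMF (Multiset α)} {P : α → Prop} (hμ : Sends μ P)
    (hν : Sends ν P) : Sends (μ * ν) P := by
  intro S hS m hm
  obtain ⟨a, ha, b, hb, rfl⟩ := mem_support_mul.1 hS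
  rcases Multiset.mem_add.1 hm with h | h
  · exact hμ a ha m h
  · exact hν b hb m h

theorem Sends.prod {α ι : Type*} {s : Finset ι} {μ : ι → PMF (Multiset α)} {P : α → Prop}
    (h : ∀ i ∈ s, Sends (μ i) P) : Sends (∏ i ∈ s, μ i) P := by
  refine Finset.prod_induction μ (fun ν => Sends ν P) (fun _ _ => Sends.mul) ?_ h
  intro S hS m hm
  rw [one_conv_def, PMF.support_pure, Set.mem_singleton_iff] at hS
  simp [hS] at hm

theorem sends_map_nsmul {α : Type*} (N : PMF ℕ) {s : Multiset α} {P : α → Prop}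
    (h : ∀ m ∈ s, P m) : Sends (N.map fun z => z • s) P := by
  intro S hS m hm
  obtain ⟨z, -, rfl⟩ := (PMF.mem_support_map_iff _ _ _).1 hS
  exact h m (Multiset.mem_of_mem_nsmul hm)

theorem abs_le_of_mem_zeroSum {v : ℕ} (hv : 0 < v) {w : ℤ} (hw : w ∈ zeroSum v) : |w| ≤ v := by
  unfold zeroSum at hw
  split_ifs at hw with h
  · subst h
    simp at hw
    rcases hw with rfl | rfl <;> simp
  · simp only [Multiset.insert_eq_cons, Multiset.mem_cons, Multiset.mem_singleton] at hw
    rw [abs_le]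
    omega

theorem abs_le_of_mem_signedZeroSum {b : Bool} {v : ℕ} (hv : 0 < v) {w : ℤ}
    (hw : w ∈ signedZeroSum b v) : |w| ≤ v := by
  unfold signedZeroSum at hw
  split_ifs at hw
  · exact abs_le_of_mem_zeroSum hv hw
  · obtain ⟨u, hu, rfl⟩ := Multiset.mem_map.1 hw
    rw [abs_neg]
    exact abs_le_of_mem_zeroSum hv hu

theorem sends_noise (ε δ : ℝ) (n : ℕ) {V : ℕ} (hV : 0 < V) :
    Sends (noise ε δ n V) fun w => |w| ≤ V := by
  have hV' : (1 : ℤ) ≤ V := by exact_mod_cast hV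
  rw [noise_eq]
  refine (((sends_map_nsmul _ ?_).mul (sends_map_nsmul _ ?_)).mul (sends_map_nsmul _ ?_)).mul
    (Sends.prod fun q hq => sends_map_nsmul _ ?_)
  · intro m hm
    rw [Multiset.mem_singleton.1 hm]
    simpa using hV'
  · intro m hm
    rw [Multiset.mem_singleton.1 hm]
    simpa using hV'
  · intro m hm
    exact (abs_le_of_mem_zeroSum one_pos hm).trans (by exact_mod_cast hV)
  · intro m hm
    have h := Finset.mem_Icc.1 (Finset.mem_product.1 hq).2
    exact (abs_le_of_mem_signedZeroSum (by omega) hm).trans (by exact_mod_cast h.2)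

theorem sends_base (hε : 0 < ε) (hn : 0 < n) {j x : ℕ} (hx : x ≤ 2 ^ j) :
    Sends (baseRandomizer ε δ n (2 ^ j) x) fun w => |w| ≤ reducedSize ε n (2 ^ j) := by
  obtain ⟨m, hm, hV, hg, -⟩ := exists_reducedSize_eq hε hn j
  rw [baseRandomizer_eq]
  refine Sends.mul ?_ (sends_noise _ _ _ (by rw [hV]; positivity))
  intro S hS w hw
  obtain ⟨a, ha, rfl⟩ := (PMF.mem_support_map_iff _ _ _).1 hS
  have hle := randRound_support_le (V := 2 ^ m) (by rw [hg]; positivity)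
    (by rw [hg, ← pow_add, Nat.sub_add_cancel hm]; exact hx) a ha
  simp only [node, if_true] at hw
  split_ifs at hw with h0
  · simp at hw
  · rw [Multiset.mem_singleton.1 hw, hV]
    simpa using (by exact_mod_cast hle : (a : ℤ) ≤ 2 ^ m)

theorem sends_highDim (hd : 0 < d) (hn : 0 < n) (hε : 0 < ε) (hδ : 0 < δ) (hδ1 : δ < 1)
    (x : Fin d → ℤ) :
    Sends (highDimRandomizer H n U ε δ β σ x) fun m => m.2.2.1 ≤ topLevel d n U β ∧
      |m.2.2.2| ≤ reducedSize (coordEps d ε δ) n (2 ^ m.2.2.1) := by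
  have hε' := coordEps_pos hd hε hδ hδ1
  rw [highDimRandomizer_eq]
  refine Sends.prod fun c hc => ?_
  intro S hS m hm
  obtain ⟨T, hT, rfl⟩ := (PMF.mem_support_map_iff _ _ _).1 hS
  obtain ⟨w, hw, rfl⟩ := Multiset.mem_map.1 hm
  simp only [slots, Finset.mem_product, Finset.mem_range] at hc
  exact ⟨Nat.lt_succ_iff.1 hc.2.2, sends_base hε' hn (slotInput_le x c) T hT w hw⟩

theorem encodableInBits_of_card_le {A : Set (Message d)} (T : Finset (Message d)) {L : ℕ} {b : ℝ}
    (hA : ∀ m ∈ A, m ∈ T) (hT : T.card ≤ 2 ^ L) (hL : (L : ℝ) ≤ b) : EncodableInBits A b := by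
  classical
  obtain ⟨e⟩ : Nonempty (T ↪ (Fin L → Bool)) := by
    refine Function.Embedding.nonempty_of_card_le ?_
    simpa using hT
  refine ⟨fun m => if h : m ∈ T then List.ofFn (e ⟨m, h⟩) else [], ?_, ?_⟩
  · intro m hm m' hm' h
    simp only [dif_pos (hA m hm), dif_pos (hA m' hm')] at h
    exact congrArg Subtype.val (e.injective (List.ofFn_injective h))
  · intro m hm
    simp only [dif_pos (hA m hm), List.length_ofFn]
    exact hL

theorem EncodableInBits.mono {A : Set (Message d)} {b b' : ℝ} (h : EncodableInBits A b)
    (hb : b ≤ b') : EncodableInBits A b' :=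
  let ⟨enc, h1, h2⟩ := h
  ⟨enc, h1, fun m hm => (h2 m hm).trans hb⟩

theorem encodable_possibleMessages {W : ℕ} (hW : 0 < W) (hd : 0 < d) (hn : 0 < n) (hε : 0 < ε)
    (hδ : 0 < δ) (hδ1 : δ < 1)
    (hV : ∀ j ≤ topLevel d n U β, reducedSize (coordEps d ε δ) n (2 ^ j) ≤ W) :
    EncodableInBits (possibleMessages H n U ε δ β)
      (Real.logb 2 d + Real.logb 2 (topLevel d n U β + 1) + Real.logb 2 W + 4) := by
  have hd' : (0 : ℝ) < d := by exact_mod_cast hd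
  have hW' : (0 : ℝ) < W := by exact_mod_cast hW
  set J := topLevel d n U β
  set T : Finset (Message d) := Finset.univ ×ˢ Finset.univ ×ˢ Finset.range (J + 1) ×ˢ
    Finset.Icc (-(W : ℤ)) W
  have hcard : T.card = d * (2 * ((J + 1) * (2 * W + 1))) := by
    simp only [T, Finset.card_product, Finset.card_univ, Fintype.card_fin, Fintype.card_bool,
      Finset.card_range, Int.card_Icc]
    congr 4
    omega
  have hcard' : T.card ≤ 8 * (d * ((J + 1) * W)) := by
    rw [hcard]
    calc d * (2 * ((J + 1) * (2 * W + 1))) ≤ d * (2 * ((J + 1) * (4 * W))) := by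
          gcongr
          omega
      _ = _ := by ring
  set N := 8 * (d * ((J + 1) * W))
  refine encodableInBits_of_card_le T (L := Nat.clog 2 N) ?_
    (hcard'.trans (Nat.le_pow_clog (by norm_num) _)) ?_
  · rintro m ⟨σ, x, S, hS, hm⟩
    obtain ⟨h1, h2⟩ := sends_highDim hd hn hε hδ hδ1 x S hS m hm
    have h3 : |m.2.2.2| ≤ (W : ℤ) := h2.trans (by exact_mod_cast hV _ h1)
    simp only [T, Finset.mem_product, Finset.mem_univ, true_and, Finset.mem_range, Finset.mem_Icc]
    exact ⟨by omega, abs_le.1 h3⟩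
  · have hN : 1 < N := by
      have : 0 < d * ((J + 1) * W) := by positivity
      omega
    have h1 := Nat.pow_pred_clog_lt_self (b := 2) (by norm_num) hN
    have h2 : (2 : ℝ) ^ (Nat.clog 2 N).pred < N := by exact_mod_cast h1
    have h3 : ((Nat.clog 2 N).pred : ℝ) ≤ Real.logb 2 N := by
      rw [Real.le_logb_iff_rpow_le (by norm_num) (by positivity), Real.rpow_natCast]
      exact h2.le
    have h4 : ((Nat.clog 2 N : ℕ) : ℝ) = (Nat.clog 2 N).pred + 1 := by
      have := Nat.succ_pred_eq_of_pos (Nat.clog_pos (b := 2) (by norm_num) hN)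
      exact_mod_cast this.symm
    have h5 : Real.logb 2 N = 3 + (Real.logb 2 d + (Real.logb 2 (J + 1) + Real.logb 2 W)) := by
      simp only [N]
      push_cast
      rw [Real.logb_mul (by norm_num) (by positivity), Real.logb_mul (by positivity) (by positivity),
        Real.logb_mul (by positivity) (by positivity), show (8 : ℝ) = 2 ^ (3 : ℝ) by norm_num,
        Real.logb_rpow (by norm_num) (by norm_num)]
    linarith

theorem highDim_messageSize (hd : 0 < d) (hn : 2 ≤ n) (hU : 2 ≤ U) (hβ : 0 < β) (hβ1 : β < 1)
    (hε : 0 < ε) (hE : 1 ≤ E) (hεE : ε ≤ E) (hδ : 0 < δ) (hδ1 : δ < 1) {C : ℝ}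
    (hC : 27 * E ≤ C) :
    EncodableInBits (possibleMessages H n U ε δ β)
      (C * (Real.logb 2 d + Real.logb 2 (Real.logb 2 (U * Real.logb 2 (n * d / β))) +
        min (Real.logb 2 n) (Real.logb 2 (U * Real.logb 2 (n * d / β))))) := by
  have hd' : (1 : ℝ) ≤ d := by exact_mod_cast hd
  have hn' : (2 : ℝ) ≤ n := by exact_mod_cast hn
  have hU' : (2 : ℝ) ≤ U := by exact_mod_cast hU
  have hε' := coordEps_pos hd hε hδ hδ1
  have hεE' := (coordEps_le hd hε hδ hδ1).trans hεE
  have hJ := topLevel_add_one_le_mul_logb hd hn hU hβ hβ1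
  set J := topLevel d n U β
  have hJ0 := Nat.cast_nonneg (α := ℝ) J
  have hX : 1 ≤ Real.logb 2 (U * Real.logb 2 (n * d / β)) :=
    one_le_logb_two (by nlinarith [logb_two_mul_div_le hd hn hβ hβ1])
  set X := Real.logb 2 (U * Real.logb 2 (n * d / β))
  have hℓ := one_le_logb_two hn'
  set ℓ := Real.logb 2 (n : ℝ)
  have hs1 : 1 ≤ Real.sqrt n := by
    rw [Real.one_le_sqrt]
    linarith
  set y := 10 * E * Real.sqrt n
  have hy : 1 ≤ y := by
    simp only [y]
    nlinarith
  set W := min (2 ^ J) ⌊y⌋₊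
  have hW : 0 < W := lt_min (by positivity) (Nat.floor_pos.2 hy)
  have hW' : (0 : ℝ) < W := by exact_mod_cast hW
  have hV : ∀ j ≤ J, reducedSize (coordEps d ε δ) n (2 ^ j) ≤ W := by
    intro j hj
    obtain ⟨m, hm, hV, -, hVle, -⟩ := exists_reducedSize_eq hε' (by omega : 0 < n) j
    rw [hV]
    refine le_min (Nat.pow_le_pow_right (by norm_num) (hm.trans hj)) (Nat.le_floor ?_)
    push_cast
    exact hVle.trans (sqrt_div_zeta_le hε' hE hεE' n)
  refine (encodable_possibleMessages hW hd (by omega) hε hδ hδ1 hV).mono ?_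
  have hlogJ : Real.logb 2 (J + 1) ≤ 3 + Real.logb 2 X := by
    calc Real.logb 2 (J + 1) ≤ Real.logb 2 (2 ^ (3 : ℝ) * X) := by
          refine Real.logb_le_logb_of_le (by norm_num) (by positivity) ?_
          norm_num
          linarith
      _ = _ := by
          rw [Real.logb_mul (by positivity) (by positivity),
            Real.logb_rpow (by norm_num) (by norm_num)]
  have hW1 : Real.logb 2 W ≤ 5 * X := by
    have h : (W : ℝ) ≤ 2 ^ (J : ℝ) := by
      rw [Real.rpow_natCast]
      exact_mod_cast min_le_left (2 ^ J) ⌊y⌋₊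
    have h2 := Real.logb_le_logb_of_le (b := 2) (by norm_num) hW' h
    rw [Real.logb_rpow (by norm_num) (by norm_num)] at h2
    linarith
  have hW2 : Real.logb 2 W ≤ 20 * E * ℓ := by
    have h : (W : ℝ) ≤ y :=
      (Nat.cast_le.2 (min_le_right (2 ^ J) ⌊y⌋₊)).trans (Nat.floor_le (by linarith))
    have h2 := Real.logb_le_logb_of_le (b := 2) (by norm_num) hW' h
    have h3 : Real.logb 2 y = Real.logb 2 (10 * E) + ℓ / 2 := by
      simp only [y]
      rw [Real.logb_mul (by positivity) (by positivity), Real.sqrt_eq_rpow,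
        Real.logb_rpow_eq_mul_logb_of_pos (by linarith)]
      ring
    have h4 := logb_two_le_two_mul_log (show 1 ≤ 10 * E by linarith)
    have h5 := Real.log_le_sub_one_of_pos (show 0 < 10 * E by linarith)
    nlinarith
  set μ := min ℓ X
  have hμ : 1 ≤ μ := le_min hℓ hX
  have hWμ : Real.logb 2 W ≤ 20 * E * μ := by
    rcases min_choice ℓ X with h | h
    · simp only [μ, h]
      exact hW2
    · simp only [μ, h]
      nlinarith
  have hld : 0 ≤ Real.logb 2 (d : ℝ) := Real.logb_nonneg (by norm_num) hd'
  have hlX : 0 ≤ Real.logb 2 X := Real.logb_nonneg (by norm_num) hX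
  calc _ ≤ 27 * E * (Real.logb 2 d + Real.logb 2 X + μ) := by
        nlinarith [mul_le_mul_of_nonneg_right hE hld, mul_le_mul_of_nonneg_right hE hlX,
          mul_le_mul hE hμ zero_le_one (by linarith)]
    _ ≤ _ := by gcongr

theorem highDim_messageSize_of_le (hd : 0 < d) (hn : 2 ≤ n) (hU : 2 ≤ U) (hβ : 0 < β)
    (hβ1 : β < 1) (hε : 0 < ε) (hE : 1 ≤ E) (hεE : ε ≤ E) (hδ : 0 < δ) (hδ1 : δ < 1) {C : ℝ}
    (hC : 108 * E ≤ C) (hnU : Real.logb 2 (n * d / β) ≤ U) (hUn : Real.logb 2 U ≤ n * d) :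
    EncodableInBits (possibleMessages H n U ε δ β)
      (C * (Real.logb 2 d + min (Real.logb 2 n) (Real.logb 2 U))) := by
  have hd' : (1 : ℝ) ≤ d := by exact_mod_cast hd
  have hn' : (2 : ℝ) ≤ n := by exact_mod_cast hn
  have hU' : (2 : ℝ) ≤ U := by exact_mod_cast hU
  refine (highDim_messageSize hd hn hU hβ hβ1 hε hE hεE hδ hδ1 le_rfl).mono ?_
  have hℓ := logb_two_mul_div_le hd hn hβ hβ1
  have hX : Real.logb 2 (U * Real.logb 2 (n * d / β)) ≤ 2 * Real.logb 2 U := by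
    rw [Real.logb_mul (by positivity) (by positivity)]
    have := Real.logb_le_logb_of_le (b := 2) (by norm_num) (by linarith) hnU
    linarith
  have hX1 : 1 ≤ Real.logb 2 (U * Real.logb 2 (n * d / β)) := one_le_logb_two (by nlinarith)
  set X := Real.logb 2 (U * Real.logb 2 (n * d / β))
  have hu := one_le_logb_two hU'
  have hm := one_le_logb_two hn'
  have hld : 0 ≤ Real.logb 2 (d : ℝ) := Real.logb_nonneg (by norm_num) hd'
  have hlX : Real.logb 2 X ≤ 1 + Real.logb 2 (Real.logb 2 U) := by
    have h := Real.logb_le_logb_of_le (b := 2) (by norm_num) (by linarith) hX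
    rwa [Real.logb_mul (by norm_num) (by positivity), Real.logb_self_eq_one (by norm_num)] at h
  have hll : Real.logb 2 (Real.logb 2 U) ≤ Real.logb 2 d + Real.logb 2 n := by
    have h := Real.logb_le_logb_of_le (b := 2) (by norm_num) (by linarith) hUn
    rw [Real.logb_mul (by positivity) (by positivity)] at h
    linarith
  have hll' : Real.logb 2 (Real.logb 2 U) ≤ Real.logb 2 U := by
    refine Real.logb_le_logb_of_le (by norm_num) (by linarith) ?_
    rw [Real.logb_le_iff_le_rpow (by norm_num) (by linarith), Real.rpow_natCast]
    exact_mod_cast Nat.lt_two_pow_self.le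
  set u := Real.logb 2 (U : ℝ)
  set m := Real.logb 2 (n : ℝ)
  have hmin1 : 1 ≤ min m u := le_min hm hu
  have hminll : Real.logb 2 u ≤ Real.logb 2 d + min m u := by
    rcases min_choice m u with h | h <;> rw [h] <;> linarith
  have hminX : min m X ≤ 2 * min m u := by
    rcases min_choice m u with h | h <;> rw [h]
    · exact (min_le_left _ _).trans (by linarith)
    · exact (min_le_right _ _).trans hX
  calc _ ≤ 27 * E * (4 * (Real.logb 2 d + min m u)) := by
        gcongr
        linarith
    _ = 108 * E * (Real.logb 2 d + min m u) := by ring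
    _ ≤ _ := by gcongr

end MessageSize

end ShuffleSum

end

theorem mainTheorem2 (ε₀ δ₀ β₀ : ℝ) (hδ₀ : δ₀ < 1) (hβ₀ : β₀ < 1) :
    ∃ C : ℝ, 0 < C ∧
      ∀ (d n U : ℕ) (H : Matrix (Fin d) (Fin d) ℤ) (ε δ β : ℝ),
        0 < d → 0 < n → 0 < U → H.IsHadamard →
        0 < ε → ε ≤ ε₀ → 0 < δ → δ ≤ δ₀ → 0 < β → β ≤ β₀ →
        -- privacy of the messages received by the analyzer, for every choice of the public signs
        (ε ≤ 3 * Real.logb 2 (2 / δ) →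
          ∀ σ : Fin d → ℤˣ,
            IsDP (fun D : Fin n → Fin d → ℤ =>
              shuffled (highDimRandomizer H n U ε δ β σ) D) ε δ) ∧
        -- `ℓ₂` error
        (2 ≤ U →
          ∀ D : Fin n → Fin d → ℤ, maxL2 D ≤ U →
            ENNReal.ofReal (1 - β) ≤ (highDimOutput H U ε δ β D).toOuterMeasure
              {y | l2norm (fun k => y k - ∑ i, (D i k : ℝ)) ≤
                C * (maxL2 D *
                  Real.sqrt (d * Real.logb 2 (n * d / β) * Real.logb 2 (1 / δ)) *
                  Real.logb 2 (d * Real.logb 2 U / β) / ε)}) ∧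
        -- expected number of messages of each user, for every choice of the public signs
        (2 ≤ U → 2 ≤ n → δ ≤ 1 / n →
          ∀ D : Fin n → Fin d → ℤ, maxL2 D ≤ U → ∀ (σ : Fin d → ℤˣ) (i : Fin n),
            expectedCard (highDimRandomizer H n U ε δ β σ (D i)) ≤
              ENNReal.ofReal (d + C * ((d : ℝ) ^ (1.5 : ℝ) *
                Real.logb 2 (U * Real.logb 2 (n * d / β)) *
                Real.logb 2 (d / δ) ^ (1.5 : ℝ) * Real.logb 2 n ^ 2 /
                (ε * Real.sqrt n)))) ∧
        -- size of each message
        (2 ≤ U → 2 ≤ n →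
          EncodableInBits (possibleMessages H n U ε δ β)
            (C * (Real.logb 2 d + Real.logb 2 (Real.logb 2 (U * Real.logb 2 (n * d / β))) +
              min (Real.logb 2 n) (Real.logb 2 (U * Real.logb 2 (n * d / β))))) ∧
          (Real.logb 2 (n * d / β) ≤ U → Real.logb 2 U ≤ n * d →
            EncodableInBits (possibleMessages H n U ε δ β)
              (C * (Real.logb 2 d + min (Real.logb 2 n) (Real.logb 2 U))))) := by
  obtain ⟨cβ, hcβ1, hcβ⟩ := exists_one_le_mul_logb hβ₀
  obtain ⟨cδ, hcδ1, hcδ⟩ := exists_one_le_mul_logb hδ₀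
  set c := max cβ cδ
  set E := max 1 ε₀
  have hc : 1 ≤ c := hcβ1.trans (le_max_left _ _)
  have hE : 1 ≤ E := le_max_left _ _
  set C := 280000000000 * E ^ 5 * c ^ 2
  have hE5 : E ≤ E ^ 5 := le_self_pow₀ hE (by norm_num)
  have hc2 : 1 ≤ c ^ 2 := one_le_pow₀ hc
  have hC5 : 280000000000 * E ^ 5 ≤ C := le_mul_of_one_le_right (by positivity) hc2
  have hC2 : 7680 * E * c ^ 2 ≤ C := mul_le_mul_of_nonneg_right (by linarith) (by positivity)
  refine ⟨C, by positivity, ?_⟩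
  intro d n U H ε δ β hd hn _ hH hε hεε hδ hδδ hβ hββ
  have hδ1 : δ < 1 := hδδ.trans_lt hδ₀
  have hβ1 : β < 1 := hββ.trans_lt hβ₀
  have hεE : ε ≤ E := hεε.trans (le_max_right _ _)
  have hlβ : 0 ≤ Real.logb 2 (1 / β) :=
    Real.logb_nonneg (by norm_num) (by rw [le_div_iff₀ hβ]; linarith)
  have hlδ : 0 ≤ Real.logb 2 (1 / δ) :=
    Real.logb_nonneg (by norm_num) (by rw [le_div_iff₀ hδ]; linarith)
  refine ⟨fun h σ => highDim_isDP hd hε hδ hδ1 h, fun hU D hD => ?_,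
    fun hU hn2 hδn D _ σ i => ?_, fun hU hn2 => ⟨?_, fun h1 h2 => ?_⟩⟩
  · exact highDim_utility hd hn hU hβ hβ1 hε hδ hδ1 hc
      ((hcβ β hβ hββ).trans (mul_le_mul_of_nonneg_right (le_max_left _ _) hlβ))
      ((hcδ δ hδ hδδ).trans (mul_le_mul_of_nonneg_right (le_max_right _ _) hlδ))
      hE hεE hH hC2 D hD
  · exact highDim_communication hd hn2 hU hβ hβ1 hε hE hεE hδ hδn hC5 (D i)
  · exact highDim_messageSize hd hn2 hU hβ hβ1 hε hE hεE hδ hδ1 (by linarith)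
  · exact highDim_messageSize_of_le hd hn2 hU hβ hβ1 hε hE hεE hδ hδ1 (by linarith) h1 h2
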